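/- Let $k$ be a finite field and let $\mathcal A$ be an essentially small $k$-linear abelian category which is hereditary ($\mathrm{Ext}^n_{\mathcal A}=0$ for $n\ge 2$) and in which all spaces $\mathrm{Hom}_{\mathcal A}(X,Y)$ and $\mathrm{Ext}^1_{\mathcal A}(X,Y)$ are finite-dimensional. Let $t\ge 1$, and let $\mathcal C=\mathcal C_{\mathbb Z/t}(\mathcal A)$ be the abelian category of $\mathbb Z/t$-graded complexes $(M^i,\,d^i\colon M^i\to M^{i+1})_{i\in\mathbb Z/t}$, $d^{i+1}d^i=0$. Write $\mathrm{Iso}(-)$ for the set of isomorphism classes of objects, $\widehat X$ for the class of $X$ in the Grothendieck group $K_0(\mathcal A)$, and $\langle\widehat X,\widehat Y\rangle=|\mathrm{Hom}(X,Y)|/|\mathrm{Ext}^1(X,Y)|$ for the multiplicative Euler form, a bilinear form on $K_0(\mathcal A)$ with values in $\mathbb Q^\times$. The Ringel–Hall algebra $\mathcal H(\mathcal C)$ is the associative unital $\mathbb Q$-algebra with basis $\mathrm{Iso}(\mathcal C)$ and product $$[M]\diamond[N]=\sum_{[L]}\frac{|\mathrm{Ext}^1_{\mathcal C}(M,N)_L|}{|\mathrm{Hom}_{\mathcal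 C}(M,N)|}[L],$$ where $\mathrm{Ext}^1_{\mathcal C}(M,N)_L$ is the set of extension classes with middle term isomorphic to $L$. Let $J_{\mathbb Z/t}$ be the two-sided ideal generated by all differences $[M]-[N]$ with $H^i(M)\cong H^i(N)$ and $\widehat{\mathrm{Im}\,d^i_M}=\widehat{\mathrm{Im}\,d^i_N}$ for all $i\in\mathbb Z/t$. The semi-derived Ringel–Hall algebra $\mathcal{SDH}_{\mathbb Z/t}(\mathcal A)$ is the localization of $\mathcal H(\mathcal C)/J_{\mathbb Z/t}$ at the set of all $r[K]$ with $r\in\mathbb Q^\times$ and $K$ an acyclic complex. For $X\in\mathcal A$ and $i\in\mathbb Z/t$ let $U_{X,i}$ be the stalk complex with $X$ in degree $i$. If $t>1$, let $K_{X,i}$ be the acyclic complex $X\xrightarrow{1}X$ with $X$ in degrees $i-1$ and $i$; if $t=1$, let $K_{X,0}=\bigl(X\oplus X,\begin{pmatrix}0&1\\0&0\end{pmatrix}\bigr)$. Put $e=1$ if $t>1$ and $e=2$ if $t=1$. Then there are elements $K_{\alpha,i}$ ($\alpha\in K_0(\mathcal A)$, $i\in\mathbb Z/t$) of $\mathcal{SDH}_{\mathbb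 Z/t}(\mathcal A)$, well defined by $$K_{\alpha,i}=\frac{1}{\langle\alpha,\widehat B\rangle^{e}}\,[K_{A,i}]\diamond[K_{B,i}]^{-1}\qquad\text{whenever }\alpha=\widehat A-\widehat B,\ A,B\in\mathcal A,$$ and the elements $$K_{\alpha^0,0}\diamond K_{\alpha^1,1}\diamond\cdots\diamond K_{\alpha^{t-1},t-1}\diamond\Bigl[\bigoplus_{i\in\mathbb Z/t}U_{A^i,i}\Bigr],$$ indexed by all families $(\alpha^i)_{i\in\mathbb Z/t}$ in $K_0(\mathcal A)$ and $([A^i])_{i\in\mathbb Z/t}$ in $\mathrm{Iso}(\mathcal A)$, form a $\mathbb Q$-basis of $\mathcal{SDH}_{\mathbb Z/t}(\mathcal A)$. -/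

import Mathlib

open CategoryTheory CategoryTheory.Limits

open scoped ZeroObject

universe v u

namespace SemiDerivedHall

section Ext1
variable {C : Type u} [Category.{v} C] [Abelian C]

/- Mathlib's `Ext`-groups, in the universe in which they always exist. -/
attribute [local instance] HasExt.standard

/-- The group `Ext¹(X, Y)` of an abelian category. -/
abbrev Ext1 (X Y : C) : Type (max u v) := Abelian.Ext.{max u v} X Y 1

/-- The short sequence `0 ⟶ B ⟶ X ⟶ A ⟶ 0` given by `f`, `g` is exact. -/
def IsSES {A B X : C} (f : B ⟶ X) (g : X ⟶ A) : Prop :=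
  ∃ w : f ≫ g = 0, (ShortComplex.mk f g w).ShortExact

namespace IsSES
variable {A B X X' : C} {f : B ⟶ X} {g : X ⟶ A} {f' : B ⟶ X'} {g' : X' ⟶ A}

theorem w (h : IsSES f g) : f ≫ g = 0 := h.elim fun w _ => w

theorem shortExact (h : IsSES f g) : (ShortComplex.mk f g h.w).ShortExact := h.elim fun _ s => s

/-- The class in `Ext¹(A, B)` of a short exact sequence `0 ⟶ B ⟶ X ⟶ A ⟶ 0`. -/
noncomputable def cls (h : IsSES f g) : Ext1 A B :=
  h.shortExact.extClass

theorem mono (h : IsSES f g) : Mono f := h.shortExact.mono_f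

theorem epi (h : IsSES f g) : Epi g := h.shortExact.epi_g

theorem exists_lift (h : IsSES f g) {Z : C} (k : Z ⟶ X) (hk : k ≫ g = 0) :
    ∃ l : Z ⟶ B, l ≫ f = k := by
  obtain ⟨w, s⟩ := h
  have := s.mono_f
  exact ⟨s.exact.lift k hk, s.exact.lift_f k hk⟩

theorem exists_desc (h : IsSES f g) {Z : C} (k : X ⟶ Z) (hk : f ≫ k = 0) :
    ∃ l : A ⟶ Z, g ≫ l = k := by
  obtain ⟨w, s⟩ := h
  have := s.epi_g
  exact ⟨s.exact.desc k hk, s.exact.g_desc k hk⟩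

theorem of_mono_epi [Mono f] [Epi g] (w : f ≫ g = 0)
    (h : ∀ {Z : C} (k : Z ⟶ X), k ≫ g = 0 → ∃ l : Z ⟶ B, l ≫ f = k) : IsSES f g := by
  refine ⟨w, ShortComplex.ShortExact.mk' (ShortComplex.exact_of_f_is_kernel _ ?_) ‹_› ‹_›⟩
  exact KernelFork.IsLimit.ofι' f w fun k hk => ⟨(h k hk).choose, (h k hk).choose_spec⟩

theorem of_mono_epi' [Mono f] [Epi g] (w : f ≫ g = 0)
    (h : ∀ {Z : C} (k : X ⟶ Z), f ≫ k = 0 → ∃ l : A ⟶ Z, g ≫ l = k) : IsSES f g := by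
  refine ⟨w, ShortComplex.ShortExact.mk' (ShortComplex.exact_of_g_is_cokernel _ ?_) ‹_› ‹_›⟩
  exact CokernelCofork.IsColimit.ofπ' g w fun k hk => ⟨(h k hk).choose, (h k hk).choose_spec⟩

open Abelian.Ext in
/-- Two short exact sequences with the same class are equivalent extensions. -/
theorem exists_iso_of_cls_eq (h : IsSES f g) (h' : IsSES f' g') (e : h.cls = h'.cls) :
    ∃ φ : X ≅ X', f ≫ φ.hom = f' ∧ φ.hom ≫ g' = g := by
  obtain ⟨w, s⟩ := id h
  obtain ⟨w', s'⟩ := id h'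
  change s.extClass = s'.extClass at e
  have := h.epi
  obtain ⟨φ₀, hφ⟩ := contravariant_sequence_exact₁ s (Y := X') (mk₀ f') (n₁ := 1) rfl
    (by rw [e]; exact s'.extClass_comp)
  obtain ⟨φ, rfl⟩ := (mk₀_bijective _ _).2 φ₀
  simp only [mk₀_comp_mk₀] at hφ
  have hφ' : f ≫ φ = f' := (mk₀_bijective _ _).1 hφ
  obtain ⟨u, hu⟩ := h.exists_desc (φ ≫ g') (by rw [← Category.assoc, hφ', w'])
  have key : (mk₀ (u - 𝟙 A)).comp s'.extClass (zero_add 1) = 0 := by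
    have := ShortComplex.ShortExact.extClass_naturality s s'
      { τ₁ := 𝟙 B, τ₂ := φ, τ₃ := u, comm₁₂ := by simpa using hφ'.symm, comm₂₃ := hu.symm }
    dsimp at this
    rw [sub_eq_add_neg, mk₀_add, add_comp, ← this, mk₀_neg, neg_comp, mk₀_id_comp, comp_mk₀_id, e]
    exact add_neg_cancel _
  obtain ⟨v₀, hv⟩ := covariant_sequence_exact₃ (hS := s') _ _ (n₁ := 1) rfl key
  obtain ⟨v, rfl⟩ := (mk₀_bijective _ _).2 v₀
  simp only [mk₀_comp_mk₀] at hv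
  have hv' : v ≫ g' = u - 𝟙 A := (mk₀_bijective _ _).1 hv
  let ψ : ShortComplex.mk f g w ⟶ ShortComplex.mk f' g' w' :=
    { τ₁ := 𝟙 B, τ₂ := φ - g ≫ v, τ₃ := 𝟙 A
      comm₁₂ := by simp [hφ', reassoc_of% w]
      comm₂₃ := by simp [hv', hu] }
  have i1 : IsIso ψ.τ₁ := inferInstanceAs (IsIso (𝟙 B))
  have i3 : IsIso ψ.τ₃ := inferInstanceAs (IsIso (𝟙 A))
  have i2 : IsIso (φ - g ≫ v) := ShortComplex.isIso₂_of_shortExact_of_isIso₁₃' ψ s s' i1 i3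
  exact ⟨asIso (φ - g ≫ v), by simp [hφ', reassoc_of% w], by simp [hv', hu]⟩

open Abelian.Ext in
theorem cls_eq_of_comm (h : IsSES f g) (h' : IsSES f' g') (φ : X ⟶ X') (h1 : f ≫ φ = f')
    (h2 : φ ≫ g' = g) : h.cls = h'.cls := by
  have := ShortComplex.ShortExact.extClass_naturality h.shortExact h'.shortExact
      { τ₁ := 𝟙 B, τ₂ := φ, τ₃ := 𝟙 A, comm₁₂ := by simpa using h1.symm, comm₂₃ := by simpa using h2 }
  dsimp at this
  rwa [mk₀_id_comp, comp_mk₀_id] at this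

end IsSES

/-- Every element of `Ext¹(A, B)` is the class of a short exact sequence. -/
theorem exists_isSES_cls {A B : C} (ξ : Ext1 A B) :
    ∃ (X : C) (f : B ⟶ X) (g : X ⟶ A) (h : IsSES f g), h.cls = ξ := by
  let := HasDerivedCategory.standard C
  let F := DerivedCategory.singleFunctor C 0
  let δ : F.obj A ⟶ (F.obj B)⟦(1 : ℤ)⟧ := ξ.hom
  obtain ⟨X, f₀, g₀, hT₀⟩ := Pretriangulated.distinguished_cocone_triangle₂ δ
  have h1 : X.IsLE 0 := DerivedCategory.TStructure.t.isLE₂ _ hT₀ 0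
    (inferInstanceAs ((DerivedCategory.singleFunctor C 0).obj B |>.IsLE 0))
    (inferInstanceAs ((DerivedCategory.singleFunctor C 0).obj A |>.IsLE 0))
  have h2 : X.IsGE 0 := DerivedCategory.TStructure.t.isGE₂ _ hT₀ 0
    (inferInstanceAs ((DerivedCategory.singleFunctor C 0).obj B |>.IsGE 0))
    (inferInstanceAs ((DerivedCategory.singleFunctor C 0).obj A |>.IsGE 0))
  obtain ⟨Y, ⟨e⟩⟩ := X.exists_iso_singleFunctor_obj_of_isGE_of_isLE 0
  obtain ⟨f, hf⟩ := F.map_surjective (f₀ ≫ e.hom)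
  obtain ⟨g, hg⟩ := F.map_surjective (e.inv ≫ g₀)
  have hT : Pretriangulated.Triangle.mk (F.map f) (F.map g) δ ∈ Pretriangulated.distinguishedTriangles := by
    refine Pretriangulated.isomorphic_distinguished _ hT₀ _ ?_
    refine Pretriangulated.Triangle.isoMk _ _ (Iso.refl _) e.symm (Iso.refl _) ?_ ?_ ?_
    · change F.map f ≫ e.inv = 𝟙 (F.obj B) ≫ f₀
      rw [hf, Category.assoc, e.hom_inv_id, Category.comp_id, Category.id_comp]
    · change F.map g ≫ 𝟙 (F.obj A) = e.inv ≫ g₀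
      rw [hg, Category.comp_id]
    · change δ ≫ (𝟙 (F.obj B))⟦(1 : ℤ)⟧' = 𝟙 (F.obj A) ≫ δ
      rw [CategoryTheory.Functor.map_id, Category.comp_id, Category.id_comp]
  have w : f ≫ g = 0 := F.map_injective (by
    rw [F.map_comp, F.map_zero]; exact Pretriangulated.comp_distTriang_mor_zero₁₂ _ hT)
  have hmono : Mono f := by
    rw [Preadditive.mono_iff_cancel_zero]
    intro Z k hk
    apply F.map_injective
    have hT' := Pretriangulated.inv_rot_of_distTriang _ hT
    obtain ⟨r, hr⟩ := Pretriangulated.Triangle.coyoneda_exact₂ _ hT' (F.map k)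
      (by
        refine (F.map_comp _ _).symm.trans ?_
        exact (congrArg F.map hk).trans (F.map_zero _ _))
    have hz : r = 0 := by
      have := (DerivedCategory.TStructure.t (C := C)).isGE_shift (F.obj A) 0 (-1) 1
      exact (DerivedCategory.TStructure.t (C := C)).zero_of_isLE_of_isGE r 0 1 (by lia)
        (inferInstanceAs ((DerivedCategory.singleFunctor C 0).obj Z |>.IsLE 0)) this
    rw [F.map_zero]
    refine hr.trans ?_
    rw [hz]
    exact zero_comp
  have hepi : Epi g := by
    rw [Preadditive.epi_iff_cancel_zero]
    intro Z k hk
    apply F.map_injective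
    obtain ⟨r, hr⟩ := Pretriangulated.Triangle.yoneda_exact₃ _ hT (F.map k)
      (by
        refine (F.map_comp _ _).symm.trans ?_
        exact (congrArg F.map hk).trans (F.map_zero _ _))
    have hz : r = 0 := by
      have := (DerivedCategory.TStructure.t (C := C)).isLE_shift (F.obj B) 0 1 (-1)
      exact (DerivedCategory.TStructure.t (C := C)).zero_of_isLE_of_isGE r (-1) 0 (by lia) this
        (inferInstanceAs ((DerivedCategory.singleFunctor C 0).obj Z |>.IsGE 0))
    rw [F.map_zero]
    refine hr.trans ?_
    rw [hz]
    exact comp_zero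
  have hs : IsSES f g := IsSES.of_mono_epi w (by
    intro Z k hk
    obtain ⟨r, hr⟩ := Pretriangulated.Triangle.coyoneda_exact₂ _ hT (F.map k)
      (by
        refine (F.map_comp _ _).symm.trans ?_
        exact (congrArg F.map hk).trans (F.map_zero _ _))
    obtain ⟨l, rfl⟩ := F.map_surjective r
    exact ⟨l, F.map_injective (by rw [F.map_comp]; exact hr.symm)⟩)
  refine ⟨Y, f, g, hs, ?_⟩
  ext
  change (hs.shortExact.extClass).hom = _
  rw [ShortComplex.ShortExact.extClass_hom]
  have hT2 := hs.shortExact.singleTriangle_distinguished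
  obtain ⟨c, hc1, hc2⟩ := Pretriangulated.complete_distinguished_triangle_morphism _ _ hT2 hT
    (𝟙 _) (𝟙 _) ((Category.comp_id _).trans (Category.id_comp _).symm)
  obtain ⟨c, rfl⟩ := F.map_surjective c
  have hgc : g ≫ c = g := F.map_injective (by
    rw [F.map_comp]; refine hc1.trans ?_; exact Category.id_comp _)
  have hc : c = 𝟙 A := by rw [← cancel_epi g, hgc, Category.comp_id]
  subst hc
  have hc3 : hs.shortExact.singleδ ≫ (𝟙 (F.obj B))⟦(1 : ℤ)⟧' = F.map (𝟙 A) ≫ δ := hc2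
  rw [F.map_id, CategoryTheory.Functor.map_id, Category.comp_id, Category.id_comp] at hc3
  exact hc3


end Ext1

/-- `|Hom(X, Y)| < ∞` and `|Ext¹(X, Y)| < ∞` for all `X`, `Y`. For a category that is linear over
a finite field this says that these spaces are finite-dimensional. -/
class FinitaryCategory (C : Type u) [Category.{v} C] [Abelian C] : Prop where
  finite_hom : ∀ X Y : C, Finite (X ⟶ Y)
  finite_ext : ∀ X Y : C, Finite (Ext1 X Y)

attribute [instance] FinitaryCategory.finite_hom FinitaryCategory.finite_ext

/-- `Iso(C)`: the isomorphism classes of objects of `C`. -/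
abbrev IsoClass (C : Type u) [Category.{v} C] := Quotient (isIsomorphicSetoid C)

/-- The isomorphism class `[X]`. -/
abbrev isoClass {C : Type u} [Category.{v} C] (X : C) : IsoClass C := Quotient.mk _ X

/-- The chosen representative of `[X]` is isomorphic to `X`. -/
noncomputable def outIso {C : Type u} [Category.{v} C] (X : C) : (isoClass X).out ≅ X :=
  Classical.choice (@Quotient.mk_out _ (isIsomorphicSetoid C) X)

section Hall
variable {C : Type u} [Category.{v} C] [Abelian C]

/-- `Ext¹(A, B)_X`: the classes of the extensions `0 ⟶ B ⟶ X ⟶ A ⟶ 0`, that is, the elements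
of `Ext¹(A, B)` whose middle term is isomorphic to `X`. -/
def extMiddle (A B X : C) : Set (Ext1 A B) :=
  {ξ | ∃ (f : B ⟶ X) (g : X ⟶ A) (h : IsSES f g), h.cls = ξ}

/-- The structure constant `|Ext¹(A, B)_X| / |Hom(A, B)|`. -/
noncomputable def hallNumber (A B X : C) : ℚ :=
  (Nat.card (extMiddle A B X) : ℚ) / Nat.card (A ⟶ B)

/-- The pairs of morphisms forming a short exact sequence `0 ⟶ B ⟶ X ⟶ A ⟶ 0`. -/
abbrev SES (A B X : C) := {p : (B ⟶ X) × (X ⟶ A) // IsSES p.1 p.2}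

theorem IsSES.comp_iso {A B X X' : C} {f : B ⟶ X} {g : X ⟶ A} (h : IsSES f g) (φ : X ≅ X') :
    IsSES (f ≫ φ.hom) (φ.inv ≫ g) := by
  have := h.mono
  have := h.epi
  refine IsSES.of_mono_epi (by simp [h.w]) fun k hk => ?_
  obtain ⟨l, hl⟩ := h.exists_lift (k ≫ φ.inv) (by simpa using hk)
  exact ⟨l, by rw [reassoc_of% hl]; simp⟩

theorem IsSES.iso_comp {A B B' X : C} {f : B ⟶ X} {g : X ⟶ A} (h : IsSES f g) (φ : B' ≅ B) :
    IsSES (φ.hom ≫ f) g := by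
  have := h.mono
  have := h.epi
  refine IsSES.of_mono_epi (by simp [h.w]) fun k hk => ?_
  obtain ⟨l, hl⟩ := h.exists_lift k hk
  exact ⟨l ≫ φ.inv, by simpa using hl⟩

theorem IsSES.comp_iso' {A A' B X : C} {f : B ⟶ X} {g : X ⟶ A} (h : IsSES f g) (φ : A ≅ A') :
    IsSES f (g ≫ φ.hom) := by
  have := h.mono
  have := h.epi
  refine IsSES.of_mono_epi (by simp [reassoc_of% h.w]) fun k hk => ?_
  exact h.exists_lift k (by rw [← cancel_mono φ.hom]; simpa using hk)

/-- The automorphism `1 + g h f` of the middle term of an extension. -/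
def IsSES.shear {A B X : C} {f : B ⟶ X} {g : X ⟶ A} (e : IsSES f g) (h : A ⟶ B) : X ≅ X where
  hom := 𝟙 X + g ≫ h ≫ f
  inv := 𝟙 X - g ≫ h ≫ f
  hom_inv_id := by simp [reassoc_of% e.w]
  inv_hom_id := by simp [reassoc_of% e.w]

/-- The class of a short exact sequence with middle term `X`. -/
noncomputable def SES.toExt {A B X : C} (e : SES A B X) : extMiddle A B X :=
  ⟨e.2.cls, _, _, e.2, rfl⟩

theorem card_ses_mul (A B X : C) :
    Nat.card (SES A B X) * Nat.card (A ⟶ B) = Nat.card (extMiddle A B X) * Nat.card (X ≅ X) := by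
  rw [← Nat.card_prod, ← Nat.card_prod]
  have sec : ∀ ξ : extMiddle A B X, ∃ e : SES A B X, e.2.cls = ξ.1 := by
    rintro ⟨ξ, f, g, h, rfl⟩
    exact ⟨⟨(f, g), h⟩, rfl⟩
  choose s hs using sec
  have key : ∀ e : SES A B X, ∃ φ : X ≅ X,
      (s (SES.toExt e)).1.1 ≫ φ.hom = e.1.1 ∧ φ.hom ≫ e.1.2 = (s (SES.toExt e)).1.2 :=
    fun e => IsSES.exists_iso_of_cls_eq (s (SES.toExt e)).2 e.2 (hs _)
  choose φ h1 h2 using key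
  let F : SES A B X × (A ⟶ B) → extMiddle A B X × (X ≅ X) := fun q =>
    (SES.toExt q.1, φ q.1 ≪≫ q.1.2.shear q.2)
  refine Nat.card_congr (Equiv.ofBijective F ⟨?_, ?_⟩)
  · rintro ⟨e, h⟩ ⟨e', h'⟩ hq
    have hc : SES.toExt e = SES.toExt e' := congrArg Prod.fst hq
    have hθ : (φ e).hom ≫ (𝟙 X + e.1.2 ≫ h ≫ e.1.1) = (φ e').hom ≫ (𝟙 X + e'.1.2 ≫ h' ≫ e'.1.1) :=
      congrArg Iso.hom (congrArg Prod.snd hq)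
    have a1 := h1 e
    have a2 := h2 e
    have b1 := h1 e'
    have b2 := h2 e'
    rw [hc] at a1 a2
    have c1 : e.1.1 = e'.1.1 := by
      have := congrArg (fun t => (s (SES.toExt e')).1.1 ≫ t) hθ
      rw [reassoc_of% a1, reassoc_of% b1] at this
      simpa [reassoc_of% e.2.w, reassoc_of% e'.2.w] using this
    have c2 : e.1.2 = e'.1.2 := by
      have l1 : ((φ e).hom ≫ (𝟙 X + e.1.2 ≫ h ≫ e.1.1)) ≫ e.1.2 = (φ e).hom ≫ e.1.2 := by
        simp [e.2.w]
      have l2 : ((φ e').hom ≫ (𝟙 X + e'.1.2 ≫ h' ≫ e'.1.1)) ≫ e'.1.2 = (φ e').hom ≫ e'.1.2 := by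
        simp [e'.2.w]
      rw [← cancel_epi ((φ e ≪≫ e.2.shear h).hom)]
      change ((φ e).hom ≫ (𝟙 X + e.1.2 ≫ h ≫ e.1.1)) ≫ e.1.2 =
        ((φ e).hom ≫ (𝟙 X + e.1.2 ≫ h ≫ e.1.1)) ≫ e'.1.2
      rw [l1, hθ, l2, a2, b2]
    obtain rfl : e = e' := Subtype.ext (Prod.ext c1 c2)
    have := e.2.mono
    have := e.2.epi
    have h3 : e.1.2 ≫ h ≫ e.1.1 = e.1.2 ≫ h' ≫ e.1.1 := by simpa using hθ
    rw [cancel_epi, cancel_mono] at h3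
    rw [h3]
  · rintro ⟨ξ, θ⟩
    let e : SES A B X := ⟨((s ξ).1.1 ≫ θ.hom, θ.inv ≫ (s ξ).1.2), (s ξ).2.comp_iso θ⟩
    have e1 : e.1.1 = (s ξ).1.1 ≫ θ.hom := rfl
    have e2 : e.1.2 = θ.inv ≫ (s ξ).1.2 := rfl
    have hc : SES.toExt e = ξ := Subtype.ext
      (((s ξ).2.cls_eq_of_comm e.2 θ.hom rfl (by simp [e2])).symm.trans (hs ξ))
    have a1 := h1 e
    have a2 := h2 e
    rw [hc] at a1 a2
    have m := e.2.mono
    have ep := e.2.epi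
    have r1 : e.1.1 ≫ ((φ e).inv ≫ θ.hom - 𝟙 X) = 0 := by
      rw [Preadditive.comp_sub, Category.comp_id, sub_eq_zero]
      nth_rw 1 [← a1]
      simp [e1]
    have r2 : ((φ e).inv ≫ θ.hom - 𝟙 X) ≫ e.1.2 = 0 := by
      rw [Preadditive.sub_comp, Category.id_comp, sub_eq_zero]
      nth_rw 1 [e2]
      simp [← a2]
    obtain ⟨k, hk⟩ := e.2.exists_desc _ r1
    obtain ⟨h, hh⟩ := e.2.exists_lift k (by rw [← cancel_epi e.1.2, reassoc_of% hk, r2, comp_zero])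
    refine ⟨(e, h), Prod.ext hc (Iso.ext ?_)⟩
    change (φ e).hom ≫ (𝟙 X + e.1.2 ≫ h ≫ e.1.1) = θ.hom
    rw [hh, hk]
    simp

/-! Two-step filtrations of an object `L`. -/

theorem filtration_left {A B D X L Y : C} {b : B ⟶ X} {a : X ⟶ A} {c : D ⟶ L} {p : L ⟶ X}
    {y : Y ⟶ L} (h1 : IsSES b a) (h2 : IsSES c p) (h3 : IsSES y (p ≫ a)) :
    ∃ (c' : D ⟶ Y) (r : Y ⟶ B), c' ≫ y = c ∧ r ≫ b = y ≫ p ∧ IsSES c' r := by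
  have := h1.mono
  have := h2.mono
  have := h2.epi
  have := h3.mono
  obtain ⟨c', hc⟩ := h3.exists_lift c (by rw [reassoc_of% h2.w, zero_comp])
  obtain ⟨r, hr⟩ := h1.exists_lift (y ≫ p) (by rw [Category.assoc, h3.w])
  refine ⟨c', r, hc, hr, ?_⟩
  have : Mono c' := by
    have : Mono (c' ≫ y) := by rw [hc]; infer_instance
    exact mono_of_mono c' y
  have : Epi r := by
    obtain ⟨m, hm⟩ := h3.exists_lift (pullback.fst p b)
      (by rw [pullback.condition_assoc, h1.w, comp_zero])
    have e : m ≫ r = pullback.snd p b := by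
      rw [← cancel_mono b, Category.assoc, hr, reassoc_of% hm, pullback.condition]
    have : Epi (m ≫ r) := by rw [e]; infer_instance
    exact epi_of_epi m r
  refine IsSES.of_mono_epi ?_ fun k hk => ?_
  · rw [← cancel_mono b, Category.assoc, hr, reassoc_of% hc, h2.w, zero_comp]
  · obtain ⟨l, hl⟩ := h2.exists_lift (k ≫ y)
      (by rw [Category.assoc, ← hr, reassoc_of% hk, zero_comp])
    exact ⟨l, by rw [← cancel_mono y, Category.assoc, hc, hl]⟩

theorem filtration_right {A B D X L Y : C} {c' : D ⟶ Y} {r : Y ⟶ B} {y : Y ⟶ L} {a' : L ⟶ A}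
    {p : L ⟶ X} (h1 : IsSES c' r) (h2 : IsSES y a') (h3 : IsSES (c' ≫ y) p) :
    ∃ (b : B ⟶ X) (a : X ⟶ A), p ≫ a = a' ∧ r ≫ b = y ≫ p ∧ IsSES b a := by
  have := h1.epi
  have := h2.mono
  have := h2.epi
  have := h3.epi
  obtain ⟨a, ha⟩ := h3.exists_desc a' (by rw [Category.assoc, h2.w, comp_zero])
  obtain ⟨b, hb⟩ := h1.exists_desc (y ≫ p) (by rw [← Category.assoc, h3.w])
  refine ⟨b, a, ha, hb, ?_⟩
  have : Epi a := by
    have : Epi (p ≫ a) := by rw [ha]; infer_instance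
    exact epi_of_epi p a
  have : Mono b := by
    obtain ⟨m, hm⟩ := h3.exists_desc (pushout.inl y r)
      (by rw [Category.assoc, pushout.condition, reassoc_of% h1.w, zero_comp])
    have e : b ≫ m = pushout.inr y r := by
      rw [← cancel_epi r, reassoc_of% hb, hm, pushout.condition]
    have : Mono (b ≫ m) := by rw [e]; infer_instance
    exact mono_of_mono b m
  refine IsSES.of_mono_epi' ?_ fun k hk => ?_
  · rw [← cancel_epi r, reassoc_of% hb, ha, h2.w, comp_zero]
  · obtain ⟨l, hl⟩ := h2.exists_desc (p ≫ k)
      (by rw [← reassoc_of% hb, hk, comp_zero])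
    exact ⟨l, by rw [← cancel_epi p, reassoc_of% ha, hl]⟩

theorem card_filtrations (A B D X L Y : C) :
    Nat.card (Σ e : SES A B X × SES X D L, {y : Y ⟶ L // IsSES y (e.2.1.2 ≫ e.1.1.2)}) =
    Nat.card (Σ e : SES B D Y × SES A Y L, {p : L ⟶ X // IsSES (e.1.1.1 ≫ e.2.1.1) p}) := by
  have key := fun q : (Σ e : SES A B X × SES X D L, {y : Y ⟶ L // IsSES y (e.2.1.2 ≫ e.1.1.2)}) =>
    filtration_left q.1.1.2 q.1.2.2 q.2.2
  choose c' r hc hr hs using key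
  refine Nat.card_congr (Equiv.ofBijective (fun q =>
    ⟨(⟨(c' q, r q), hs q⟩, ⟨(q.2.1, q.1.2.1.2 ≫ q.1.1.1.2), q.2.2⟩),
      ⟨q.1.2.1.2, by dsimp; rw [hc]; exact q.1.2.2⟩⟩) ⟨?_, ?_⟩)
  · intro q q' h
    have h1 : c' q = c' q' := congrArg (fun t => t.1.1.1.1) h
    have h2 : r q = r q' := congrArg (fun t => t.1.1.1.2) h
    have h3 : q.2.1 = q'.2.1 := congrArg (fun t => t.1.2.1.1) h
    have h4 : q.1.2.1.2 ≫ q.1.1.1.2 = q'.1.2.1.2 ≫ q'.1.1.1.2 := congrArg (fun t => t.1.2.1.2) h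
    have h5 : q.1.2.1.2 = q'.1.2.1.2 := congrArg (fun t => t.2.1) h
    have := q'.1.2.2.epi
    have := (hs q').epi
    have h6 : q.1.1.1.2 = q'.1.1.1.2 := by rw [h5, cancel_epi] at h4; exact h4
    have h7 : q.1.1.1.1 = q'.1.1.1.1 := by
      rw [← cancel_epi (r q'), hr, ← h2, hr, h3, h5]
    have h8 : q.1.2.1.1 = q'.1.2.1.1 := by rw [← hc, ← hc, h1, h3]
    exact Sigma.subtype_ext (Prod.ext (Subtype.ext (Prod.ext h7 h6))
      (Subtype.ext (Prod.ext h8 h5))) h3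
  · rintro ⟨⟨⟨⟨d, s⟩, h1⟩, ⟨⟨y, a'⟩, h2⟩⟩, ⟨p, h3⟩⟩
    dsimp at h1 h2 h3
    obtain ⟨b, a, ha, hb, h4⟩ := filtration_right h1 h2 h3
    subst ha
    let q : (Σ e : SES A B X × SES X D L, {y : Y ⟶ L // IsSES y (e.2.1.2 ≫ e.1.1.2)}) :=
      ⟨(⟨(b, a), h4⟩, ⟨(d ≫ y, p), h3⟩), ⟨y, h2⟩⟩
    have m1 := h2.mono
    have m2 := h4.mono
    have e1 : c' q = d := by
      rw [← cancel_mono y]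
      exact hc q
    have e2 : r q = s := by
      rw [← cancel_mono b, hb]
      exact hr q
    exact ⟨q, Sigma.subtype_ext (Prod.ext (Subtype.ext (Prod.ext e1 e2)) rfl) rfl⟩

variable [FinitaryCategory C]

instance (X Y : C) : Finite (X ≅ Y) := Finite.of_injective (fun e => e.hom) fun _ _ h => Iso.ext h

theorem card_iso_pos (X : C) : (0 : ℚ) < Nat.card (X ≅ X) := by
  have : Nonempty (X ≅ X) := ⟨Iso.refl X⟩
  exact_mod_cast Nat.card_pos

/-- Riedtmann's formula. -/
theorem hallNumber_eq (A B X : C) :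
    hallNumber A B X = (Nat.card (SES A B X) : ℚ) / Nat.card (X ≅ X) := by
  have h1 : (0 : ℚ) < Nat.card (A ⟶ B) := by exact_mod_cast Nat.card_pos
  have h2 := card_iso_pos X
  rw [hallNumber, div_eq_div_iff h1.ne' h2.ne']
  exact_mod_cast (card_ses_mul A B X).symm

theorem hallNumber_ne_zero_iff (A B X : C) : hallNumber A B X ≠ 0 ↔ Nonempty (SES A B X) := by
  rw [hallNumber_eq, div_ne_zero_iff, and_iff_left (card_iso_pos X).ne', Nat.cast_ne_zero,
    Nat.card_ne_zero]
  exact and_iff_left inferInstance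

theorem hallNumber_congr {A A' B B' X X' : C} (a : A ≅ A') (b : B ≅ B') (x : X ≅ X') :
    hallNumber A B X = hallNumber A' B' X' := by
  rw [hallNumber_eq, hallNumber_eq]
  congr 2
  · refine Nat.card_congr
      { toFun := fun e => ⟨(b.inv ≫ e.1.1 ≫ x.hom, (x.inv ≫ e.1.2) ≫ a.hom),
          ((e.2.comp_iso x).comp_iso' a).iso_comp b.symm⟩
        invFun := fun e => ⟨(b.hom ≫ e.1.1 ≫ x.inv, (x.hom ≫ e.1.2) ≫ a.inv),
          ((e.2.comp_iso x.symm).comp_iso' a.symm).iso_comp b⟩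
        left_inv := fun e => by simp
        right_inv := fun e => by simp }
  · exact Nat.card_congr
      { toFun := fun φ => x.symm ≪≫ φ ≪≫ x
        invFun := fun φ => x ≪≫ φ ≪≫ x.symm
        left_inv := fun e => by ext; simp
        right_inv := fun e => by ext; simp }

theorem finite_setOf_hallNumber_ne_zero (A B : C) :
    {x : IsoClass C | hallNumber A B x.out ≠ 0}.Finite := by
  have key : ∀ x : {x : IsoClass C | hallNumber A B x.out ≠ 0}, Nonempty (SES A B x.1.out) :=
    fun x => (hallNumber_ne_zero_iff _ _ _).1 x.2
  let s := fun x => (key x).some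
  have : Finite {x : IsoClass C | hallNumber A B x.out ≠ 0} := by
    refine Finite.of_injective (fun x => (s x).2.cls) fun x y h => Subtype.ext ?_
    obtain ⟨φ, -⟩ := (s x).2.exists_iso_of_cls_eq (s y).2 h
    rw [← Quotient.out_eq x.1, ← Quotient.out_eq y.1]
    exact Quotient.sound ⟨φ⟩
  exact Set.toFinite _

/-- The product `[A] ⋄ [B] = ∑_[X] |Ext¹(A, B)_X| / |Hom(A, B)| [X]` of two isomorphism classes. -/
noncomputable def hallProd (a b : IsoClass C) : IsoClass C →₀ ℚ :=
  Finsupp.ofSupportFinite (fun x => hallNumber a.out b.out x.out)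
    (finite_setOf_hallNumber_ne_zero _ _)

theorem hallProd_apply (A B X : C) :
    hallProd (isoClass A) (isoClass B) (isoClass X) = hallNumber A B X :=
  hallNumber_congr (outIso A) (outIso B) (outIso X)

theorem hallProd_apply_out (a b x : IsoClass C) :
    hallProd a b x = (Nat.card (SES a.out b.out x.out) : ℚ) / Nat.card (x.out ≅ x.out) :=
  hallNumber_eq _ _ _

/-! Associativity: both iterated products count two-step filtrations. -/

theorem sum_card_kernels {A L : C} (g : L ⟶ A) (S : Finset (IsoClass C))
    (hS : ∃ y ∈ S, ∃ k : y.out ⟶ L, IsSES k g) :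
    ∑ y ∈ S, (Nat.card {k : y.out ⟶ L // IsSES k g} : ℚ) / Nat.card (y.out ≅ y.out) = 1 := by
  obtain ⟨y, hy, k, hk⟩ := hS
  have := hk.mono
  have lift : ∀ {Y : C} (k' : Y ⟶ L), IsSES k' g → ∃ φ : Y ≅ y.out, φ.hom ≫ k = k' := by
    intro Y k' hk'
    have := hk'.mono
    obtain ⟨l, hl⟩ := hk.exists_lift k' hk'.w
    obtain ⟨m, hm⟩ := hk'.exists_lift k hk.w
    exact ⟨⟨l, m, by rw [← cancel_mono k']; simp [hl, hm], by rw [← cancel_mono k]; simp [hl, hm]⟩, hl⟩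
  rw [Finset.sum_eq_single_of_mem y hy]
  · rw [div_eq_one_iff_eq (card_iso_pos _).ne']
    congr 1
    refine Nat.card_congr (Equiv.ofBijective (fun φ : y.out ≅ y.out =>
      (⟨φ.hom ≫ k, hk.iso_comp φ⟩ : {k : y.out ⟶ L // IsSES k g})) ⟨?_, ?_⟩).symm
    · intro φ ψ h
      exact Iso.ext ((cancel_mono k).1 (congrArg Subtype.val h))
    · rintro ⟨k', hk'⟩
      obtain ⟨φ, hφ⟩ := lift k' hk'
      exact ⟨φ, Subtype.ext hφ⟩
  · intro z _ hz
    have : IsEmpty {k : z.out ⟶ L // IsSES k g} := ⟨fun k' => hz (by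
      obtain ⟨φ, -⟩ := lift k'.1 k'.2
      rw [← Quotient.out_eq z, ← Quotient.out_eq y]
      exact Quotient.sound ⟨φ⟩)⟩
    simp

theorem sum_card_cokernels {D L : C} (f : D ⟶ L) (S : Finset (IsoClass C))
    (hS : ∃ y ∈ S, ∃ k : L ⟶ y.out, IsSES f k) :
    ∑ y ∈ S, (Nat.card {k : L ⟶ y.out // IsSES f k} : ℚ) / Nat.card (y.out ≅ y.out) = 1 := by
  obtain ⟨y, hy, k, hk⟩ := hS
  have := hk.epi
  have desc : ∀ {Y : C} (k' : L ⟶ Y), IsSES f k' → ∃ φ : y.out ≅ Y, k ≫ φ.hom = k' := by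
    intro Y k' hk'
    have := hk'.epi
    obtain ⟨l, hl⟩ := hk.exists_desc k' hk'.w
    obtain ⟨m, hm⟩ := hk'.exists_desc k hk.w
    exact ⟨⟨l, m, by rw [← cancel_epi k]; simp [reassoc_of% hl, hm],
      by rw [← cancel_epi k']; simp [hl, reassoc_of% hm]⟩, hl⟩
  rw [Finset.sum_eq_single_of_mem y hy]
  · rw [div_eq_one_iff_eq (card_iso_pos _).ne']
    congr 1
    refine Nat.card_congr (Equiv.ofBijective (fun φ : y.out ≅ y.out =>
      (⟨k ≫ φ.hom, hk.comp_iso' φ⟩ : {k : L ⟶ y.out // IsSES f k})) ⟨?_, ?_⟩).symm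
    · intro φ ψ h
      exact Iso.ext ((cancel_epi k).1 (congrArg Subtype.val h))
    · rintro ⟨k', hk'⟩
      obtain ⟨φ, hφ⟩ := desc k' hk'
      exact ⟨φ, Subtype.ext hφ⟩
  · intro z _ hz
    have : IsEmpty {k : L ⟶ z.out // IsSES f k} := ⟨fun k' => hz (by
      obtain ⟨φ, -⟩ := desc k'.1 k'.2
      rw [← Quotient.out_eq z, ← Quotient.out_eq y]
      exact Quotient.sound ⟨φ.symm⟩)⟩
    simp

theorem hallProd_assoc_aux (a b d l : IsoClass C) :
    (∑ x ∈ (hallProd a b).support, hallProd a b x * hallProd x d l) =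
      ∑ y ∈ (hallProd b d).support, hallProd b d y * hallProd a y l := by
  have L : ∀ x ∈ (hallProd a b).support, hallProd a b x * hallProd x d l =
      ∑ y ∈ (hallProd b d).support,
        (Nat.card (Σ e : SES a.out b.out x.out × SES x.out d.out l.out,
          {y : y.out ⟶ l.out // IsSES y (e.2.1.2 ≫ e.1.1.2)}) : ℚ) /
          (Nat.card (x.out ≅ x.out) * Nat.card (y.out ≅ y.out) * Nat.card (l.out ≅ l.out)) := by
    intro x _
    have := Fintype.ofFinite (SES a.out b.out x.out × SES x.out d.out l.out)
    have hf : ∀ e : SES a.out b.out x.out × SES x.out d.out l.out,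
        ∑ y ∈ (hallProd b d).support,
          (Nat.card {k : y.out ⟶ l.out // IsSES k (e.2.1.2 ≫ e.1.1.2)} : ℚ) /
            Nat.card (y.out ≅ y.out) = 1 := by
      intro e
      apply sum_card_kernels
      have := e.1.2.epi
      have := e.2.2.epi
      let g := e.2.1.2 ≫ e.1.1.2
      have h0 : IsSES (kernel.ι g) g := IsSES.of_mono_epi (kernel.condition g)
        fun k hk => ⟨kernel.lift g k hk, kernel.lift_ι g k hk⟩
      let φ : (isoClass (kernel g)).out ≅ kernel g := outIso _
      have h1 : IsSES (φ.hom ≫ kernel.ι g) g := h0.iso_comp φ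
      refine ⟨isoClass (kernel g), ?_, _, h1⟩
      rw [Finsupp.mem_support_iff]
      obtain ⟨c', r, -, -, h⟩ := filtration_left e.1.2 e.2.2 h1
      exact (hallNumber_ne_zero_iff _ _ _).2 ⟨⟨(c', r), h⟩⟩
    calc _ = (∑ e : SES a.out b.out x.out × SES x.out d.out l.out, (1 : ℚ)) /
          (Nat.card (x.out ≅ x.out) * Nat.card (l.out ≅ l.out)) := by
            rw [hallProd_apply_out, hallProd_apply_out, Finset.sum_const, Finset.card_univ,
              ← Nat.card_eq_fintype_card, Nat.card_prod, div_mul_div_comm]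
            simp
      _ = _ := by
            simp_rw [Nat.card_sigma]
            rw [Finset.sum_congr rfl fun e _ => (hf e).symm, Finset.sum_comm, Finset.sum_div]
            refine Finset.sum_congr rfl fun y _ => ?_
            rw [← Finset.sum_div, Nat.cast_sum, div_div]
            congr 1
            ring
  have R : ∀ y ∈ (hallProd b d).support, hallProd b d y * hallProd a y l =
      ∑ x ∈ (hallProd a b).support,
        (Nat.card (Σ e : SES b.out d.out y.out × SES a.out y.out l.out,
          {p : l.out ⟶ x.out // IsSES (e.1.1.1 ≫ e.2.1.1) p}) : ℚ) /
          (Nat.card (x.out ≅ x.out) * Nat.card (y.out ≅ y.out) * Nat.card (l.out ≅ l.out)) := by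
    intro y _
    have := Fintype.ofFinite (SES b.out d.out y.out × SES a.out y.out l.out)
    have hf : ∀ e : SES b.out d.out y.out × SES a.out y.out l.out,
        ∑ x ∈ (hallProd a b).support,
          (Nat.card {p : l.out ⟶ x.out // IsSES (e.1.1.1 ≫ e.2.1.1) p} : ℚ) /
            Nat.card (x.out ≅ x.out) = 1 := by
      intro e
      apply sum_card_cokernels
      have := e.1.2.mono
      have := e.2.2.mono
      let f := e.1.1.1 ≫ e.2.1.1
      have h0 : IsSES f (cokernel.π f) := IsSES.of_mono_epi' (cokernel.condition f)
        fun k hk => ⟨cokernel.desc f k hk, cokernel.π_desc f k hk⟩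
      let φ : (isoClass (cokernel f)).out ≅ cokernel f := outIso _
      have h1 : IsSES f (cokernel.π f ≫ φ.inv) := h0.comp_iso' φ.symm
      refine ⟨isoClass (cokernel f), ?_, _, h1⟩
      rw [Finsupp.mem_support_iff]
      obtain ⟨b', a', -, -, h⟩ := filtration_right e.1.2 e.2.2 h1
      exact (hallNumber_ne_zero_iff _ _ _).2 ⟨⟨(b', a'), h⟩⟩
    calc _ = (∑ e : SES b.out d.out y.out × SES a.out y.out l.out, (1 : ℚ)) /
          (Nat.card (y.out ≅ y.out) * Nat.card (l.out ≅ l.out)) := by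
            rw [hallProd_apply_out, hallProd_apply_out, Finset.sum_const, Finset.card_univ,
              ← Nat.card_eq_fintype_card, Nat.card_prod, div_mul_div_comm]
            simp
      _ = _ := by
            simp_rw [Nat.card_sigma]
            rw [Finset.sum_congr rfl fun e _ => (hf e).symm, Finset.sum_comm, Finset.sum_div]
            refine Finset.sum_congr rfl fun x _ => ?_
            rw [← Finset.sum_div, Nat.cast_sum, div_div]
            congr 1
            ring
  rw [Finset.sum_congr rfl L, Finset.sum_congr rfl R, Finset.sum_comm]
  refine Finset.sum_congr rfl fun y _ => Finset.sum_congr rfl fun x _ => ?_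
  rw [card_filtrations]

theorem hallProd_zero_left (b : IsoClass C) :
    hallProd (isoClass (0 : C)) b = Finsupp.single b 1 := by
  classical
  ext x
  rw [← Quotient.out_eq x, ← Quotient.out_eq b]
  change hallProd (isoClass (0 : C)) (isoClass b.out) (isoClass x.out) =
    Finsupp.single (isoClass b.out) 1 (isoClass x.out)
  rw [hallProd_apply, hallNumber_eq, Finsupp.single_apply]
  split_ifs with h
  · obtain ⟨φ⟩ : Nonempty (b.out ≅ x.out) := Quotient.exact h
    rw [div_eq_one_iff_eq (card_iso_pos _).ne']
    have h0 : IsSES (𝟙 x.out) (0 : x.out ⟶ (0 : C)) := by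
      have : Epi (0 : x.out ⟶ (0 : C)) := ⟨fun _ _ _ => (isZero_zero C).eq_of_src _ _⟩
      exact IsSES.of_mono_epi (by simp) fun k _ => ⟨k, by simp⟩
    congr 1
    refine Nat.card_congr (Equiv.ofBijective (fun ψ : x.out ≅ x.out =>
      (⟨((φ ≪≫ ψ).hom ≫ 𝟙 _, 0), h0.iso_comp (φ ≪≫ ψ)⟩ : SES 0 b.out x.out)) ⟨?_, ?_⟩).symm
    · intro ψ ψ' h
      have := congrArg (fun t => t.1.1) h
      exact Iso.ext (by simpa using this)
    · rintro ⟨⟨f, g⟩, h⟩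
      have hg : g = 0 := (isZero_zero C).eq_of_tgt _ _
      subst hg
      have := h.mono
      obtain ⟨l, hl⟩ := h.exists_lift (𝟙 _) (by simp)
      dsimp at hl
      refine ⟨φ.symm ≪≫ ⟨f, l, by rw [← cancel_mono f]; simp [hl], hl⟩, ?_⟩
      exact Subtype.ext (Prod.ext (by simp) rfl)
  · have : IsEmpty (SES 0 b.out x.out) := ⟨fun e => h (by
      have := e.2.mono
      have hg : e.1.2 = 0 := (isZero_zero C).eq_of_tgt _ _
      obtain ⟨l, hl⟩ := e.2.exists_lift (𝟙 _) (by simp [hg])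
      exact Quotient.sound ⟨⟨e.1.1, l, by rw [← cancel_mono e.1.1]; simp [hl], hl⟩⟩)⟩
    simp

theorem hallProd_zero_right (a : IsoClass C) :
    hallProd a (isoClass (0 : C)) = Finsupp.single a 1 := by
  classical
  ext x
  rw [← Quotient.out_eq x, ← Quotient.out_eq a]
  change hallProd (isoClass a.out) (isoClass (0 : C)) (isoClass x.out) =
    Finsupp.single (isoClass a.out) 1 (isoClass x.out)
  rw [hallProd_apply, hallNumber_eq, Finsupp.single_apply]
  split_ifs with h
  · obtain ⟨φ⟩ : Nonempty (a.out ≅ x.out) := Quotient.exact h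
    rw [div_eq_one_iff_eq (card_iso_pos _).ne']
    have h0 : IsSES (0 : (0 : C) ⟶ x.out) (𝟙 x.out) := by
      have : Mono (0 : (0 : C) ⟶ x.out) := ⟨fun _ _ _ => (isZero_zero C).eq_of_tgt _ _⟩
      exact IsSES.of_mono_epi' (by simp) fun k _ => ⟨k, by simp⟩
    congr 1
    refine Nat.card_congr (Equiv.ofBijective (fun ψ : x.out ≅ x.out =>
      (⟨(0, 𝟙 _ ≫ (ψ ≪≫ φ.symm).hom), h0.comp_iso' (ψ ≪≫ φ.symm)⟩ : SES a.out 0 x.out))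
        ⟨?_, ?_⟩).symm
    · intro ψ ψ' h
      have := congrArg (fun t => t.1.2) h
      exact Iso.ext (by simpa using this)
    · rintro ⟨⟨f, g⟩, h⟩
      have hf : f = 0 := (isZero_zero C).eq_of_src _ _
      subst hf
      have := h.epi
      obtain ⟨l, hl⟩ := h.exists_desc (𝟙 _) (by simp)
      dsimp at hl
      refine ⟨⟨g, l, hl, by rw [← cancel_epi g]; simp [reassoc_of% hl]⟩ ≪≫ φ, ?_⟩
      exact Subtype.ext (Prod.ext rfl (by simp))
  · have : IsEmpty (SES a.out 0 x.out) := ⟨fun e => h (by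
      have := e.2.epi
      have hf : e.1.1 = 0 := (isZero_zero C).eq_of_src _ _
      obtain ⟨l, hl⟩ := e.2.exists_desc (𝟙 _) (by simp [hf])
      exact Quotient.sound ⟨(⟨e.1.2, l, hl, by rw [← cancel_epi e.1.2]; simp [reassoc_of% hl]⟩ :
        x.out ≅ a.out).symm⟩)⟩
    simp

/-- The bilinear extension of `hallProd`. -/
noncomputable def hallMul : (IsoClass C →₀ ℚ) →ₗ[ℚ] (IsoClass C →₀ ℚ) →ₗ[ℚ] (IsoClass C →₀ ℚ) :=
  Finsupp.linearCombination ℚ fun a => Finsupp.linearCombination ℚ fun b => hallProd a b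

theorem hallMul_single (a b : IsoClass C) (r s : ℚ) :
    hallMul (Finsupp.single a r) (Finsupp.single b s) = (r * s) • hallProd a b := by
  simp [hallMul, Finsupp.linearCombination_single, smul_smul]

theorem hallMul_assoc (x y z : IsoClass C →₀ ℚ) :
    hallMul (hallMul x y) z = hallMul x (hallMul y z) := by
  induction x using Finsupp.induction_linear with
  | zero => simp
  | add x x' h h' => simp [h, h']
  | single a r =>
    induction y using Finsupp.induction_linear with
    | zero => simp
    | add y y' h h' => simp [h, h']
    | single b s =>
      induction z using Finsupp.induction_linear with
      | zero => simp
      | add z z' h h' => simp [h, h']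
      | single d t =>
        have h1 : hallMul (hallProd a b) (Finsupp.single d t) =
            t • ∑ x ∈ (hallProd a b).support, hallProd a b x • hallProd x d := by
          conv_lhs => rw [← (hallProd a b).sum_single, Finsupp.sum]
          rw [map_sum, LinearMap.sum_apply, Finset.smul_sum]
          refine Finset.sum_congr rfl fun x _ => ?_
          rw [hallMul_single, smul_smul, mul_comm]
        have h2 : hallMul (Finsupp.single a r) (hallProd b d) =
            r • ∑ y ∈ (hallProd b d).support, hallProd b d y • hallProd a y := by
          conv_lhs => rw [← (hallProd b d).sum_single, Finsupp.sum]
          rw [map_sum, Finset.smul_sum]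
          refine Finset.sum_congr rfl fun x _ => ?_
          rw [hallMul_single, smul_smul]
        rw [hallMul_single, hallMul_single, map_smul, map_smul, LinearMap.smul_apply, h1, h2]
        ext l
        simp only [Finsupp.smul_apply, Finsupp.finsetSum_apply, smul_eq_mul]
        rw [hallProd_assoc_aux]
        ring

end Hall

/-- The Ringel–Hall algebra of `C`: the `ℚ`-vector space with basis `Iso(C)`, with the product
`[A] ⋄ [B] = ∑_[X] |Ext¹(A, B)_X| / |Hom(A, B)| [X]`. -/
def HallAlgebra (C : Type u) [Category.{v} C] [Abelian C] := IsoClass C →₀ ℚ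

namespace HallAlgebra
variable {C : Type u} [Category.{v} C] [Abelian C]

noncomputable instance : AddCommGroup (HallAlgebra C) := inferInstanceAs (AddCommGroup (_ →₀ ℚ))

noncomputable instance : Module ℚ (HallAlgebra C) := inferInstanceAs (Module ℚ (_ →₀ ℚ))

/-- The basis element `[X]` of the Ringel–Hall algebra. -/
noncomputable def of (X : C) : HallAlgebra C := Finsupp.single (isoClass X) (1 : ℚ)

variable [FinitaryCategory C]

noncomputable instance : Ring (HallAlgebra C) :=
  { (inferInstance : AddCommGroup (HallAlgebra C)) with
    mul := fun x y => hallMul x y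
    one := of 0
    left_distrib := fun x y z => map_add (hallMul x) y z
    right_distrib := fun x y z => LinearMap.map_add₂ hallMul x y z
    zero_mul := fun x => LinearMap.map_zero₂ hallMul x
    mul_zero := fun x => map_zero (hallMul x)
    mul_assoc := hallMul_assoc
    one_mul := fun x => by
      change hallMul (Finsupp.single _ 1) x = x
      induction x using Finsupp.induction_linear with
      | zero => simp
      | add x y hx hy => rw [map_add, hx, hy]
      | single a r =>
        rw [hallMul_single, one_mul, hallProd_zero_left, Finsupp.smul_single, smul_eq_mul, mul_one]
    mul_one := fun x => by
      change hallMul x (Finsupp.single _ 1) = x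
      induction x using Finsupp.induction_linear with
      | zero => simp
      | add x y hx hy => rw [LinearMap.map_add₂, hx, hy]
      | single a r =>
        rw [hallMul_single, mul_one, hallProd_zero_right, Finsupp.smul_single, smul_eq_mul,
          mul_one] }

noncomputable instance : Algebra ℚ (HallAlgebra C) :=
  Algebra.ofModule (fun r x y => LinearMap.map_smul₂ hallMul r x y)
    (fun r x y => map_smul (hallMul x) r y)

/-- The product of two basis elements. -/
theorem of_mul_of (A B : C) :
    of A * of B = (Finsupp.ofSupportFinite (fun x => hallNumber A B x.out)
      (finite_setOf_hallNumber_ne_zero A B) : IsoClass C →₀ ℚ) := by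
  change hallMul (Finsupp.single _ 1) (Finsupp.single _ 1) = _
  rw [hallMul_single, one_mul, one_smul]
  ext x
  change hallNumber _ _ _ = hallNumber _ _ _
  exact hallNumber_congr (outIso A) (outIso B) (Iso.refl _)

end HallAlgebra

section Complexes
variable {C : Type u} [Category.{v} C] [Abelian C] {ι : Type} (c : ComplexShape ι)

theorem IsSES.degreewise {c : ComplexShape ι} {A B X : HomologicalComplex C c} {f : B ⟶ X}
    {g : X ⟶ A} (h : IsSES f g) (i : ι) : IsSES (f.f i) (g.f i) :=
  ⟨by rw [← HomologicalComplex.comp_f, h.w, HomologicalComplex.zero_f],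
    h.shortExact.map_of_exact (HomologicalComplex.eval C c i)⟩

/-- Finiteness of morphism spaces and of first extension spaces passes to finitely indexed
complexes. -/
instance [Finite ι] [FinitaryCategory C] : FinitaryCategory (HomologicalComplex C c) where
  finite_hom M N := Finite.of_injective (fun φ (i : ι) => φ.f i) fun φ ψ h => by
    ext i
    exact congrFun h i
  finite_ext M N := by
    have rep : ∀ (i : ι) (η : Ext1 (M.X i) (N.X i)), ∃ (Y : C) (F : N.X i ⟶ Y) (G : Y ⟶ M.X i)
      (s : IsSES F G), s.cls = η := fun i η => exists_isSES_cls η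
    choose Y F G s hs using rep
    let P := Σ η : (∀ i, Ext1 (M.X i) (N.X i)), ∀ i j, Y i (η i) ⟶ Y j (η j)
    have key : ∀ ξ : Ext1 M N, ∃ (p : P) (E : HomologicalComplex C c) (f : N ⟶ E) (g : E ⟶ M)
        (h : IsSES f g) (θ : ∀ i, E.X i ≅ Y i (p.1 i)), h.cls = ξ ∧
        (∀ i, f.f i ≫ (θ i).hom = F i (p.1 i)) ∧ (∀ i, (θ i).hom ≫ G i (p.1 i) = g.f i) ∧
        ∀ i j, E.d i j ≫ (θ j).hom = (θ i).hom ≫ p.2 i j := by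
      intro ξ
      obtain ⟨E, f, g, h, hξ⟩ := exists_isSES_cls ξ
      have iso := fun i => (h.degreewise i).exists_iso_of_cls_eq (s i (h.degreewise i).cls)
        (hs i _).symm
      choose θ h1 h2 using iso
      exact ⟨⟨fun i => (h.degreewise i).cls, fun i j => (θ i).inv ≫ E.d i j ≫ (θ j).hom⟩,
        E, f, g, h, θ, hξ, h1, h2, fun i j => by simp⟩
    choose p E f g h θ h0 h1 h2 h3 using key
    refine Finite.of_injective p fun ξ ξ' hp => ?_
    have iso : ∃ φ : ∀ i, (E ξ).X i ≅ (E ξ').X i, (∀ i, (f ξ).f i ≫ (φ i).hom = (f ξ').f i) ∧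
        (∀ i, (φ i).hom ≫ (g ξ').f i = (g ξ).f i) ∧
        ∀ i j, (φ i).hom ≫ (E ξ').d i j = (E ξ).d i j ≫ (φ j).hom := by
      have a1 := h1 ξ'
      have a2 := h2 ξ'
      have a3 := h3 ξ'
      revert a1 a2 a3
      generalize θ ξ' = θ'
      revert θ'
      rw [← hp]
      intro θ' a1 a2 a3
      refine ⟨fun i => θ ξ i ≪≫ (θ' i).symm, fun i => ?_, fun i => ?_, fun i j => ?_⟩
      · simp [reassoc_of% h1 ξ i, ← a1 i]
      · simp [← a2 i, h2 ξ i]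
      · rw [← cancel_mono (θ' j).hom]
        simp [a3 i j, reassoc_of% h3 ξ i j]
    obtain ⟨φ, b1, b2, b3⟩ := iso
    rw [← h0 ξ, ← h0 ξ']
    exact (h ξ).cls_eq_of_comm (h ξ')
      { f := fun i => (φ i).hom, comm' := fun i j _ => b3 i j }
      (by ext i; exact b1 i) (by ext i; exact b2 i)

end Complexes

/-! ### The Grothendieck group and the Euler form -/

section K0
variable (C : Type u) [Category.{v} C] [Abelian C]

/-- The Grothendieck group `K₀(C)`: generated by the objects, with one relation
`X = A + B` for each short exact sequence `0 ⟶ B ⟶ X ⟶ A ⟶ 0`. -/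
def K₀ : Type u :=
  FreeAbelianGroup C ⧸ AddSubgroup.closure
    {x : FreeAbelianGroup C | ∃ (A B X : C) (f : B ⟶ X) (g : X ⟶ A), IsSES f g ∧
      x = FreeAbelianGroup.of X - FreeAbelianGroup.of A - FreeAbelianGroup.of B}

instance : AddCommGroup (K₀ C) := inferInstanceAs (AddCommGroup (_ ⧸ AddSubgroup.closure _))

variable {C}

/-- The class of an object in `K₀(C)`. -/
def K₀.of (X : C) : K₀ C := QuotientAddGroup.mk (FreeAbelianGroup.of X)

/-- The multiplicative Euler form `⟨X, Y⟩ = |Hom(X, Y)| / |Ext¹(X, Y)|` on objects. -/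
noncomputable def eulerForm (X Y : C) : ℚ := (Nat.card (X ⟶ Y) : ℚ) / Nat.card (Ext1 X Y)

variable (C)

/-- `C` is hereditary: `Extⁿ(X, Y) = 0` for all `X`, `Y` and all `n ≥ 2`. -/
def IsHereditary : Prop := ∀ X : C, HasProjectiveDimensionLE X 1

end K0

/-! ### Localization of a noncommutative algebra -/

section Localization
variable (R : Type u) [Ring R] [Algebra ℚ R] (S : Set R)

/-- The relations defining the localization: the generators `inl x`, `x : R`, satisfy the
relations of `R`, and `inr s` is a two-sided inverse of `inl s` for `s ∈ S`. -/
inductive LocalizationRel : FreeAlgebra ℚ (R ⊕ S) → FreeAlgebra ℚ (R ⊕ S) → Prop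
  | add (x y : R) : LocalizationRel (FreeAlgebra.ι ℚ (Sum.inl (x + y)))
      (FreeAlgebra.ι ℚ (Sum.inl x) + FreeAlgebra.ι ℚ (Sum.inl y))
  | mul (x y : R) : LocalizationRel (FreeAlgebra.ι ℚ (Sum.inl (x * y)))
      (FreeAlgebra.ι ℚ (Sum.inl x) * FreeAlgebra.ι ℚ (Sum.inl y))
  | scalar (r : ℚ) : LocalizationRel (FreeAlgebra.ι ℚ (Sum.inl (algebraMap ℚ R r)))
      (algebraMap ℚ _ r)
  | mul_inv (s : S) : LocalizationRel
      (FreeAlgebra.ι ℚ (Sum.inl (s : R)) * FreeAlgebra.ι ℚ (Sum.inr s)) 1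
  | inv_mul (s : S) : LocalizationRel
      (FreeAlgebra.ι ℚ (Sum.inr s) * FreeAlgebra.ι ℚ (Sum.inl (s : R))) 1

/-- The localization `R[S⁻¹]` of a not necessarily commutative algebra: the universal algebra
under `R` in which the elements of `S` are invertible. -/
def NCLocalization : Type u := RingQuot (LocalizationRel R S)

namespace NCLocalization

noncomputable instance : Ring (NCLocalization R S) :=
  inferInstanceAs (Ring (RingQuot (LocalizationRel R S)))

noncomputable instance : Algebra ℚ (NCLocalization R S) :=
  inferInstanceAs (Algebra ℚ (RingQuot (LocalizationRel R S)))

/-- The canonical map `R → R[S⁻¹]`. -/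
noncomputable def map : R →ₐ[ℚ] NCLocalization R S :=
  let q : FreeAlgebra ℚ (R ⊕ S) →ₐ[ℚ] RingQuot (LocalizationRel R S) :=
    RingQuot.mkAlgHom ℚ (LocalizationRel R S)
  have hs : ∀ r : ℚ, q (FreeAlgebra.ι ℚ (Sum.inl (algebraMap ℚ R r))) = algebraMap ℚ _ r :=
    fun r => (RingQuot.mkAlgHom_rel ℚ (LocalizationRel.scalar (S := S) r)).trans (q.commutes r)
  { toFun := fun x => q (FreeAlgebra.ι ℚ (Sum.inl x))
    map_one' := by
      have := hs 1
      rw [map_one, map_one] at this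
      exact this
    map_mul' := fun x y => (RingQuot.mkAlgHom_rel ℚ (LocalizationRel.mul (S := S) x y)).trans
      (map_mul q _ _)
    map_zero' := by
      have := hs 0
      rw [map_zero, map_zero] at this
      exact this
    map_add' := fun x y => (RingQuot.mkAlgHom_rel ℚ (LocalizationRel.add (S := S) x y)).trans
      (map_add q _ _)
    commutes' := hs }

theorem isUnit_map (s : S) : IsUnit (map R S s) := by
  let q : FreeAlgebra ℚ (R ⊕ S) →ₐ[ℚ] RingQuot (LocalizationRel R S) :=
    RingQuot.mkAlgHom ℚ (LocalizationRel R S)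
  refine ⟨⟨map R S s, q (FreeAlgebra.ι ℚ (Sum.inr s)), ?_, ?_⟩, rfl⟩
  · exact (map_mul q _ _).symm.trans
      ((RingQuot.mkAlgHom_rel ℚ (LocalizationRel.mul_inv s)).trans (map_one q))
  · exact (map_mul q _ _).symm.trans
      ((RingQuot.mkAlgHom_rel ℚ (LocalizationRel.inv_mul s)).trans (map_one q))

/-- The universal property of the localization. -/
theorem existsUnique_lift {B : Type*} [Ring B] [Algebra ℚ B] (f : R →ₐ[ℚ] B)
    (hf : ∀ s ∈ S, IsUnit (f s)) :
    ∃! g : NCLocalization R S →ₐ[ℚ] B, g.comp (map R S) = f := by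
  let φ : FreeAlgebra ℚ (R ⊕ S) →ₐ[ℚ] B :=
    FreeAlgebra.lift ℚ (Sum.elim f fun s => ((hf s s.2).unit⁻¹ : Bˣ))
  have hφ : ∀ ⦃x y⦄, LocalizationRel R S x y → φ x = φ y := by
    intro x y h
    cases h <;> simp [φ]
  refine ⟨RingQuot.liftAlgHom ℚ ⟨φ, hφ⟩, ?_, ?_⟩
  · ext x
    exact (RingQuot.liftAlgHom_mkAlgHom_apply ℚ φ hφ _).trans (by simp [φ])
  · intro g hg
    refine RingQuot.ringQuot_ext' ℚ _ _ (FreeAlgebra.hom_ext (funext fun z => ?_))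
    have hl : ∀ x : R, g (RingQuot.mkAlgHom ℚ (LocalizationRel R S)
        (FreeAlgebra.ι ℚ (Sum.inl x))) = f x := fun x => DFunLike.congr_fun hg x
    refine Eq.trans ?_ (RingQuot.liftAlgHom_mkAlgHom_apply ℚ φ hφ _).symm
    rcases z with x | s
    · refine (hl x).trans (by simp [φ])
    · have h1 : f s * g (RingQuot.mkAlgHom ℚ (LocalizationRel R S)
          (FreeAlgebra.ι ℚ (Sum.inr s))) = 1 := by
        rw [← hl]
        refine (map_mul g _ _).symm.trans ?_
        rw [← map_one g]
        exact congrArg g ((map_mul (RingQuot.mkAlgHom ℚ (LocalizationRel R S)) _ _).symm.trans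
          ((RingQuot.mkAlgHom_rel ℚ (LocalizationRel.mul_inv s)).trans (map_one _)))
      have h2 : φ (FreeAlgebra.ι ℚ (Sum.inr s)) = ((hf s s.2).unit⁻¹ : Bˣ) := by simp [φ]
      rw [h2]
      exact Units.eq_inv_of_mul_eq_one_left (u := (hf s s.2).unit) h1

end NCLocalization

end Localization

/-! ### The semi-derived Ringel–Hall algebra -/

section SDH
variable (𝒜 : Type u) [Category.{v} 𝒜] [Abelian 𝒜] (t : ℕ)

/-- The category of `ℤ/t`-graded complexes `(Mⁱ, dⁱ : Mⁱ ⟶ Mⁱ⁺¹)`, `i ∈ ℤ/t`. -/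
abbrev PeriodicComplex := HomologicalComplex 𝒜 (ComplexShape.up (ZMod t))

variable {𝒜 t}

/-- The stalk complex `U_{X,i}`, with `X` in degree `i` and zero differential. -/
noncomputable abbrev stalk (X : 𝒜) (i : ZMod t) : PeriodicComplex 𝒜 t :=
  (HomologicalComplex.single 𝒜 (ComplexShape.up (ZMod t)) i).obj X

/-- The complex `⨁ᵢ U_{Aⁱ,i}`. -/
noncomputable def stalkSum [NeZero t] (A : ZMod t → 𝒜) : PeriodicComplex 𝒜 t :=
  haveI : HasFiniteBiproducts (PeriodicComplex 𝒜 t) := Abelian.hasFiniteBiproducts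
  ⨁ fun i => stalk (A i) i

/-- The complex `K_{X,i}`: for `t > 1` it is `1 : X ⟶ X` in degrees `i - 1` and `i`;
for `t = 1` it is `X ⊞ X` with the differential mapping the second summand identically onto the
first one. -/
noncomputable def disk (X : 𝒜) (i : ZMod t) : PeriodicComplex 𝒜 t :=
  if h : t = 1 then
    { X := fun _ => X ⊞ X
      d := fun _ _ => biprod.snd ≫ biprod.inl
      shape := by
        subst h
        exact fun j l hjl => absurd (Subsingleton.elim (α := ZMod 1) (j + 1) l) hjl
      d_comp_d' := by simp }
  else HomologicalComplex.double (𝟙 X) (c := ComplexShape.up (ZMod t)) (i₀ := i - 1) (i₁ := i)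
    (ComplexShape.up_mk _ _ (sub_add_cancel i 1))

/-- `Hⁱ(M) ≅ Hⁱ(N)` and the images of `dⁱ_M` and `dⁱ_N` have the same class in `K₀(𝒜)`,
for all `i ∈ ℤ/t`. -/
def SameClass (M N : PeriodicComplex 𝒜 t) : Prop :=
  ∀ i : ZMod t, Nonempty (M.homology i ≅ N.homology i) ∧
    K₀.of (image (M.d i (i + 1))) = K₀.of (image (N.d i (i + 1)))

variable [NeZero t]

theorem acyclic_disk (X : 𝒜) (i : ZMod t) : (disk X i).Acyclic := by
  intro j
  have hp : (ComplexShape.up (ZMod t)).prev j = j - 1 :=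
    ComplexShape.prev_eq' _ (sub_add_cancel j 1)
  have hn : (ComplexShape.up (ZMod t)).next j = j + 1 := ComplexShape.next_eq' _ rfl
  by_cases ht : t = 1
  · rw [disk, dif_pos ht, HomologicalComplex.exactAt_iff' _ (j - 1) j (j + 1) hp hn,
      ShortComplex.exact_iff_exact_up_to_refinements]
    intro Z (x : Z ⟶ X ⊞ X) (hx : x ≫ biprod.snd ≫ biprod.inl = 0)
    have h0 : x ≫ biprod.snd = 0 := by simpa using hx =≫ biprod.fst
    refine ⟨Z, 𝟙 Z, inferInstance, (x ≫ biprod.fst ≫ biprod.inr : Z ⟶ X ⊞ X), ?_⟩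
    change 𝟙 Z ≫ x = (x ≫ biprod.fst ≫ biprod.inr) ≫ biprod.snd ≫ biprod.inl
    apply biprod.hom_ext <;> simp [h0]
  · rw [disk, dif_neg ht]
    have : Fact (1 < t) := ⟨by have := NeZero.ne t; omega⟩
    have hi : i - 1 ≠ i := by simp
    have hr : (ComplexShape.up (ZMod t)).Rel (i - 1) i :=
      ComplexShape.up_mk _ _ (sub_add_cancel i 1)
    have hd : IsIso ((HomologicalComplex.double (𝟙 X) hr).d (i - 1) i) := by
      rw [HomologicalComplex.double_d _ _ hi]
      infer_instance
    by_cases h1 : j = i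
    · rw [HomologicalComplex.exactAt_iff' _ (i - 1) j (j + 1) (by rw [hp, h1]) hn]
      subst h1
      have : Epi ((HomologicalComplex.double (𝟙 X) hr).sc' (j - 1) j (j + 1)).f :=
        inferInstanceAs (Epi ((HomologicalComplex.double (𝟙 X) hr).d (j - 1) j))
      refine (ShortComplex.exact_iff_epi _ ?_).2 this
      rw [← cancel_epi ((HomologicalComplex.double (𝟙 X) hr).sc' (j - 1) j (j + 1)).f,
        ShortComplex.zero, comp_zero]
    · by_cases h2 : j = i - 1
      · rw [HomologicalComplex.exactAt_iff' _ (j - 1) j i hp (by rw [hn, h2, sub_add_cancel])]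
        subst h2
        have : Mono ((HomologicalComplex.double (𝟙 X) hr).sc' (i - 1 - 1) (i - 1) i).g :=
          inferInstanceAs (Mono ((HomologicalComplex.double (𝟙 X) hr).d (i - 1) i))
        refine (ShortComplex.exact_iff_mono _ ?_).2 this
        rw [← cancel_mono ((HomologicalComplex.double (𝟙 X) hr).sc' (i - 1 - 1) (i - 1) i).g,
          ShortComplex.zero, zero_comp]
      · rw [HomologicalComplex.exactAt_iff' _ (j - 1) j (j + 1) hp hn]
        exact ShortComplex.exact_of_isZero_X₂ _ (HomologicalComplex.isZero_double_X (𝟙 X) hr j h2 h1)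

variable (𝒜 t) [FinitaryCategory 𝒜]

/-- The ideal `J` of the Ringel–Hall algebra of `ℤ/t`-graded complexes that is generated by the
differences `[M] - [N]` with `M`, `N` as in `SameClass`. -/
noncomputable def hallIdeal : TwoSidedIdeal (HallAlgebra (PeriodicComplex 𝒜 t)) :=
  TwoSidedIdeal.span {x | ∃ M N : PeriodicComplex 𝒜 t, SameClass M N ∧
    x = HallAlgebra.of M - HallAlgebra.of N}

/-- The quotient of the Ringel–Hall algebra of `ℤ/t`-graded complexes by the ideal `J`. -/
abbrev HallQuotient := (hallIdeal 𝒜 t).ringCon.Quotient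

/-- The set `S` of the elements `r[K]` with `r ∈ ℚ`, `r ≠ 0`, and `K` acyclic. -/
def acyclicClasses : Set (HallQuotient 𝒜 t) :=
  {x | ∃ (r : ℚ) (K : PeriodicComplex 𝒜 t), r ≠ 0 ∧ K.Acyclic ∧
    x = r • ((HallAlgebra.of K : HallAlgebra (PeriodicComplex 𝒜 t)) : HallQuotient 𝒜 t)}

/-- The `ℤ/t`-graded semi-derived Ringel–Hall algebra of `𝒜`. -/
abbrev SemiDerivedHallAlgebra := NCLocalization (HallQuotient 𝒜 t) (acyclicClasses 𝒜 t)

variable {𝒜 t}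

/-- The element `[M]` of the semi-derived Ringel–Hall algebra. -/
noncomputable def cls (M : PeriodicComplex 𝒜 t) : SemiDerivedHallAlgebra 𝒜 t :=
  NCLocalization.map _ _ ((HallAlgebra.of M : HallAlgebra (PeriodicComplex 𝒜 t)) :
    HallQuotient 𝒜 t)

theorem isUnit_cls {K : PeriodicComplex 𝒜 t} (hK : K.Acyclic) : IsUnit (cls K) :=
  NCLocalization.isUnit_map (HallQuotient 𝒜 t) (acyclicClasses 𝒜 t)
    ⟨_, 1, K, one_ne_zero, hK, (one_smul _ _).symm⟩

end SDH

end SemiDerivedHall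

/-! To a complex `M` attach the invariants `clsIdx M`: the classes in `K₀` of the images of its
differentials, and the isomorphism classes of its homology objects. The ideal `J` identifies
complexes with equal invariants. The point is that it identifies nothing else: the kernel of the
linear map `classProj`, which replaces `[M]` by the basis vector of its invariants, is itself a
two-sided ideal. This means that `classProj ([M] * [L])` depends only on the invariants of `M` and
of `L` (`classProj_mul_congr_left`, `classProj_mul_congr_right`).

To see this, `M` is compared with its homology `H`, viewed as a complex with zero differential.
Heredity gives a complex `N` containing `M` with acyclic quotient `K` and containing `H` with
contractible quotient (`exists_coresolution`; dually `exists_resolution`). If `M ⊆ N` has acyclic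
quotient `K`, an extension of `N` by `L` restricts to one of `M` by `L`, and the two middle terms
differ by `K`, so their invariants differ by a translation. When the restriction `Ext¹(N, L) →
Ext¹(M, L)` is onto, counting fibres shows that `classProj` of `[N] * [L]` and of `[M] * [L]` agree
up to this translation and the scalar `⟨K, L⟩⁻¹` (`IsSES.map_mul_of_left`). Using both subobjects of
`N` expresses the product through `H`, with a scalar that depends only on invariants.

Surjectivity of the restriction is the homological core. Although `Ext²` of periodic complexes need
not vanish, the obstructions are Yoneda products of two classes in `Ext¹`, and these vanish when the
first argument is acyclic (`comp_eq_zero_of_acyclic`). Contractible complexes are treated degreewise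
by adjunction. Complexes with zero differential sit in short exact sequences with contractible
middle term, and every complex is an extension of two complexes with zero differential.

Consequently the class of an acyclic `K` times `[L]` is a nonzero multiple of `[K ⊞ L]`, in either
order. Such classes are regular and commute with every `[L]` up to scalars, so they form an Ore set:
the quotient embeds in the localization (`map_injective`), whose elements are left fractions
(`exists_cls_mul_eq_map`). Every element of the proposed basis is, up to a scalar, a fraction `[P]⁻¹
[M]`, and the difference of the invariants of `M` and `P` runs exactly once through `K₀` and `Iso`
families. Clearing denominators gives independence and spanning. -/

namespace SemiDerivedHall

/-! ### Morphisms of extensions, obstructions in `Ext²`, and heredity -/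

section Ext1Algebra
variable {C : Type u} [Category.{v} C] [Abelian C]

attribute [local instance] HasExt.standard

open Abelian Abelian.Ext

/-- The extension class of a morphism of short exact sequences. -/
theorem IsSES.cls_naturality {A B X A' B' X' : C} {f : B ⟶ X} {g : X ⟶ A} {f' : B' ⟶ X'}
    {g' : X' ⟶ A'} (h : IsSES f g) (h' : IsSES f' g') (β : B ⟶ B') (φ : X ⟶ X') (α : A ⟶ A')
    (h1 : f ≫ φ = β ≫ f') (h2 : φ ≫ g' = g ≫ α) :
    h.cls.comp (mk₀ β) (add_zero 1) = (mk₀ α).comp h'.cls (zero_add 1) :=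
  ShortComplex.ShortExact.extClass_naturality h.shortExact h'.shortExact
    { τ₁ := β, τ₂ := φ, τ₃ := α, comm₁₂ := h1.symm, comm₂₃ := h2 }

/-- A pair of morphisms that is compatible with the extension classes extends to a morphism of
short exact sequences. -/
theorem IsSES.exists_hom {A B X A' B' X' : C} {f : B ⟶ X} {g : X ⟶ A} {f' : B' ⟶ X'}
    {g' : X' ⟶ A'} (h : IsSES f g) (h' : IsSES f' g') (β : B ⟶ B') (α : A ⟶ A')
    (e : h.cls.comp (mk₀ β) (add_zero 1) = (mk₀ α).comp h'.cls (zero_add 1)) :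
    ∃ φ : X ⟶ X', f ≫ φ = β ≫ f' ∧ φ ≫ g' = g ≫ α := by
  have hc : h'.cls.comp (mk₀ f') (add_zero 1) = 0 := h'.shortExact.extClass_comp
  have z : h.cls.comp (mk₀ (β ≫ f')) (add_zero 1) = 0 := by
    rw [← mk₀_comp_mk₀, ← comp_assoc (a₁₂ := 1) (a₂₃ := 0) _ _ _ rfl rfl rfl, e,
      comp_assoc (a₁₂ := 1) (a₂₃ := 1) _ _ _ rfl rfl rfl, hc, Ext.comp_zero]
  obtain ⟨φ₀, hφ⟩ := contravariant_sequence_exact₁ h.shortExact _ (mk₀ (β ≫ f')) (n₁ := 1) rfl z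
  obtain ⟨φ, rfl⟩ := (mk₀_bijective _ _).2 φ₀
  have hφ' : f ≫ φ = β ≫ f' := by
    simp only [mk₀_comp_mk₀] at hφ
    exact (mk₀_bijective _ _).1 hφ
  obtain ⟨w, hw⟩ := h.exists_desc (φ ≫ g') (by rw [← Category.assoc, hφ', Category.assoc, h'.w,
    Limits.comp_zero])
  -- The extension `φ` of `β ≫ f'` induces some `w` on the quotients instead of `α`. Since `w - α`
  -- annihilates the class of the second sequence, it lifts to `X'`, and subtracting this lift
  -- corrects `φ` without changing it on `B`.
  have key : (mk₀ (w - α)).comp h'.cls (zero_add 1) = 0 := by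
    rw [sub_eq_add_neg, mk₀_add, add_comp, ← IsSES.cls_naturality h h' β φ w hφ' hw.symm, mk₀_neg,
      neg_comp, e]
    exact add_neg_cancel _
  obtain ⟨v₀, hv⟩ := covariant_sequence_exact₃ (hS := h'.shortExact) _ _ (n₁ := 1) rfl key
  obtain ⟨v, rfl⟩ := (mk₀_bijective _ _).2 v₀
  simp only [mk₀_comp_mk₀] at hv
  have hv' : v ≫ g' = w - α := (mk₀_bijective _ _).1 hv
  exact ⟨φ - g ≫ v, by simp [hφ', reassoc_of% h.w], by simp [hv', hw]⟩

theorem IsSES.cls_comp_mk₀ {A B X : C} {f : B ⟶ X} {g : X ⟶ A} (h : IsSES f g) :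
    h.cls.comp (mk₀ f) (add_zero 1) = 0 := h.shortExact.extClass_comp

theorem IsSES.mk₀_comp_cls {A B X : C} {f : B ⟶ X} {g : X ⟶ A} (h : IsSES f g) :
    (mk₀ g).comp h.cls (zero_add 1) = 0 := h.shortExact.comp_extClass

theorem isSES_kernel {X Y : C} (g : X ⟶ Y) [Epi g] : IsSES (kernel.ι g) g :=
  IsSES.of_mono_epi (kernel.condition g) fun k hk => ⟨kernel.lift g k hk, kernel.lift_ι g k hk⟩

theorem isSES_cokernel {X Y : C} (f : X ⟶ Y) [Mono f] : IsSES f (cokernel.π f) :=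
  IsSES.of_mono_epi' (cokernel.condition f)
    fun k hk => ⟨cokernel.desc f k hk, cokernel.π_desc f k hk⟩

/-- `ζ` lifts along the epimorphism of a short exact sequence if the product vanishes. -/
theorem IsSES.lift_of_comp_eq_zero {A B X K : C} {f : B ⟶ X} {g : X ⟶ A} (h : IsSES f g)
    (ζ : Ext1 K A) (hz : ζ.comp h.cls (show 1 + 1 = 2 from rfl) = 0) :
    ∃ β : Ext1 K X, β.comp (mk₀ g) (add_zero 1) = ζ :=
  covariant_sequence_exact₃ (hS := h.shortExact) _ ζ rfl hz

/-- The obstruction to extending `ξ` is its own Yoneda product with the class of the sequence.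
Asking only for this product to vanish, and not for the whole of `Ext²`, makes the lemma applicable
to complexes. -/
theorem IsSES.extend_of_comp_eq_zero {A B X L : C} {f : B ⟶ X} {g : X ⟶ A} (h : IsSES f g)
    (ξ : Ext1 B L) (hz : h.cls.comp ξ (show 1 + 1 = 2 from rfl) = 0) :
    ∃ β : Ext1 X L, (mk₀ f).comp β (zero_add 1) = ξ :=
  contravariant_sequence_exact₁ h.shortExact _ ξ rfl hz

theorem IsSES.comp_cls_eq_zero_of_lift {A B X K : C} {f : B ⟶ X} {g : X ⟶ A} (h : IsSES f g)
    (β : Ext1 K X) :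
    (β.comp (mk₀ g) (add_zero 1)).comp h.cls (show 1 + 1 = 2 from rfl) = 0 := by
  rw [comp_assoc (a₁₂ := 1) (a₂₃ := 1) _ _ _ rfl rfl rfl, h.mk₀_comp_cls, Ext.comp_zero]

theorem IsSES.cls_comp_eq_zero_of_extend {A B X L : C} {f : B ⟶ X} {g : X ⟶ A} (h : IsSES f g)
    (β : Ext1 X L) :
    h.cls.comp ((mk₀ f).comp β (zero_add 1)) (show 1 + 1 = 2 from rfl) = 0 := by
  rw [← comp_assoc (a₁₂ := 1) (a₂₃ := 1) _ _ _ rfl rfl rfl, h.cls_comp_mk₀, Ext.zero_comp]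

theorem ext_two_eq_zero (hC : IsHereditary C) {X Y : C} (e : Ext X Y 2) : e = 0 :=
  haveI := hC X
  e.eq_zero_of_hasProjectiveDimensionLT 2 le_rfl

/-- The obstruction lies in `Ext²` of the cokernel of `b`, which is zero by heredity. -/
theorem exists_extend_of_mono (hC : IsHereditary C) {A A' B : C} (b : A ⟶ A') [Mono b]
    (ξ : Ext1 A B) : ∃ ξ' : Ext1 A' B, (mk₀ b).comp ξ' (zero_add 1) = ξ :=
  (isSES_cokernel b).extend_of_comp_eq_zero ξ (ext_two_eq_zero hC _)

theorem exists_lift_of_epi (hC : IsHereditary C) {X A K : C} (g : X ⟶ A) [Epi g]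
    (ζ : Ext1 K A) : ∃ ζ' : Ext1 K X, ζ'.comp (mk₀ g) (add_zero 1) = ζ :=
  (isSES_kernel g).lift_of_comp_eq_zero ζ (ext_two_eq_zero hC _)

/-- In a hereditary category, an extension of `A ⊆ A'` extends to an extension of `A'`. -/
theorem IsSES.exists_extend (hC : IsHereditary C) {A A' B X : C} {f : B ⟶ X} {g : X ⟶ A}
    (h : IsSES f g) (b : A ⟶ A') [Mono b] :
    ∃ (X' : C) (f' : B ⟶ X') (g' : X' ⟶ A') (φ : X ⟶ X'), IsSES f' g' ∧ f ≫ φ = f' ∧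
      φ ≫ g' = g ≫ b := by
  obtain ⟨ξ', hξ⟩ := exists_extend_of_mono hC b h.cls
  obtain ⟨X', f', g', h', rfl⟩ := exists_isSES_cls ξ'
  obtain ⟨φ, h1, h2⟩ := h.exists_hom h' (𝟙 B) b (by rw [hξ, comp_mk₀_id])
  exact ⟨X', f', g', φ, h', by simpa using h1, h2⟩

/-- In a hereditary category, an extension by `B` lifts along an epimorphism `B' ⟶ B`. -/
theorem IsSES.exists_colift (hC : IsHereditary C) {A B B' X : C} {f : B ⟶ X} {g : X ⟶ A}
    (h : IsSES f g) (b : B' ⟶ B) [Epi b] :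
    ∃ (X' : C) (f' : B' ⟶ X') (g' : X' ⟶ A) (φ : X' ⟶ X), IsSES f' g' ∧ f' ≫ φ = b ≫ f ∧
      φ ≫ g = g' := by
  obtain ⟨ξ', hξ⟩ := exists_lift_of_epi hC b h.cls
  obtain ⟨X', f', g', h', rfl⟩ := exists_isSES_cls ξ'
  obtain ⟨φ, h1, h2⟩ := h'.exists_hom h b (𝟙 A) (by rw [hξ, mk₀_id_comp])
  exact ⟨X', f', g', φ, h', h1, by simpa using h2⟩

end Ext1Algebra

/-! ### Biproducts of short exact sequences -/

section Biproduct
variable {C : Type u} [Category.{v} C] [Abelian C]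

theorem IsSES.biprodMap {A B X A' B' X' : C} {f : B ⟶ X} {g : X ⟶ A} {f' : B' ⟶ X'}
    {g' : X' ⟶ A'} (h : IsSES f g) (h' : IsSES f' g') :
    IsSES (biprod.map f f') (biprod.map g g') := by
  have := h.mono
  have := h.epi
  have := h'.mono
  have := h'.epi
  have : Mono (biprod.map f f') := ⟨fun k l e => by
    apply biprod.hom_ext
    · rw [← cancel_mono f]; simpa using e =≫ biprod.fst
    · rw [← cancel_mono f']; simpa using e =≫ biprod.snd⟩
  have : Epi (biprod.map g g') := ⟨fun k l e => by
    apply biprod.hom_ext'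
    · rw [← cancel_epi g]; simpa using biprod.inl ≫= e
    · rw [← cancel_epi g']; simpa using biprod.inr ≫= e⟩
  refine IsSES.of_mono_epi (by apply biprod.hom_ext <;> simp [h.w, h'.w]) fun k hk => ?_
  obtain ⟨l, hl⟩ := h.exists_lift (k ≫ biprod.fst) (by simpa using hk =≫ biprod.fst)
  obtain ⟨l', hl'⟩ := h'.exists_lift (k ≫ biprod.snd) (by simpa using hk =≫ biprod.snd)
  exact ⟨biprod.lift l l', by apply biprod.hom_ext <;> simp [hl, hl']⟩

theorem isSES_biprod_inl_snd (A B : C) : IsSES (biprod.inl : B ⟶ B ⊞ A) biprod.snd :=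
  IsSES.of_mono_epi (by simp) fun k hk => ⟨k ≫ biprod.fst, by
    apply biprod.hom_ext <;> simp [hk]⟩

end Biproduct

/-! ### Complexes with zero differential and contractible complexes -/

section PeriodicComplexes
variable {𝒜 : Type u} [Category.{v} 𝒜] [Abelian 𝒜] {t : ℕ}

theorem rel_succ (i : ZMod t) : (ComplexShape.up (ZMod t)).Rel i (i + 1) := rfl

theorem next_eq (i : ZMod t) : (ComplexShape.up (ZMod t)).next i = i + 1 :=
  ComplexShape.next_eq' _ rfl

theorem prev_eq (i : ZMod t) : (ComplexShape.up (ZMod t)).prev (i + 1) = i :=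
  ComplexShape.prev_eq' _ rfl

theorem exists_eq_succ (i : ZMod t) : ∃ j : ZMod t, i = j + 1 := ⟨i - 1, by simp⟩

/-- A periodic complex from its objects and differentials. -/
noncomputable abbrev periodicMk (X : ZMod t → 𝒜) (d : ∀ i, X i ⟶ X (i + 1))
    (sq : ∀ i, d i ≫ d (i + 1) = 0) : PeriodicComplex 𝒜 t where
  X := X
  d i j := if h : i + 1 = j then d i ≫ eqToHom (by rw [h]) else 0
  shape i j h := dif_neg h
  d_comp_d' := by
    rintro i _ _ rfl rfl
    simp [sq]

@[simp]
theorem periodicMk_d (X : ZMod t → 𝒜) (d : ∀ i, X i ⟶ X (i + 1)) (sq : ∀ i, d i ≫ d (i + 1) = 0)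
    (i : ZMod t) : (periodicMk X d sq).d i (i + 1) = d i := by
  simp [periodicMk]

/-- A morphism of periodic complexes from its components. -/
abbrev periodicHom {M N : PeriodicComplex 𝒜 t} (f : ∀ i, M.X i ⟶ N.X i)
    (h : ∀ i, f i ≫ N.d i (i + 1) = M.d i (i + 1) ≫ f (i + 1)) : M ⟶ N where
  f := f
  comm' := by
    rintro i _ rfl
    exact h i

theorem IsSES.of_degreewise {A B X : PeriodicComplex 𝒜 t} {f : B ⟶ X} {g : X ⟶ A}
    (h : ∀ i, IsSES (f.f i) (g.f i)) : IsSES f g :=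
  ⟨by ext i; exact (h i).w, HomologicalComplex.shortExact_of_degreewise_shortExact _
    fun i => (h i).shortExact⟩

/-- Exactness is expressed at `i + 1`, so that both neighbouring degrees are successors and no
transport along `i - 1 + 1 = i` occurs. -/
theorem acyclic_iff {K : PeriodicComplex 𝒜 t} : K.Acyclic ↔ ∀ (i : ZMod t) {Z : 𝒜}
    (x : Z ⟶ K.X (i + 1)), x ≫ K.d (i + 1) (i + 1 + 1) = 0 →
      ∃ (Z' : 𝒜) (π : Z' ⟶ Z) (_ : Epi π) (y : Z' ⟶ K.X i), π ≫ x = y ≫ K.d i (i + 1) := by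
  refine ⟨fun h i Z x hx => ?_, fun h j => ?_⟩
  · exact (K.exactAt_iff_exact_up_to_refinements i (i + 1) (i + 1 + 1) (prev_eq _) (next_eq _)).1
      (h (i + 1)) x hx
  · obtain ⟨i, rfl⟩ := exists_eq_succ j
    rw [K.exactAt_iff_exact_up_to_refinements i (i + 1) (i + 1 + 1) (prev_eq _) (next_eq _)]
    intro Z x hx
    exact h i x hx

/-- The complex with zero differential on a family of objects. -/
noncomputable abbrev zeroDiff (Y : ZMod t → 𝒜) : PeriodicComplex 𝒜 t :=
  periodicMk Y (fun _ => 0) fun _ => zero_comp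

@[simp]
theorem zeroDiff_d (Y : ZMod t → 𝒜) (i j : ZMod t) : (zeroDiff Y).d i j = 0 := by
  by_cases h : i + 1 = j
  · subst h
    exact periodicMk_d _ _ _ i
  · exact (zeroDiff Y).shape i j h

/-- The contractible complex with `Y i ⊞ Y (i + 1)` in degree `i`. -/
noncomputable abbrev diskSum (Y : ZMod t → 𝒜) : PeriodicComplex 𝒜 t :=
  periodicMk (fun i => Y i ⊞ Y (i + 1)) (fun _ => biprod.snd ≫ biprod.inl) fun _ => by simp

@[simp]
theorem diskSum_d (Y : ZMod t → 𝒜) (i : ZMod t) : (diskSum Y).d i (i + 1) =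
    (biprod.snd : Y i ⊞ Y (i + 1) ⟶ Y (i + 1)) ≫
      (biprod.inl : Y (i + 1) ⟶ Y (i + 1) ⊞ Y (i + 1 + 1)) :=
  periodicMk_d _ _ _ i

/-- The morphism of complexes with zero differential given by a family of morphisms. -/
noncomputable abbrev zeroDiffMap {Y Y' : ZMod t → 𝒜} (f : ∀ i, Y i ⟶ Y' i) :
    zeroDiff Y ⟶ zeroDiff Y' :=
  periodicHom f fun i => by simp

/-- The morphism of contractible complexes given by a family of morphisms. -/
noncomputable abbrev diskSumMap {Y Y' : ZMod t → 𝒜} (f : ∀ i, Y i ⟶ Y' i) :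
    diskSum Y ⟶ diskSum Y' :=
  periodicHom (fun i => biprod.map (f i) (f (i + 1))) fun i => by
    rw [diskSum_d, diskSum_d]
    simp

theorem isSES_zeroDiffMap {A B X : ZMod t → 𝒜} {f : ∀ i, B i ⟶ X i} {g : ∀ i, X i ⟶ A i}
    (h : ∀ i, IsSES (f i) (g i)) : IsSES (zeroDiffMap f) (zeroDiffMap g) :=
  IsSES.of_degreewise h

theorem isSES_diskSumMap {A B X : ZMod t → 𝒜} {f : ∀ i, B i ⟶ X i} {g : ∀ i, X i ⟶ A i}
    (h : ∀ i, IsSES (f i) (g i)) : IsSES (diskSumMap f) (diskSumMap g) :=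
  IsSES.of_degreewise fun i => (h i).biprodMap (h (i + 1))

/-- The inclusion of `Y` as the cycles of the contractible complex on `Y`. -/
noncomputable def diskSumι (Y : ZMod t → 𝒜) : zeroDiff Y ⟶ diskSum Y :=
  periodicHom (fun i => (biprod.inl : Y i ⟶ Y i ⊞ Y (i + 1))) fun i => by
    rw [diskSum_d, zeroDiff_d, zero_comp, biprod.inl_snd_assoc, zero_comp]

/-- The quotient of the contractible complex on `Y` by its cycles. -/
noncomputable def diskSumπ (Y : ZMod t → 𝒜) : diskSum Y ⟶ zeroDiff fun i => Y (i + 1) :=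
  periodicHom (fun i => (biprod.snd : Y i ⊞ Y (i + 1) ⟶ Y (i + 1))) fun i => by
    rw [diskSum_d, zeroDiff_d, comp_zero, Category.assoc]
    exact (by simp : biprod.snd ≫ (biprod.inl : Y (i + 1) ⟶ Y (i + 1) ⊞ Y (i + 1 + 1)) ≫
      biprod.snd = 0).symm

theorem isSES_diskSum (Y : ZMod t → 𝒜) : IsSES (diskSumι Y) (diskSumπ Y) :=
  IsSES.of_degreewise fun i => isSES_biprod_inl_snd (Y (i + 1)) (Y i)

theorem acyclic_diskSum (Y : ZMod t → 𝒜) : (diskSum Y).Acyclic := by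
  refine acyclic_iff.2 fun i Z (x : Z ⟶ Y (i + 1) ⊞ Y (i + 1 + 1)) hx => ?_
  rw [diskSum_d] at hx
  have h0 : x ≫ biprod.snd = 0 := by simpa using hx =≫ biprod.fst
  refine ⟨Z, 𝟙 Z, inferInstance, (x ≫ biprod.fst ≫ biprod.inr : Z ⟶ Y i ⊞ Y (i + 1)), ?_⟩
  rw [diskSum_d]
  apply biprod.hom_ext <;> simp [h0]

/-- The unit `M ⟶ D(M)`, `m ↦ (m, d m)`. -/
noncomputable def toDiskSum (M : PeriodicComplex 𝒜 t) : M ⟶ diskSum M.X :=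
  periodicHom (fun i => biprod.lift (𝟙 _) (M.d i (i + 1))) fun i => by
    rw [diskSum_d]
    apply biprod.hom_ext <;> simp

attribute [local instance] HasExt.standard

open Abelian Abelian.Ext

/-- Every extension of `M` by a contractible complex is induced by a degreewise extension. -/
theorem exists_cls_eq_toDiskSum_comp {M : PeriodicComplex 𝒜 t} {Y : ZMod t → 𝒜}
    (γ : Ext1 M (diskSum Y)) :
    ∃ (G : ZMod t → 𝒜) (f : ∀ i, Y i ⟶ G i) (g : ∀ i, G i ⟶ M.X i) (h : ∀ i, IsSES (f i) (g i)),
      γ = (mk₀ (toDiskSum M)).comp (isSES_diskSumMap h).cls (zero_add 1) := by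
  obtain ⟨E, ι, p, hE, rfl⟩ := exists_isSES_cls γ
  have hs := hE.degreewise
  -- `diskSum` is right adjoint to taking the objects of a complex. The degreewise extension
  -- corresponding to `γ` is the pushout of its degree `i` part along the first projection of `Y i ⊞
  -- Y (i + 1)`.
  have key : ∀ i, ∃ (G : 𝒜) (f : Y i ⟶ G) (g : G ⟶ M.X i) (q : E.X i ⟶ G), IsSES f g ∧
      ι.f i ≫ q = (biprod.fst : Y i ⊞ Y (i + 1) ⟶ Y i) ≫ f ∧ q ≫ g = p.f i := by
    intro i
    obtain ⟨G, f, g, h, hc⟩ := exists_isSES_cls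
      ((hs i).cls.comp (mk₀ (biprod.fst : Y i ⊞ Y (i + 1) ⟶ Y i)) (add_zero 1))
    obtain ⟨q, h1, h2⟩ := (hs i).exists_hom h biprod.fst (𝟙 _) (by rw [mk₀_id_comp, hc])
    exact ⟨G, f, g, q, h, h1, by simpa using h2⟩
  choose G f g q h h1 h2 using key
  refine ⟨G, f, g, h, ?_⟩
  -- The adjoint of the family `q`, namely `x ↦ (q x, q (d x))`.
  let φ : E ⟶ diskSum G :=
    periodicHom (fun i => biprod.lift (q i) (E.d i (i + 1) ≫ q (i + 1))) fun i => by
      rw [diskSum_d]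
      apply biprod.hom_ext <;> simp
  have := hE.cls_naturality (isSES_diskSumMap h) (𝟙 _) φ (toDiskSum M) ?_ ?_
  · rwa [comp_mk₀_id] at this
  · refine HomologicalComplex.hom_ext _ _ fun i => ?_
    rw [Category.id_comp]
    change ι.f i ≫ biprod.lift (q i) (E.d i (i + 1) ≫ q (i + 1)) = biprod.map (f i) (f (i + 1))
    apply biprod.hom_ext
    · simp [h1]
    · have := ι.comm i (i + 1)
      rw [diskSum_d] at this
      simp [reassoc_of% this, h1]
  · refine HomologicalComplex.hom_ext _ _ fun i => ?_
    change biprod.lift (q i) (E.d i (i + 1) ≫ q (i + 1)) ≫ biprod.map (g i) (g (i + 1)) =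
      p.f i ≫ biprod.lift (𝟙 _) (M.d i (i + 1))
    apply biprod.hom_ext <;> simp [h2]

end PeriodicComplexes

/-! ### Cycles and opcycles in extensions with an acyclic end -/

section CyclesSequences
variable {𝒜 : Type u} [Category.{v} 𝒜] [Abelian 𝒜] {t : ℕ}

open HomologicalComplex

/-- Opcycles are always right exact; acyclicity of `K` gives injectivity. If `f b = d z`, then `g z`
is a cycle of `K`, hence `g z = d w`. For a lift `w'` of `w`, the element `z - d w'` comes from `B`
and has differential `b`. -/
theorem IsSES.opcycles {B X K : PeriodicComplex 𝒜 t} {f : B ⟶ X} {g : X ⟶ K} (h : IsSES f g)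
    (hK : K.Acyclic) (i : ZMod t) : IsSES (opcyclesMap f i) (opcyclesMap g i) := by
  have hs := h.degreewise
  have := fun i => (hs i).mono
  have := fun i => (hs i).epi
  -- The degree is written as `i + 1 + 1`, because the diagram chase goes back two degrees.
  obtain ⟨i, rfl⟩ := exists_eq_succ i
  obtain ⟨i, rfl⟩ := exists_eq_succ i
  have : Mono (opcyclesMap f (i + 1 + 1)) := by
    rw [Preadditive.mono_iff_cancel_zero]
    intro T x hx
    obtain ⟨T₁, π₁, _, y, hy⟩ :=
      surjective_up_to_refinements_of_epi (B.pOpcycles (i + 1 + 1)) x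
    have h0 : (y ≫ f.f _) ≫ X.pOpcycles (i + 1 + 1) = 0 := by
      rw [Category.assoc, ← p_opcyclesMap, ← reassoc_of% hy, hx, comp_zero]
    obtain ⟨T₂, π₂, _, z, hz⟩ :=
      (comp_pOpcycles_eq_zero_iff_up_to_refinements _ _ (i + 1) (prev_eq _)).1 h0
    obtain ⟨T₃, π₃, _, w, hw⟩ := (acyclic_iff.1 hK) i (z ≫ g.f (i + 1)) (by
      rw [Category.assoc, g.comm, ← reassoc_of% hz, (hs _).w, comp_zero, comp_zero])
    obtain ⟨T₄, π₄, _, w', hw'⟩ := surjective_up_to_refinements_of_epi (g.f i) w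
    obtain ⟨v, hv⟩ := (hs (i + 1)).exists_lift (π₄ ≫ π₃ ≫ z - w' ≫ X.d i (i + 1)) (by
      rw [Preadditive.sub_comp, Category.assoc, Category.assoc, Category.assoc, hw,
        ← g.comm, reassoc_of% hw', sub_self])
    have e : π₄ ≫ π₃ ≫ π₂ ≫ y = v ≫ B.d (i + 1) (i + 1 + 1) := by
      rw [← cancel_mono (f.f (i + 1 + 1))]
      simp only [Category.assoc]
      rw [← f.comm, reassoc_of% hv]
      simp [hz]
    rw [← cancel_epi π₁, ← cancel_epi π₂, ← cancel_epi π₃, ← cancel_epi π₄, hy,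
      reassoc_of% e]
    simp
  refine IsSES.of_mono_epi' ?_ fun {Z} k hk => ?_
  · rw [← opcyclesMap_comp, h.w, opcyclesMap_zero]
  · obtain ⟨l, hl⟩ := (hs (i + 1 + 1)).exists_desc (X.pOpcycles _ ≫ k) (by
      rw [← p_opcyclesMap_assoc, hk, comp_zero])
    refine ⟨K.descOpcycles l (i + 1) (prev_eq _) ?_, ?_⟩
    · rw [← cancel_epi (g.f (i + 1)), g.comm_assoc, hl]
      simp
    · rw [← cancel_epi (X.pOpcycles _), p_opcyclesMap_assoc, p_descOpcycles, hl]

/-- Cycles are always left exact, so surjectivity is all that has to be assumed. -/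
theorem IsSES.cycles_of_epi {B X A : PeriodicComplex 𝒜 t} {f : B ⟶ X} {g : X ⟶ A} (h : IsSES f g)
    (i : ZMod t) [Epi (cyclesMap g i)] : IsSES (cyclesMap f i) (cyclesMap g i) := by
  have hs := h.degreewise
  have := fun i => (hs i).mono
  refine IsSES.of_mono_epi ?_ fun {Z} k hk => ?_
  · rw [← cyclesMap_comp, h.w, cyclesMap_zero]
  · obtain ⟨l, hl⟩ := (hs i).exists_lift (k ≫ X.iCycles i) (by
      rw [Category.assoc, ← cyclesMap_i, reassoc_of% hk, zero_comp])
    refine ⟨B.liftCycles l (i + 1) (next_eq _) ?_, ?_⟩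
    · rw [← cancel_mono (f.f (i + 1)), Category.assoc, ← f.comm, reassoc_of% hl]
      simp
    · rw [← cancel_mono (X.iCycles _), Category.assoc, cyclesMap_i, liftCycles_i_assoc, hl]

/-- A cycle of `K` is a boundary `d y`, and the differential of a lift of `y` is a cycle that lifts
it. -/
theorem IsSES.cycles_of_acyclic_right {B X K : PeriodicComplex 𝒜 t} {f : B ⟶ X} {g : X ⟶ K}
    (h : IsSES f g) (hK : K.Acyclic) (i : ZMod t) :
    IsSES (cyclesMap f i) (cyclesMap g i) := by
  have hs := h.degreewise
  have := fun i => (hs i).epi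
  obtain ⟨i, rfl⟩ := exists_eq_succ i
  have : Epi (cyclesMap g (i + 1)) := by
    rw [epi_iff_surjective_up_to_refinements]
    intro T x
    obtain ⟨T₁, π₁, _, y, hy⟩ := (acyclic_iff.1 hK) i (x ≫ K.iCycles _) (by simp)
    obtain ⟨T₂, π₂, _, z, hz⟩ := surjective_up_to_refinements_of_epi (g.f i) y
    refine ⟨T₂, π₂ ≫ π₁, inferInstance, z ≫ X.toCycles i (i + 1), ?_⟩
    rw [← cancel_mono (K.iCycles _)]
    simp [hy, reassoc_of% hz]
  exact h.cycles_of_epi _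

/-- For a lift `y` of a cycle of `A`, the element `d y` is a cycle of `K`, hence `d y = d v` with
`v` in `K`; then `y - v` is a cycle with the same image. -/
theorem IsSES.cycles_of_acyclic_left {K X A : PeriodicComplex 𝒜 t} {f : K ⟶ X} {g : X ⟶ A}
    (h : IsSES f g) (hK : K.Acyclic) (i : ZMod t) :
    IsSES (cyclesMap f i) (cyclesMap g i) := by
  have hs := h.degreewise
  have := fun i => (hs i).epi
  have := fun i => (hs i).mono
  have : Epi (cyclesMap g i) := by
    rw [epi_iff_surjective_up_to_refinements]
    intro T x
    obtain ⟨T₁, π₁, _, y, hy⟩ := surjective_up_to_refinements_of_epi (g.f i) (x ≫ A.iCycles i)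
    obtain ⟨w, hw⟩ := (hs (i + 1)).exists_lift (y ≫ X.d i (i + 1)) (by
      rw [Category.assoc, ← g.comm, ← reassoc_of% hy]
      simp)
    obtain ⟨T₂, π₂, _, v, hv⟩ := (acyclic_iff.1 hK) i w (by
      rw [← cancel_mono (f.f _), Category.assoc, ← f.comm, reassoc_of% hw]
      simp)
    refine ⟨T₂, π₂ ≫ π₁, inferInstance,
      X.liftCycles (π₂ ≫ y - v ≫ f.f i) (i + 1) (next_eq _) ?_, ?_⟩
    · simp [← hw, reassoc_of% hv]
    · rw [← cancel_mono (A.iCycles _)]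
      simp [hy, (hs i).w]
  exact h.cycles_of_epi _

instance (Y : ZMod t → 𝒜) (i : ZMod t) : IsIso ((zeroDiff Y).pOpcycles i) := by
  obtain ⟨i, rfl⟩ := exists_eq_succ i
  exact (zeroDiff Y).isIso_pOpcycles i (i + 1) (prev_eq _) (by simp)

instance (Y : ZMod t → 𝒜) (i : ZMod t) : IsIso ((zeroDiff Y).iCycles i) :=
  (zeroDiff Y).isIso_iCycles i (i + 1) (next_eq _) (by simp)

/-- The projection of a complex onto its objects of opcycles. -/
noncomputable abbrev toOpcycles (M : PeriodicComplex 𝒜 t) : M ⟶ zeroDiff fun i => M.opcycles i :=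
  periodicHom (fun i => M.pOpcycles i) fun i => by simp

/-- The inclusion of the objects of cycles in a complex. -/
noncomputable abbrev fromCycles (M : PeriodicComplex 𝒜 t) : (zeroDiff fun i => M.cycles i) ⟶ M :=
  periodicHom (fun i => M.iCycles i) fun i => by simp

theorem mono_fromOpcycles {K : PeriodicComplex 𝒜 t} (hK : K.Acyclic) (i : ZMod t) :
    Mono (K.fromOpcycles i (i + 1)) := by
  obtain ⟨i, rfl⟩ := exists_eq_succ i
  rw [Preadditive.mono_iff_cancel_zero]
  intro T x hx
  obtain ⟨T₁, π₁, _, y, hy⟩ := surjective_up_to_refinements_of_epi (K.pOpcycles (i + 1)) x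
  obtain ⟨T₂, π₂, _, z, hz⟩ := (acyclic_iff.1 hK) i y (by
    rw [← K.p_fromOpcycles, ← reassoc_of% hy, hx, comp_zero])
  rw [← cancel_epi π₁, ← cancel_epi π₂, hy, reassoc_of% hz]
  simp

theorem epi_toCycles {K : PeriodicComplex 𝒜 t} (hK : K.Acyclic) (i : ZMod t) :
    Epi (K.toCycles i (i + 1)) := by
  rw [epi_iff_surjective_up_to_refinements]
  intro T x
  obtain ⟨T₁, π₁, _, y, hy⟩ := (acyclic_iff.1 hK) i (x ≫ K.iCycles _) (by simp)
  exact ⟨T₁, π₁, inferInstance, y, by rw [← cancel_mono (K.iCycles _)]; simpa using hy⟩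

end CyclesSequences

/-! ### Yoneda products starting or ending at a contractible complex -/

section ExtVanishing
variable {𝒜 : Type u} [Category.{v} 𝒜] [Abelian 𝒜] {t : ℕ}

open HomologicalComplex

attribute [local instance] HasExt.standard

open Abelian Abelian.Ext

/-- The objects of a complex, shifted by one. -/
abbrev shiftX (M : PeriodicComplex 𝒜 t) (i : ZMod t) : 𝒜 := M.X (i - 1)

/-- The counit `(m, m') ↦ d m + m'` from a contractible complex to `M`. -/
noncomputable abbrev fromDiskSum (M : PeriodicComplex 𝒜 t) : diskSum (shiftX M) ⟶ M :=
  periodicHom (fun i => biprod.desc (M.d (i - 1) i)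
    (M.XIsoOfEq (add_sub_cancel_right i 1)).hom) fun i => by
    rw [diskSum_d]
    apply biprod.hom_ext' <;> simp

/-- The inclusion of `Y i` in degree `i - 1` of the contractible complex on `Y`. -/
noncomputable abbrev diskSumGen (Y : ZMod t → 𝒜) (i : ZMod t) : Y i ⟶ (diskSum Y).X (i - 1) :=
  eqToHom (by rw [sub_add_cancel]) ≫ (biprod.inr : Y (i - 1 + 1) ⟶ Y (i - 1) ⊞ Y (i - 1 + 1))

theorem diskSumGen_d (Y : ZMod t → 𝒜) (i : ZMod t) :
    diskSumGen Y i ≫ (diskSum Y).d (i - 1) i = (biprod.inl : Y i ⟶ Y i ⊞ Y (i + 1)) := by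
  -- With `i - 1` replaced by any `j` such that `j + 1 = i`, substitution removes the transport.
  have : ∀ (j : ZMod t) (h : j + 1 = i), (eqToHom (by rw [h]) ≫
      (biprod.inr : Y (j + 1) ⟶ Y j ⊞ Y (j + 1))) ≫ (diskSum Y).d j i =
      (biprod.inl : Y i ⟶ Y i ⊞ Y (i + 1)) := by
    rintro j rfl
    rw [diskSum_d]
    simp
  exact this (i - 1) (sub_add_cancel i 1)

theorem diskSumGen_succ (Y : ZMod t → 𝒜) (i : ZMod t) :
    diskSumGen Y (i + 1) ≫ ((diskSum Y).XIsoOfEq (add_sub_cancel_right i 1)).hom =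
      (biprod.inr : Y (i + 1) ⟶ Y i ⊞ Y (i + 1)) := by
  have : ∀ (j : ZMod t) (h : j = i), (eqToHom (by rw [h]) ≫
      (biprod.inr : Y (j + 1) ⟶ Y j ⊞ Y (j + 1))) ≫ ((diskSum Y).XIsoOfEq h).hom =
      (biprod.inr : Y (i + 1) ⟶ Y i ⊞ Y (i + 1)) := by
    rintro j rfl
    simp
  exact this (i + 1 - 1) (add_sub_cancel_right i 1)

/-- Every extension of a contractible complex is induced by a degreewise extension. -/
theorem exists_cls_comp_fromDiskSum_eq {M : PeriodicComplex 𝒜 t} {Y : ZMod t → 𝒜}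
    (γ : Ext1 (diskSum Y) M) :
    ∃ (G : ZMod t → 𝒜) (f : ∀ i, shiftX M i ⟶ G i) (g : ∀ i, G i ⟶ Y i)
      (h : ∀ i, IsSES (f i) (g i)),
      γ = (isSES_diskSumMap h).cls.comp (mk₀ (fromDiskSum M)) (add_zero 1) := by
  obtain ⟨E, ι, p, hE, rfl⟩ := exists_isSES_cls γ
  have hs := hE.degreewise
  -- Up to a shift, `diskSum` is also left adjoint to taking objects: `Y i` generates its disk from
  -- degree `i - 1`. Hence the extension in degree `i - 1` is pulled back along the inclusion of
  -- these generators.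
  have key : ∀ i, ∃ (G : 𝒜) (f : M.X (i - 1) ⟶ G) (g : G ⟶ Y i) (q : G ⟶ E.X (i - 1)), IsSES f g ∧
      f ≫ q = ι.f (i - 1) ∧ q ≫ p.f (i - 1) = g ≫ diskSumGen Y i := by
    intro i
    obtain ⟨G, f, g, h, hc⟩ := exists_isSES_cls
      ((mk₀ (diskSumGen Y i)).comp (hs (i - 1)).cls (zero_add 1))
    obtain ⟨q, h1, h2⟩ := h.exists_hom (hs (i - 1)) (𝟙 _) (diskSumGen Y i)
      (by rw [comp_mk₀_id, hc])
    exact ⟨G, f, g, q, h, by simpa using h1, h2⟩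
  choose G f g q h h1 h2 using key
  refine ⟨G, f, g, h, ?_⟩
  -- The adjoint of the family `q`, namely `(x, y) ↦ d (q x) + q y`.
  let φ : diskSum G ⟶ E :=
    periodicHom (fun i => biprod.desc (q i ≫ E.d (i - 1) i)
      (q (i + 1) ≫ (E.XIsoOfEq (add_sub_cancel_right i 1)).hom)) fun i => by
      rw [diskSum_d]
      apply biprod.hom_ext' <;> simp
  have := (isSES_diskSumMap h).cls_naturality hE (fromDiskSum M) φ (𝟙 _) ?_ ?_
  · rw [mk₀_id_comp] at this
    exact this.symm
  · refine HomologicalComplex.hom_ext _ _ fun i => ?_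
    change biprod.map (f i) (f (i + 1)) ≫ biprod.desc (q i ≫ E.d (i - 1) i)
      (q (i + 1) ≫ (E.XIsoOfEq (add_sub_cancel_right i 1)).hom) =
      biprod.desc (M.d (i - 1) i) (M.XIsoOfEq (add_sub_cancel_right i 1)).hom ≫ ι.f i
    apply biprod.hom_ext'
    · simp [reassoc_of% h1]
    · simp [reassoc_of% h1, XIsoOfEq_hom_naturality]
  · refine HomologicalComplex.hom_ext _ _ fun i => ?_
    rw [Category.comp_id]
    change biprod.desc (q i ≫ E.d (i - 1) i)
      (q (i + 1) ≫ (E.XIsoOfEq (add_sub_cancel_right i 1)).hom) ≫ p.f i =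
      biprod.map (g i) (g (i + 1))
    apply biprod.hom_ext'
    · have := diskSumGen_d Y i
      simp only [biprod.inl_desc_assoc, Category.assoc, ← p.comm, reassoc_of% h2, biprod.inl_map]
      rw [← this]
      simp
    · have := diskSumGen_succ Y i
      simp only [biprod.inr_desc_assoc, Category.assoc, biprod.inr_map]
      rw [← this, ← XIsoOfEq_hom_naturality, ← Category.assoc, h2, Category.assoc]

/-- Heredity is used degree by degree: each first extension lifts along the epimorphism `g' i` of
the second. After applying `diskSum`, the first class is the image of another one under `g'`, and
`g'` annihilates the class of the second sequence. -/
theorem diskSum_cls_comp_cls_eq_zero (h𝒜 : IsHereditary 𝒜) {A B D X Y : ZMod t → 𝒜}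
    {f : ∀ i, B i ⟶ X i} {g : ∀ i, X i ⟶ A i} (h : ∀ i, IsSES (f i) (g i))
    {f' : ∀ i, D i ⟶ Y i} {g' : ∀ i, Y i ⟶ B i} (h' : ∀ i, IsSES (f' i) (g' i)) :
    (isSES_diskSumMap h).cls.comp (isSES_diskSumMap h').cls (show 1 + 1 = 2 from rfl) = 0 := by
  have := fun i => (h' i).epi
  have key := fun i => (h i).exists_colift h𝒜 (g' i)
  choose G a b φ h₁ h₂ h₃ using key
  have := (isSES_diskSumMap h₁).cls_naturality (isSES_diskSumMap h) (diskSumMap g')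
    (diskSumMap φ) (𝟙 _)
    (HomologicalComplex.hom_ext _ _ fun i => by
      change biprod.map (a i) (a (i + 1)) ≫ biprod.map (φ i) (φ (i + 1)) =
        biprod.map (g' i) (g' (i + 1)) ≫ biprod.map (f i) (f (i + 1))
      apply biprod.hom_ext' <;> simp [reassoc_of% h₂])
    (HomologicalComplex.hom_ext _ _ fun i => by
      rw [Category.comp_id]
      change biprod.map (φ i) (φ (i + 1)) ≫ biprod.map (g i) (g (i + 1)) =
        biprod.map (b i) (b (i + 1))
      apply biprod.hom_ext' <;> simp [reassoc_of% h₃])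
  rw [mk₀_id_comp] at this
  rw [← this]
  exact (isSES_diskSumMap h').comp_cls_eq_zero_of_lift _

/-- `ξ` factors through the unit `toDiskSum M`. Then `ζ` followed by this unit is again an extension
by a contractible complex and factors through the unit of `K`, which leaves a product of two classes
coming from degreewise extensions. -/
theorem comp_eq_zero_of_diskSum_right (h𝒜 : IsHereditary 𝒜) {K M : PeriodicComplex 𝒜 t}
    {Y : ZMod t → 𝒜} (ζ : Ext1 K M) (ξ : Ext1 M (diskSum Y)) :
    ζ.comp ξ (show 1 + 1 = 2 from rfl) = 0 := by
  obtain ⟨G, f, g, h, rfl⟩ := exists_cls_eq_toDiskSum_comp ξ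
  obtain ⟨G', f', g', h', e⟩ :=
    exists_cls_eq_toDiskSum_comp (ζ.comp (mk₀ (toDiskSum M)) (add_zero 1))
  rw [← comp_assoc (a₁₂ := 1) (a₂₃ := 1) _ _ _ rfl rfl rfl, e,
    comp_assoc (a₁₂ := 1) (a₂₃ := 2) _ _ _ rfl rfl rfl, diskSum_cls_comp_cls_eq_zero h𝒜 h' h,
    Ext.comp_zero]

theorem comp_eq_zero_of_diskSum_left (h𝒜 : IsHereditary 𝒜) {K M : PeriodicComplex 𝒜 t}
    {Y : ZMod t → 𝒜} (ζ : Ext1 (diskSum Y) M) (ξ : Ext1 M K) :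
    ζ.comp ξ (show 1 + 1 = 2 from rfl) = 0 := by
  obtain ⟨G, f, g, h, rfl⟩ := exists_cls_comp_fromDiskSum_eq ζ
  obtain ⟨G', f', g', h', e⟩ :=
    exists_cls_comp_fromDiskSum_eq ((mk₀ (fromDiskSum M)).comp ξ (zero_add 1))
  rw [comp_assoc (a₁₂ := 1) (a₂₃ := 1) _ _ _ rfl rfl rfl, e,
    ← comp_assoc (a₁₂ := 2) (a₂₃ := 1) _ _ _ rfl rfl rfl, diskSum_cls_comp_cls_eq_zero h𝒜 h h',
    Ext.zero_comp]

end ExtVanishing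

/-! ### Yoneda products starting or ending at an acyclic complex -/

section AcyclicExt
variable {𝒜 : Type u} [Category.{v} 𝒜] [Abelian 𝒜] {t : ℕ}

open HomologicalComplex

attribute [local instance] HasExt.standard

open Abelian Abelian.Ext

theorem IsSES.opcycles_zeroDiff {Y : ZMod t → 𝒜} {E K : PeriodicComplex 𝒜 t} {f : zeroDiff Y ⟶ E}
    {g : E ⟶ K} (h : IsSES f g) (hK : K.Acyclic) (i : ZMod t) :
    IsSES ((zeroDiff Y).pOpcycles i ≫ opcyclesMap f i) (opcyclesMap g i) :=
  (h.opcycles hK i).iso_comp (asIso ((zeroDiff Y).pOpcycles i))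

theorem IsSES.cycles_zeroDiff {Y : ZMod t → 𝒜} {E K : PeriodicComplex 𝒜 t} {f : K ⟶ E}
    {g : E ⟶ zeroDiff Y} (h : IsSES f g) (hK : K.Acyclic) (i : ZMod t) :
    IsSES (cyclesMap f i) (cyclesMap g i ≫ (zeroDiff Y).iCycles i) :=
  (h.cycles_of_acyclic_left hK i).comp_iso' (asIso ((zeroDiff Y).iCycles i))

/-- An extension of an acyclic complex by a complex with zero differential is induced by the
extensions of the opcycles. -/
theorem IsSES.cls_eq_toOpcycles_comp {Y : ZMod t → 𝒜} {E K : PeriodicComplex 𝒜 t}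
    {f : zeroDiff Y ⟶ E} {g : E ⟶ K} (h : IsSES f g) (hK : K.Acyclic) :
    h.cls = (mk₀ (toOpcycles K)).comp (isSES_zeroDiffMap (h.opcycles_zeroDiff hK)).cls
      (zero_add 1) := by
  have := h.cls_naturality (isSES_zeroDiffMap (h.opcycles_zeroDiff hK)) (𝟙 _) (toOpcycles E)
    (toOpcycles K) ?_ ?_
  · rwa [comp_mk₀_id] at this
  · refine HomologicalComplex.hom_ext _ _ fun i => ?_
    rw [Category.id_comp]
    exact (p_opcyclesMap f i).symm
  · refine HomologicalComplex.hom_ext _ _ fun i => ?_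
    exact p_opcyclesMap g i

/-- The cycles of `E` form a subextension with the same quotient, because `K` is acyclic and the
quotient consists of cycles only. -/
theorem IsSES.cls_eq_comp_fromCycles {Y : ZMod t → 𝒜} {E K : PeriodicComplex 𝒜 t}
    {f : K ⟶ E} {g : E ⟶ zeroDiff Y} (h : IsSES f g) (hK : K.Acyclic) :
    h.cls = (isSES_zeroDiffMap (h.cycles_zeroDiff hK)).cls.comp (mk₀ (fromCycles K))
      (add_zero 1) := by
  have := (isSES_zeroDiffMap (h.cycles_zeroDiff hK)).cls_naturality h (fromCycles K)
    (fromCycles E) (𝟙 _) ?_ ?_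
  · rw [mk₀_id_comp] at this
    exact this.symm
  · refine HomologicalComplex.hom_ext _ _ fun i => ?_
    exact (cyclesMap_i f i)
  · refine HomologicalComplex.hom_ext _ _ fun i => ?_
    rw [Category.comp_id]
    exact (cyclesMap_i g i).symm

theorem exists_cls_eq_toOpcycles_comp {K : PeriodicComplex 𝒜 t} (hK : K.Acyclic)
    {Y : ZMod t → 𝒜} (γ : Ext1 K (zeroDiff Y)) :
    ∃ (G : ZMod t → 𝒜) (f : ∀ i, Y i ⟶ G i) (g : ∀ i, G i ⟶ K.opcycles i)
      (h : ∀ i, IsSES (f i) (g i)),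
      γ = (mk₀ (toOpcycles K)).comp (isSES_zeroDiffMap h).cls (zero_add 1) := by
  obtain ⟨E, ι, p, hE, rfl⟩ := exists_isSES_cls γ
  exact ⟨_, _, _, hE.opcycles_zeroDiff hK, hE.cls_eq_toOpcycles_comp hK⟩

theorem exists_cls_eq_comp_fromCycles {K : PeriodicComplex 𝒜 t} (hK : K.Acyclic)
    {Y : ZMod t → 𝒜} (γ : Ext1 (zeroDiff Y) K) :
    ∃ (G : ZMod t → 𝒜) (f : ∀ i, K.cycles i ⟶ G i) (g : ∀ i, G i ⟶ Y i)
      (h : ∀ i, IsSES (f i) (g i)),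
      γ = (isSES_zeroDiffMap h).cls.comp (mk₀ (fromCycles K)) (add_zero 1) := by
  obtain ⟨E, ι, p, hE, rfl⟩ := exists_isSES_cls γ
  exact ⟨_, _, _, hE.cycles_zeroDiff hK, hE.cls_eq_comp_fromCycles hK⟩

/-- `γ` comes from extensions of the opcycles of `K` in degree `i` by `Y (i + 1)`. As `K` is
acyclic, these opcycles embed into `K.X (i + 1)`, so heredity extends them to extensions of the
objects of `K`. By adjunction those define an extension of `K` by the contractible complex. -/
theorem exists_lift_diskSum (h𝒜 : IsHereditary 𝒜) {K : PeriodicComplex 𝒜 t} (hK : K.Acyclic)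
    {Y : ZMod t → 𝒜} (γ : Ext1 K (zeroDiff fun i => Y (i + 1))) :
    ∃ β : Ext1 K (diskSum Y), β.comp (mk₀ (diskSumπ Y)) (add_zero 1) = γ := by
  obtain ⟨G, f, g, h, rfl⟩ := exists_cls_eq_toOpcycles_comp hK γ
  -- The extended objects are indexed by the target degree `k = i + 1`, while the given ones live in
  -- degree `i`; quantifying over all `i` with `i + 1 = k` bridges the two.
  have key : ∀ k : ZMod t, ∃ (G' : 𝒜) (f' : Y k ⟶ G') (g' : G' ⟶ K.X k), IsSES f' g' ∧
      ∀ (i : ZMod t) (e : i + 1 = k), ∃ φ : G i ⟶ G', f i ≫ φ = eqToHom (by rw [e]) ≫ f' ∧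
        φ ≫ g' = g i ≫ K.fromOpcycles i k := by
    intro k
    obtain ⟨i, rfl⟩ := exists_eq_succ k
    have := mono_fromOpcycles hK i
    obtain ⟨G', f', g', φ, h', h1, h2⟩ := (h i).exists_extend h𝒜 (K.fromOpcycles i (i + 1))
    refine ⟨G', f', g', h', fun j e => ?_⟩
    obtain rfl : j = i := by simpa using e
    exact ⟨φ, by simpa using h1, h2⟩
  choose G' f' g' h' φ h1 h2 using key
  refine ⟨(mk₀ (toDiskSum K)).comp (isSES_diskSumMap h').cls (zero_add 1), ?_⟩
  have n1 := (isSES_diskSumMap h').cls_naturality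
    (isSES_zeroDiffMap fun i => h' (i + 1)) (diskSumπ Y) (diskSumπ G') (diskSumπ K.X)
    (HomologicalComplex.hom_ext _ _ fun i => biprod.map_snd _ _)
    (HomologicalComplex.hom_ext _ _ fun i => (biprod.map_snd _ _).symm)
  have n2 := (isSES_zeroDiffMap h).cls_naturality
    (isSES_zeroDiffMap fun i => h' (i + 1)) (𝟙 _) (zeroDiffMap fun i => φ (i + 1) i rfl)
    (zeroDiffMap fun i => K.fromOpcycles i (i + 1))
    (HomologicalComplex.hom_ext _ _ fun i => (h1 (i + 1) i rfl))
    (HomologicalComplex.hom_ext _ _ fun i => (h2 (i + 1) i rfl))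
  -- Both composites are the differential of `K`.
  have n3 : toDiskSum K ≫ diskSumπ K.X =
      toOpcycles K ≫ zeroDiffMap fun i => K.fromOpcycles i (i + 1) :=
    HomologicalComplex.hom_ext _ _ fun i =>
      (biprod.lift_snd _ _).trans (K.p_fromOpcycles i (i + 1)).symm
  rw [comp_mk₀_id] at n2
  rw [n2, comp_assoc (a₁₂ := 1) (a₂₃ := 1) _ _ _ rfl rfl rfl, n1, mk₀_comp_mk₀_assoc,
    mk₀_comp_mk₀_assoc, n3]

/-- Dual argument: `γ` comes from extensions by the cycles of `K`, which are quotients of the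
objects in the preceding degree because `K` is acyclic. -/
theorem exists_extend_diskSum (h𝒜 : IsHereditary 𝒜) {K : PeriodicComplex 𝒜 t} (hK : K.Acyclic)
    {Y : ZMod t → 𝒜} (γ : Ext1 (zeroDiff Y) K) :
    ∃ β : Ext1 (diskSum Y) K, (mk₀ (diskSumι Y)).comp β (zero_add 1) = γ := by
  obtain ⟨G, f, g, h, rfl⟩ := exists_cls_eq_comp_fromCycles hK γ
  have : ∀ i : ZMod t, Epi (K.toCycles (i - 1) i) := by
    intro i
    obtain ⟨i, rfl⟩ := exists_eq_succ i
    rw [add_sub_cancel_right]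
    exact epi_toCycles hK i
  choose G' f' g' φ h' h1 h2 using fun i => (h i).exists_colift h𝒜 (K.toCycles (i - 1) i)
  refine ⟨(isSES_diskSumMap h').cls.comp (mk₀ (fromDiskSum K)) (add_zero 1), ?_⟩
  have n1 := (isSES_zeroDiffMap h').cls_naturality (isSES_diskSumMap h')
    (diskSumι (shiftX K)) (diskSumι G') (diskSumι Y)
    (HomologicalComplex.hom_ext _ _ fun i => (biprod.inl_map _ _).symm)
    (HomologicalComplex.hom_ext _ _ fun i => (biprod.inl_map _ _))
  have n2 := (isSES_zeroDiffMap h').cls_naturality (isSES_zeroDiffMap h)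
    (zeroDiffMap fun i => K.toCycles (i - 1) i) (zeroDiffMap φ) (𝟙 _)
    (HomologicalComplex.hom_ext _ _ fun i => h1 i)
    (HomologicalComplex.hom_ext _ _ fun i => (h2 i).trans (Category.comp_id _).symm)
  have n3 : diskSumι (shiftX K) ≫ fromDiskSum K =
      (zeroDiffMap fun i => K.toCycles (i - 1) i) ≫ fromCycles K :=
    HomologicalComplex.hom_ext _ _ fun i =>
      (biprod.inl_desc _ _).trans (K.toCycles_i (i - 1) i).symm
  rw [mk₀_id_comp] at n2
  rw [← n2, comp_assoc (a₁₂ := 1) (a₂₃ := 0) _ _ _ rfl rfl rfl, mk₀_comp_mk₀, ← n3,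
    ← mk₀_comp_mk₀, ← comp_assoc (a₁₂ := 1) (a₂₃ := 0) _ _ _ rfl rfl rfl, n1,
    comp_assoc (a₁₂ := 1) (a₂₃ := 1) _ _ _ rfl rfl rfl]

/-- In the sequence that embeds `zeroDiff Y` in a contractible complex, the product dies in the
middle term, so it is the connecting image of some `γ` in `Ext¹`. Since `γ` lifts to the middle term
by `exists_lift_diskSum`, this image is zero. -/
theorem comp_eq_zero_of_acyclic_of_zeroDiff (h𝒜 : IsHereditary 𝒜) {K M : PeriodicComplex 𝒜 t}
    (hK : K.Acyclic) {Y : ZMod t → 𝒜} (ζ : Ext1 K M) (ξ : Ext1 M (zeroDiff Y)) :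
    ζ.comp ξ (show 1 + 1 = 2 from rfl) = 0 := by
  obtain ⟨γ, hγ⟩ := covariant_sequence_exact₁ _ (isSES_diskSum Y).shortExact
    (ζ.comp ξ (show 1 + 1 = 2 from rfl)) (by
      rw [comp_assoc (a₁₂ := 2) (a₂₃ := 1) _ _ _ rfl rfl rfl]
      exact comp_eq_zero_of_diskSum_right h𝒜 ζ _) (n₀ := 1) rfl
  obtain ⟨β, rfl⟩ := exists_lift_diskSum h𝒜 hK γ
  rw [← hγ]
  exact (isSES_diskSum Y).comp_cls_eq_zero_of_lift β

/-- The product of an extension by any complex and an extension of it by an acyclic complex `K`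
vanishes, for complexes `zeroDiff W` as first argument. -/
theorem comp_eq_zero_of_zeroDiff_of_acyclic (h𝒜 : IsHereditary 𝒜) {K M : PeriodicComplex 𝒜 t}
    (hK : K.Acyclic) {W : ZMod t → 𝒜} (ζ : Ext1 (zeroDiff W) M) (ξ : Ext1 M K) :
    ζ.comp ξ (show 1 + 1 = 2 from rfl) = 0 := by
  -- Unshifting `W` makes `zeroDiff W` the quotient of a contractible complex.
  obtain ⟨V, rfl⟩ : ∃ V : ZMod t → 𝒜, W = fun i => V (i + 1) :=
    ⟨fun i => W (i - 1), by simp⟩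
  obtain ⟨γ, hγ⟩ := contravariant_sequence_exact₃ (isSES_diskSum V).shortExact _
    (ζ.comp ξ (show 1 + 1 = 2 from rfl)) (by
      rw [← comp_assoc (a₁₂ := 1) (a₂₃ := 2) _ _ _ rfl rfl rfl]
      exact comp_eq_zero_of_diskSum_left h𝒜 _ ξ) (n₀ := 1) rfl
  obtain ⟨β, rfl⟩ := exists_extend_diskSum h𝒜 hK γ
  rw [← hγ]
  exact (isSES_diskSum V).cls_comp_eq_zero_of_extend β

/-- The differential of `L` takes values in the cycles, so it vanishes on the quotient by them. Thus
`L` is an extension of two complexes with zero differential. -/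
theorem isSES_cycles (L : PeriodicComplex 𝒜 t) :
    ∃ (Y : ZMod t → 𝒜) (q : L ⟶ zeroDiff Y), IsSES (fromCycles L) q := by
  refine ⟨fun i => cokernel (L.iCycles i), periodicHom (fun i => cokernel.π (L.iCycles i))
    fun i => ?_, IsSES.of_degreewise fun i => isSES_cokernel (L.iCycles i)⟩
  rw [zeroDiff_d, Limits.comp_zero, ← L.toCycles_i i (i + 1), Category.assoc, cokernel.condition,
    Limits.comp_zero]

/-- `Ext¹(K, -)` is right exact if `K` is acyclic. -/
theorem comp_eq_zero_of_acyclic (h𝒜 : IsHereditary 𝒜) {K M L : PeriodicComplex 𝒜 t}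
    (hK : K.Acyclic) (ζ : Ext1 K M) (ξ : Ext1 M L) :
    ζ.comp ξ (show 1 + 1 = 2 from rfl) = 0 := by
  obtain ⟨Y, q, hq⟩ := isSES_cycles L
  obtain ⟨X, y, a, hX, rfl⟩ := exists_isSES_cls ξ
  have := hX.mono
  have := hq.mono
  -- Dévissage along the cycles of `L`: `ζ` lifts first to the quotient of `X` by these cycles and
  -- then to `X`. Both kernels have zero differential, so the previous case applies twice.
  obtain ⟨b, a', h1, h2, h3⟩ := filtration_right hq hX (isSES_cokernel (fromCycles L ≫ y))
  obtain ⟨ζ₁, rfl⟩ := h3.lift_of_comp_eq_zero ζ (comp_eq_zero_of_acyclic_of_zeroDiff h𝒜 hK _ _)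
  obtain ⟨ζ₂, rfl⟩ := (isSES_cokernel (fromCycles L ≫ y)).lift_of_comp_eq_zero ζ₁
    (comp_eq_zero_of_acyclic_of_zeroDiff h𝒜 hK _ _)
  rw [comp_assoc_of_third_deg_zero, mk₀_comp_mk₀, h1]
  exact hX.comp_cls_eq_zero_of_lift ζ₂

end AcyclicExt

/-! ### Counting in exact sequences and additivity of the Euler form -/

section Counting

theorem card_eq_card_ker_mul_card_range {A B : Type*} [AddGroup A] [AddGroup B] (f : A →+ B) :
    Nat.card A = Nat.card f.ker * Nat.card f.range := by
  rw [← AddSubgroup.index_ker, AddSubgroup.card_mul_index]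

theorem card_of_exact {A₀ A₁ A₂ A₃ A₄ A₅ : Type*} [AddCommGroup A₀] [AddCommGroup A₁]
    [AddCommGroup A₂] [AddCommGroup A₃] [AddCommGroup A₄] [AddCommGroup A₅] {f₀ : A₀ →+ A₁}
    {f₁ : A₁ →+ A₂} {f₂ : A₂ →+ A₃} {f₃ : A₃ →+ A₄} {f₄ : A₄ →+ A₅}
    (h₀ : Function.Injective f₀) (h₁ : f₁.ker = f₀.range) (h₂ : f₂.ker = f₁.range)
    (h₃ : f₃.ker = f₂.range) (h₄ : f₄.ker = f₃.range) (h₅ : Function.Surjective f₄) :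
    Nat.card A₀ * Nat.card A₂ * Nat.card A₄ = Nat.card A₁ * Nat.card A₃ * Nat.card A₅ := by
  have e₀ : Nat.card A₀ = Nat.card f₀.range :=
    Nat.card_congr (AddMonoidHom.ofInjective h₀).toEquiv
  have e₅ : Nat.card A₅ = Nat.card f₄.range := by
    rw [AddMonoidHom.range_eq_top.2 h₅]
    exact (Nat.card_congr AddSubgroup.topEquiv.toEquiv).symm
  rw [e₀, e₅, card_eq_card_ker_mul_card_range f₁, card_eq_card_ker_mul_card_range f₂,
    card_eq_card_ker_mul_card_range f₃, card_eq_card_ker_mul_card_range f₄, h₁, h₂, h₃, h₄]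
  ring

variable {C : Type u} [Category.{v} C] [Abelian C]

attribute [local instance] HasExt.standard

open Abelian Abelian.Ext

theorem card_ext_zero (X Y : C) : Nat.card (Ext.{max u v} X Y 0) = Nat.card (X ⟶ Y) :=
  Nat.card_congr addEquiv₀.toEquiv

variable [FinitaryCategory C]

theorem card_hom_pos (X Y : C) : 0 < Nat.card (X ⟶ Y) := Nat.card_pos

theorem card_ext_pos (X Y : C) : 0 < Nat.card (Ext1 X Y) := Nat.card_pos

theorem eulerForm_pos (X Y : C) : 0 < eulerForm X Y :=
  div_pos (by exact_mod_cast card_hom_pos X Y) (by exact_mod_cast card_ext_pos X Y)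

theorem eulerForm_ne_zero (X Y : C) : eulerForm X Y ≠ 0 := (eulerForm_pos X Y).ne'

/-- The six-term sequence of `Hom` and `Ext¹` is exact, and cardinalities alternate. The
surjectivity hypothesis ends the sequence without an assumption on the whole of `Ext²`. -/
theorem IsSES.eulerForm_right {A B X : C} {f : B ⟶ X} {g : X ⟶ A} (h : IsSES f g) (K : C)
    (hs : ∀ ζ : Ext1 K A, ∃ β : Ext1 K X, β.comp (mk₀ g) (add_zero 1) = ζ) :
    eulerForm K X = eulerForm K A * eulerForm K B := by
  have key := card_of_exact (f₀ := (mk₀ f).postcomp K (add_zero 0))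
    (f₁ := (mk₀ g).postcomp K (add_zero 0)) (f₂ := h.cls.postcomp K (zero_add 1))
    (f₃ := (mk₀ f).postcomp K (add_zero 1)) (f₄ := (mk₀ g).postcomp K (add_zero 1))
    (by have := h.mono; exact postcomp_mk₀_injective_of_mono K f) ?_ ?_ ?_ ?_ hs
  · rw [card_ext_zero, card_ext_zero, card_ext_zero] at key
    have e : ∀ Y, (Nat.card (Ext1 K Y) : ℚ) ≠ 0 := fun Y => by exact_mod_cast (card_ext_pos K Y).ne'
    simp only [eulerForm]
    rw [div_mul_div_comm, div_eq_div_iff (e _) (mul_ne_zero (e _) (e _))]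
    norm_cast
    linear_combination -key
  · ext x
    constructor
    · exact covariant_sequence_exact₂ K h.shortExact x
    · rintro ⟨y, rfl⟩
      change (y.comp _ (add_zero 0)).comp _ (add_zero 0) = 0
      rw [comp_assoc_of_third_deg_zero, mk₀_comp_mk₀, h.w, mk₀_zero, Ext.comp_zero]
  · ext x
    constructor
    · exact covariant_sequence_exact₃ K h.shortExact x rfl
    · rintro ⟨y, rfl⟩
      change (y.comp _ (add_zero 0)).comp _ (zero_add 1) = 0
      rw [comp_assoc_of_second_deg_zero, h.mk₀_comp_cls, Ext.comp_zero]
  · ext x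
    constructor
    · exact fun hx => covariant_sequence_exact₁ K h.shortExact x hx rfl
    · rintro ⟨y, rfl⟩
      change (y.comp _ (zero_add 1)).comp _ (add_zero 1) = 0
      rw [comp_assoc_of_third_deg_zero, h.cls_comp_mk₀, Ext.comp_zero]
  · ext x
    constructor
    · exact covariant_sequence_exact₂ K h.shortExact x
    · rintro ⟨y, rfl⟩
      change (y.comp _ (add_zero 1)).comp _ (add_zero 1) = 0
      rw [comp_assoc_of_third_deg_zero, mk₀_comp_mk₀, h.w, mk₀_zero, Ext.comp_zero]

theorem IsSES.eulerForm_left {A B X : C} {f : B ⟶ X} {g : X ⟶ A} (h : IsSES f g) (L : C)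
    (hs : ∀ ζ : Ext1 B L, ∃ β : Ext1 X L, (mk₀ f).comp β (zero_add 1) = ζ) :
    eulerForm X L = eulerForm A L * eulerForm B L := by
  have key := card_of_exact (f₀ := (mk₀ g).precomp L (zero_add 0))
    (f₁ := (mk₀ f).precomp L (zero_add 0)) (f₂ := h.cls.precomp L (add_zero 1))
    (f₃ := (mk₀ g).precomp L (zero_add 1)) (f₄ := (mk₀ f).precomp L (zero_add 1))
    (by have := h.epi; exact precomp_mk₀_injective_of_epi L g) ?_ ?_ ?_ ?_ hs
  · rw [card_ext_zero, card_ext_zero, card_ext_zero] at key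
    have e : ∀ Y, (Nat.card (Ext1 Y L) : ℚ) ≠ 0 := fun Y => by exact_mod_cast (card_ext_pos Y L).ne'
    simp only [eulerForm]
    rw [div_mul_div_comm, div_eq_div_iff (e _) (mul_ne_zero (e _) (e _))]
    norm_cast
    linear_combination -key
  · ext x
    constructor
    · exact contravariant_sequence_exact₂ h.shortExact L x
    · rintro ⟨y, rfl⟩
      change (mk₀ f).comp ((mk₀ g).comp y (zero_add 0)) (zero_add 0) = 0
      rw [mk₀_comp_mk₀_assoc, h.w, mk₀_zero, Ext.zero_comp]
  · ext x
    constructor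
    · exact contravariant_sequence_exact₁ h.shortExact L x rfl
    · rintro ⟨y, rfl⟩
      change h.cls.comp ((mk₀ f).comp y (zero_add 0)) (add_zero 1) = 0
      rw [← comp_assoc_of_second_deg_zero, h.cls_comp_mk₀, Ext.zero_comp]
  · ext x
    constructor
    · exact fun hx => contravariant_sequence_exact₃ h.shortExact L x hx rfl
    · rintro ⟨y, rfl⟩
      change (mk₀ g).comp (h.cls.comp y (add_zero 1)) (zero_add 1) = 0
      rw [← comp_assoc (a₁₂ := 1) (a₂₃ := 1) _ _ _ rfl rfl rfl, h.mk₀_comp_cls, Ext.zero_comp]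
  · ext x
    constructor
    · exact contravariant_sequence_exact₂ h.shortExact L x
    · rintro ⟨y, rfl⟩
      change (mk₀ f).comp ((mk₀ g).comp y (zero_add 1)) (zero_add 1) = 0
      rw [mk₀_comp_mk₀_assoc, h.w, mk₀_zero, Ext.zero_comp]

end Counting

/-! ### Euler forms of acyclic complexes with complexes of zero differential -/

section AcyclicEuler
variable {𝒜 : Type u} [Category.{v} 𝒜] [Abelian 𝒜] {t : ℕ}

open HomologicalComplex

attribute [local instance] HasExt.standard

open Abelian Abelian.Ext

/-- Morphisms into a complex with zero differential. -/
noncomputable def homZeroDiffEquiv (K : PeriodicComplex 𝒜 t) (Y : ZMod t → 𝒜) :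
    (K ⟶ zeroDiff Y) ≃ ∀ i, (K.opcycles i ⟶ Y i) where
  toFun φ i := opcyclesMap φ i ≫ inv ((zeroDiff Y).pOpcycles i)
  invFun ψ := toOpcycles K ≫ zeroDiffMap ψ
  left_inv φ := by
    refine HomologicalComplex.hom_ext _ _ fun i => ?_
    change K.pOpcycles i ≫ opcyclesMap φ i ≫ inv ((zeroDiff Y).pOpcycles i) = φ.f i
    rw [p_opcyclesMap_assoc, IsIso.hom_inv_id, Category.comp_id]
  right_inv ψ := by
    funext i
    rw [← cancel_epi (K.pOpcycles i), p_opcyclesMap_assoc, IsIso.hom_inv_id, Category.comp_id]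
    rfl

/-- Morphisms from a complex with zero differential. -/
noncomputable def zeroDiffHomEquiv (K : PeriodicComplex 𝒜 t) (W : ZMod t → 𝒜) :
    (zeroDiff W ⟶ K) ≃ ∀ i, (W i ⟶ K.cycles i) where
  toFun φ i := inv ((zeroDiff W).iCycles i) ≫ cyclesMap φ i
  invFun ψ := zeroDiffMap ψ ≫ fromCycles K
  left_inv φ := by
    refine HomologicalComplex.hom_ext _ _ fun i => ?_
    change (inv ((zeroDiff W).iCycles i) ≫ cyclesMap φ i) ≫ K.iCycles i = φ.f i
    rw [Category.assoc, cyclesMap_i, IsIso.inv_hom_id_assoc]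
  right_inv ψ := by
    funext i
    rw [← cancel_mono (K.iCycles i), Category.assoc, cyclesMap_i, IsIso.inv_hom_id_assoc]
    rfl

/-- Degreewise equivalences of extensions assemble to a morphism of complexes, since there is no
differential to respect. -/
theorem zeroDiff_cls_congr {A B X X' : ZMod t → 𝒜} {f : ∀ i, B i ⟶ X i} {g : ∀ i, X i ⟶ A i}
    {f' : ∀ i, B i ⟶ X' i} {g' : ∀ i, X' i ⟶ A i} (h : ∀ i, IsSES (f i) (g i))
    (h' : ∀ i, IsSES (f' i) (g' i)) (e : ∀ i, (h i).cls = (h' i).cls) :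
    (isSES_zeroDiffMap h).cls = (isSES_zeroDiffMap h').cls := by
  choose φ h1 h2 using fun i => (h i).exists_iso_of_cls_eq (h' i) (e i)
  exact IsSES.cls_eq_of_comm _ _ (zeroDiffMap fun i => (φ i).hom)
    (HomologicalComplex.hom_ext _ _ h1) (HomologicalComplex.hom_ext _ _ h2)

/-- Passing to opcycles recovers the degreewise extensions from which the class was built. This is
the injectivity needed to count extensions. -/
theorem IsSES.cls_opcycles_eq {K E : PeriodicComplex 𝒜 t} (hK : K.Acyclic) {Y G : ZMod t → 𝒜}
    {f : zeroDiff Y ⟶ E} {g : E ⟶ K} (h : IsSES f g) {p : ∀ i, Y i ⟶ G i}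
    {q : ∀ i, G i ⟶ K.opcycles i} (s : ∀ i, IsSES (p i) (q i))
    (e : h.cls = (mk₀ (toOpcycles K)).comp (isSES_zeroDiffMap s).cls (zero_add 1)) (i : ZMod t) :
    (h.opcycles_zeroDiff hK i).cls = (s i).cls := by
  obtain ⟨φ, h1, h2⟩ := h.exists_hom (isSES_zeroDiffMap s) (𝟙 _) (toOpcycles K)
    (by rw [e, comp_mk₀_id])
  have h1' : f.f i ≫ φ.f i = p i := by
    rw [← comp_f, h1, Category.id_comp]
  have h2' : φ.f i ≫ q i = g.f i ≫ K.pOpcycles i := congrArg (fun k => k.f i) h2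
  refine IsSES.cls_eq_of_comm _ _ (homZeroDiffEquiv E G φ i) ?_ ?_
  · change ((zeroDiff Y).pOpcycles i ≫ opcyclesMap f i) ≫ opcyclesMap φ i ≫
      inv ((zeroDiff G).pOpcycles i) = p i
    rw [p_opcyclesMap, Category.assoc, p_opcyclesMap_assoc, IsIso.hom_inv_id, Category.comp_id,
      h1']
  · change (opcyclesMap φ i ≫ inv ((zeroDiff G).pOpcycles i)) ≫ q i = opcyclesMap g i
    rw [← cancel_epi (E.pOpcycles i), Category.assoc, p_opcyclesMap_assoc,
      IsIso.hom_inv_id_assoc, h2', p_opcyclesMap]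

theorem IsSES.cls_cycles_eq {K E : PeriodicComplex 𝒜 t} (hK : K.Acyclic) {Y G : ZMod t → 𝒜}
    {f : K ⟶ E} {g : E ⟶ zeroDiff Y} (h : IsSES f g) {p : ∀ i, K.cycles i ⟶ G i}
    {q : ∀ i, G i ⟶ Y i} (s : ∀ i, IsSES (p i) (q i))
    (e : h.cls = (isSES_zeroDiffMap s).cls.comp (mk₀ (fromCycles K)) (add_zero 1)) (i : ZMod t) :
    (h.cycles_zeroDiff hK i).cls = (s i).cls := by
  obtain ⟨φ, h1, h2⟩ := (isSES_zeroDiffMap s).exists_hom h (fromCycles K) (𝟙 _)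
    (by rw [e, mk₀_id_comp])
  have h1' : p i ≫ φ.f i = K.iCycles i ≫ f.f i := congrArg (fun k => k.f i) h1
  have h2' : φ.f i ≫ g.f i = q i := by
    rw [← comp_f, h2, Category.comp_id]
  refine (IsSES.cls_eq_of_comm _ _ (zeroDiffHomEquiv E G φ i) ?_ ?_).symm
  · change p i ≫ inv ((zeroDiff G).iCycles i) ≫ cyclesMap φ i = cyclesMap f i
    rw [← cancel_mono (E.iCycles i), Category.assoc, Category.assoc, cyclesMap_i,
      IsIso.inv_hom_id_assoc, h1', cyclesMap_i]
  · change (inv ((zeroDiff G).iCycles i) ≫ cyclesMap φ i) ≫ cyclesMap g i ≫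
      (zeroDiff Y).iCycles i = q i
    rw [cyclesMap_i, Category.assoc, cyclesMap_i_assoc, IsIso.inv_hom_id_assoc, h2']

/-- Opcycles are left adjoint to `zeroDiff` and are exact on extensions with acyclic quotient, so
the adjunction carries over to `Ext¹`. -/
theorem card_ext_zeroDiff {K : PeriodicComplex 𝒜 t} (hK : K.Acyclic) (Y : ZMod t → 𝒜) :
    Nat.card (Ext1 K (zeroDiff Y)) = Nat.card (∀ i, Ext1 (K.opcycles i) (Y i)) := by
  choose G p q s hs using fun (i : ZMod t) (η : Ext1 (K.opcycles i) (Y i)) => exists_isSES_cls η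
  refine (Nat.card_congr (Equiv.ofBijective (fun η : ∀ i, Ext1 (K.opcycles i) (Y i) =>
    (mk₀ (toOpcycles K)).comp (isSES_zeroDiffMap fun i => s i (η i)).cls (zero_add 1))
    ⟨fun η η' e => funext fun i => ?_, fun γ => ?_⟩)).symm
  · obtain ⟨E, f, g, h, hE⟩ := exists_isSES_cls
      ((mk₀ (toOpcycles K)).comp (isSES_zeroDiffMap fun i => s i (η i)).cls (zero_add 1))
    rw [← hs i (η i), ← hs i (η' i), ← h.cls_opcycles_eq hK (fun i => s i (η i)) hE,
      ← h.cls_opcycles_eq hK (fun i => s i (η' i)) (hE.trans e)]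
  · obtain ⟨G', f, g, h, rfl⟩ := exists_cls_eq_toOpcycles_comp hK γ
    exact ⟨fun i => (h i).cls, congrArg (fun x => (mk₀ (toOpcycles K)).comp x (zero_add 1))
      (zeroDiff_cls_congr _ h fun i => hs i _)⟩

theorem card_zeroDiff_ext {K : PeriodicComplex 𝒜 t} (hK : K.Acyclic) (W : ZMod t → 𝒜) :
    Nat.card (Ext1 (zeroDiff W) K) = Nat.card (∀ i, Ext1 (W i) (K.cycles i)) := by
  choose G p q s hs using fun (i : ZMod t) (η : Ext1 (W i) (K.cycles i)) => exists_isSES_cls η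
  refine (Nat.card_congr (Equiv.ofBijective (fun η : ∀ i, Ext1 (W i) (K.cycles i) =>
    (isSES_zeroDiffMap fun i => s i (η i)).cls.comp (mk₀ (fromCycles K)) (add_zero 1))
    ⟨fun η η' e => funext fun i => ?_, fun γ => ?_⟩)).symm
  · obtain ⟨E, f, g, h, hE⟩ := exists_isSES_cls
      ((isSES_zeroDiffMap fun i => s i (η i)).cls.comp (mk₀ (fromCycles K)) (add_zero 1))
    rw [← hs i (η i), ← hs i (η' i), ← h.cls_cycles_eq hK (fun i => s i (η i)) hE,
      ← h.cls_cycles_eq hK (fun i => s i (η' i)) (hE.trans e)]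
  · obtain ⟨G', f, g, h, rfl⟩ := exists_cls_eq_comp_fromCycles hK γ
    exact ⟨fun i => (h i).cls, congrArg (fun x : Ext1 _ _ => x.comp (mk₀ (fromCycles K))
      (add_zero 1)) (zeroDiff_cls_congr _ h fun i => hs i _)⟩

variable [NeZero t]

theorem eulerForm_zeroDiff_right {K : PeriodicComplex 𝒜 t} (hK : K.Acyclic) (Y : ZMod t → 𝒜) :
    eulerForm K (zeroDiff Y) = ∏ i, eulerForm (K.opcycles i) (Y i) := by
  rw [eulerForm, card_ext_zeroDiff hK, Nat.card_congr (homZeroDiffEquiv K Y), Nat.card_pi,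
    Nat.card_pi]
  simp only [eulerForm, Finset.prod_div_distrib, Nat.cast_prod]

theorem eulerForm_zeroDiff_left {K : PeriodicComplex 𝒜 t} (hK : K.Acyclic) (W : ZMod t → 𝒜) :
    eulerForm (zeroDiff W) K = ∏ i, eulerForm (W i) (K.cycles i) := by
  rw [eulerForm, card_zeroDiff_ext hK, Nat.card_congr (zeroDiffHomEquiv K W), Nat.card_pi,
    Nat.card_pi]
  simp only [eulerForm, Finset.prod_div_distrib, Nat.cast_prod]

end AcyclicEuler

/-- All fibres of a surjective homomorphism have the size of its kernel. This converts sums over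
extensions of one object into sums over extensions of another. -/
theorem sum_comp_of_surjective {A B V : Type*} [AddGroup A] [AddGroup B] [Fintype A] [Fintype B]
    [AddCommGroup V] [Module ℚ V] (f : A →+ B) (hf : Function.Surjective f) (F : B → V) :
    ∑ a, F (f a) = ((Nat.card A : ℚ) / Nat.card B) • ∑ b, F b := by
  classical
  have hk : ∀ b, (Finset.univ.filter fun a => f a = b).card = Nat.card f.ker := by
    intro b
    rw [AddMonoidHom.card_fiber_eq_of_mem_range f (hf b) (hf 0), Nat.card_eq_fintype_card,
      Fintype.card_subtype]
    simp only [AddMonoidHom.mem_ker]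
  have hc : (Nat.card A : ℚ) / Nat.card B = Nat.card f.ker := by
    have h0 : (Nat.card B : ℚ) ≠ 0 := by exact_mod_cast Nat.card_pos.ne'
    rw [div_eq_iff h0, card_eq_card_ker_mul_card_range f, AddMonoidHom.range_eq_top.2 hf,
      Nat.card_congr AddSubgroup.topEquiv.toEquiv]
    push_cast
    rfl
  rw [hc, ← Finset.sum_fiberwise (s := Finset.univ) (g := f), Finset.smul_sum]
  refine Finset.sum_congr rfl fun b _ => ?_
  rw [Finset.sum_congr rfl (g := fun _ => F b) fun a ha => by rw [(Finset.mem_filter.1 ha).2],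
    Finset.sum_const, hk, Nat.cast_smul_eq_nsmul]

/-! ### The Hall product as a sum over extensions, and change of a factor -/

section Multiplication
variable {C : Type u} [Category.{v} C] [Abelian C]

attribute [local instance] HasExt.standard

open Abelian Abelian.Ext

/-- The middle term of an extension. -/
noncomputable def extMid {A B : C} (ξ : Ext1 A B) : C := (exists_isSES_cls ξ).choose

theorem exists_isSES_extMid {A B : C} (ξ : Ext1 A B) :
    ∃ (f : B ⟶ extMid ξ) (g : extMid ξ ⟶ A) (h : IsSES f g), h.cls = ξ :=
  (exists_isSES_cls ξ).choose_spec

theorem HallAlgebra.of_eq_of_iso {X Y : C} (e : X ≅ Y) :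
    (HallAlgebra.of X : HallAlgebra C) = HallAlgebra.of Y := by
  have : isoClass X = isoClass Y := Quotient.sound ⟨e⟩
  rw [HallAlgebra.of, HallAlgebra.of, this]

theorem IsSES.of_eq_of_extMid {A B X : C} {f : B ⟶ X} {g : X ⟶ A} (h : IsSES f g) {ξ : Ext1 A B}
    (e : h.cls = ξ) : (HallAlgebra.of X : HallAlgebra C) = HallAlgebra.of (extMid ξ) := by
  obtain ⟨f', g', h', hξ⟩ := exists_isSES_extMid ξ
  obtain ⟨φ, -⟩ := h.exists_iso_of_cls_eq h' (e.trans hξ.symm)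
  exact HallAlgebra.of_eq_of_iso φ

theorem mem_extMiddle_out_iff {A B : C} (ξ : Ext1 A B) (x : IsoClass C) :
    ξ ∈ extMiddle A B x.out ↔ isoClass (extMid ξ) = x := by
  obtain ⟨f', g', h', hξ⟩ := exists_isSES_extMid ξ
  constructor
  · rintro ⟨f, g, h, e⟩
    obtain ⟨φ, -⟩ := h'.exists_iso_of_cls_eq h (hξ.trans e.symm)
    rw [← Quotient.out_eq x]
    exact Quotient.sound ⟨φ⟩
  · rintro rfl
    let φ := (outIso (extMid ξ)).symm
    exact ⟨_, _, h'.comp_iso φ, (h'.cls_eq_of_comm (h'.comp_iso φ) φ.hom rfl (by simp)).symm.trans hξ⟩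

variable [FinitaryCategory C]

/-- The product in the Hall algebra as a sum over all extensions. -/
theorem HallAlgebra.of_mul_of_eq_sum (A B : C) [Fintype (Ext1 A B)] :
    (HallAlgebra.of A * HallAlgebra.of B : HallAlgebra C) =
      (Nat.card (A ⟶ B) : ℚ)⁻¹ • ∑ ξ : Ext1 A B, HallAlgebra.of (extMid ξ) := by
  classical
  rw [HallAlgebra.of_mul_of]
  change _ = (Nat.card (A ⟶ B) : ℚ)⁻¹ • ∑ ξ : Ext1 A B,
    (Finsupp.single (isoClass (extMid ξ)) 1 : IsoClass C →₀ ℚ)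
  ext x
  rw [Finsupp.smul_apply, Finsupp.finsetSum_apply]
  simp only [Finsupp.single_apply, Finset.sum_boole, smul_eq_mul]
  change hallNumber A B x.out = _
  rw [hallNumber, div_eq_inv_mul]
  congr 2
  rw [← Fintype.card_subtype, ← Nat.card_eq_fintype_card]
  exact Nat.card_congr (Equiv.subtypeEquivRight fun ξ => mem_extMiddle_out_iff ξ x)

variable {V : Type*} [AddCommGroup V] [Module ℚ V] (Φ : HallAlgebra C →ₗ[ℚ] V) (S : V →ₗ[ℚ] V)

/-- Comparison of the products of `N` and of a subobject `M` of `N` with `L`. -/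
theorem IsSES.map_mul_of_left {M N K : C} {i : M ⟶ N} {p : N ⟶ K} (h : IsSES i p) (L : C)
    (hs : ∀ ξ : Ext1 M L, ∃ β : Ext1 N L, (mk₀ i).comp β (zero_add 1) = ξ)
    (hΦ : ∀ {B X : C} {f : B ⟶ X} {g : X ⟶ K}, IsSES f g →
      Φ (HallAlgebra.of X) = S (Φ (HallAlgebra.of B))) :
    Φ (HallAlgebra.of N * HallAlgebra.of L) =
      (eulerForm K L)⁻¹ • S (Φ (HallAlgebra.of M * HallAlgebra.of L)) := by
  have := Fintype.ofFinite (Ext1 M L)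
  have := Fintype.ofFinite (Ext1 N L)
  -- If `X` is the middle term of `ξ`, the kernel of `X ⟶ N ⟶ K` is the middle term of the
  -- restriction of `ξ` to `M`, and its quotient in `X` is `K`.
  have key : ∀ ξ : Ext1 N L, Φ (HallAlgebra.of (extMid ξ)) =
      S (Φ (HallAlgebra.of (extMid ((mk₀ i).precomp L (zero_add 1) ξ)))) := by
    intro ξ
    obtain ⟨f, g, hX, hξ⟩ := exists_isSES_extMid ξ
    have := h.epi
    have := hX.epi
    have hk := isSES_kernel (g ≫ p)
    obtain ⟨c, r, h1, h2, h3⟩ := filtration_left h hX hk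
    have := h3.cls_naturality hX (𝟙 _) (kernel.ι (g ≫ p)) i (by rw [h1, Category.id_comp]) h2.symm
    rw [comp_mk₀_id, hξ] at this
    rw [hΦ hk, h3.of_eq_of_extMid this]
    rfl
  -- The resulting scalar is `|Hom(M, L)| |Ext¹(N, L)| / (|Hom(N, L)| |Ext¹(M, L)|)`, which is `⟨K,
  -- L⟩⁻¹` by additivity.
  have e := h.eulerForm_left L hs
  rw [HallAlgebra.of_mul_of_eq_sum, HallAlgebra.of_mul_of_eq_sum, map_smul, map_sum,
    Finset.sum_congr rfl fun ξ _ => key ξ,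
    sum_comp_of_surjective ((mk₀ i).precomp L (zero_add 1)) hs
      fun ξ => S (Φ (HallAlgebra.of (extMid ξ))),
    map_smul, map_smul, map_sum, map_sum, smul_smul, smul_smul]
  congr 1
  have h1 : (Nat.card (Ext1 M L) : ℚ) ≠ 0 := by exact_mod_cast (card_ext_pos M L).ne'
  have h2 : (Nat.card (Ext1 N L) : ℚ) ≠ 0 := by exact_mod_cast (card_ext_pos N L).ne'
  have h3 : (Nat.card (M ⟶ L) : ℚ) ≠ 0 := by exact_mod_cast (card_hom_pos M L).ne'
  have h4 : (Nat.card (N ⟶ L) : ℚ) ≠ 0 := by exact_mod_cast (card_hom_pos N L).ne'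
  have h5 := eulerForm_ne_zero K L
  rw [eulerForm.eq_1 N L, eulerForm.eq_1 M L] at e
  field_simp at e ⊢
  linear_combination -e

/-- Comparison of the products of `L` with `N` and with a quotient `M` of `N`. -/
theorem IsSES.map_mul_of_right {M N K : C} {i : K ⟶ N} {p : N ⟶ M} (h : IsSES i p) (L : C)
    (hs : ∀ ξ : Ext1 L M, ∃ β : Ext1 L N, β.comp (mk₀ p) (add_zero 1) = ξ)
    (hΦ : ∀ {A X : C} {f : K ⟶ X} {g : X ⟶ A}, IsSES f g →
      Φ (HallAlgebra.of X) = S (Φ (HallAlgebra.of A))) :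
    Φ (HallAlgebra.of L * HallAlgebra.of N) =
      (eulerForm L K)⁻¹ • S (Φ (HallAlgebra.of L * HallAlgebra.of M)) := by
  have := Fintype.ofFinite (Ext1 L M)
  have := Fintype.ofFinite (Ext1 L N)
  -- Dually, the quotient by `K` of the middle term of `ξ` is the middle term of the pushout of `ξ`
  -- along `N ⟶ M`.
  have key : ∀ ξ : Ext1 L N, Φ (HallAlgebra.of (extMid ξ)) =
      S (Φ (HallAlgebra.of (extMid ((mk₀ p).postcomp L (add_zero 1) ξ)))) := by
    intro ξ
    obtain ⟨f, g, hX, hξ⟩ := exists_isSES_extMid ξ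
    have := h.mono
    have := hX.mono
    have hk := isSES_cokernel (i ≫ f)
    obtain ⟨b, a, h1, h2, h3⟩ := filtration_right h hX hk
    have := hX.cls_naturality h3 p (cokernel.π (i ≫ f)) (𝟙 _) h2.symm
      (by rw [h1, Category.comp_id])
    rw [mk₀_id_comp, hξ] at this
    rw [hΦ hk, h3.of_eq_of_extMid this.symm]
    rfl
  have e := h.eulerForm_right L hs
  rw [HallAlgebra.of_mul_of_eq_sum, HallAlgebra.of_mul_of_eq_sum, map_smul, map_sum,
    Finset.sum_congr rfl fun ξ _ => key ξ,
    sum_comp_of_surjective ((mk₀ p).postcomp L (add_zero 1)) hs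
      fun ξ => S (Φ (HallAlgebra.of (extMid ξ))),
    map_smul, map_smul, map_sum, map_sum, smul_smul, smul_smul]
  congr 1
  have h1 : (Nat.card (Ext1 L M) : ℚ) ≠ 0 := by exact_mod_cast (card_ext_pos L M).ne'
  have h2 : (Nat.card (Ext1 L N) : ℚ) ≠ 0 := by exact_mod_cast (card_ext_pos L N).ne'
  have h3 : (Nat.card (L ⟶ M) : ℚ) ≠ 0 := by exact_mod_cast (card_hom_pos L M).ne'
  have h4 : (Nat.card (L ⟶ N) : ℚ) ≠ 0 := by exact_mod_cast (card_hom_pos L N).ne'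
  have h5 := eulerForm_ne_zero L K
  rw [eulerForm.eq_1 L N, eulerForm.eq_1 L M] at e
  field_simp at e ⊢
  linear_combination -e

end Multiplication

/-! ### The Grothendieck group and the Euler form on it -/

section Grothendieck
variable {C : Type u} [Category.{v} C] [Abelian C]

theorem IsSES.K₀_of {A B X : C} {f : B ⟶ X} {g : X ⟶ A} (h : IsSES f g) :
    K₀.of X = K₀.of A + K₀.of B := by
  have : (QuotientAddGroup.mk (FreeAbelianGroup.of X - FreeAbelianGroup.of A -
      FreeAbelianGroup.of B) : K₀ C) = 0 :=
    (QuotientAddGroup.eq_zero_iff _).2 (AddSubgroup.subset_closure ⟨A, B, X, f, g, h, rfl⟩)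
  change K₀.of X - K₀.of A - K₀.of B = 0 at this
  rw [sub_sub, sub_eq_zero] at this
  exact this

theorem isSES_of_iso {X Y : C} (e : X ≅ Y) : IsSES (0 : (0 : C) ⟶ X) e.hom := by
  have : Mono (0 : (0 : C) ⟶ X) := ⟨fun _ _ _ => (isZero_zero C).eq_of_tgt _ _⟩
  exact IsSES.of_mono_epi' (by simp) fun k _ => ⟨e.inv ≫ k, by simp⟩

theorem K₀.of_zero : K₀.of (0 : C) = 0 := by
  have := (isSES_of_iso (Iso.refl (0 : C))).K₀_of
  simpa using this

theorem K₀.of_eq_of_iso {X Y : C} (e : X ≅ Y) : K₀.of X = K₀.of Y := by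
  rw [(isSES_of_iso e).K₀_of, K₀.of_zero, add_zero]

/-- The class in `K₀` of an isomorphism class. -/
def K₀.ofIsoClass : IsoClass C → K₀ C :=
  Quotient.lift K₀.of fun _ _ ⟨e⟩ => K₀.of_eq_of_iso e

theorem K₀.ofIsoClass_mk (X : C) : K₀.ofIsoClass (isoClass X) = K₀.of X := rfl

theorem K₀.hom_ext {A : Type*} [AddCommGroup A] {φ ψ : K₀ C →+ A}
    (h : ∀ X, φ (K₀.of X) = ψ (K₀.of X)) : φ = ψ := by
  have : φ.comp (QuotientAddGroup.mk' _) = ψ.comp (QuotientAddGroup.mk' _) :=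
    FreeAbelianGroup.lift_ext _ _ fun X => h X
  ext x
  obtain ⟨x, rfl⟩ := QuotientAddGroup.mk_surjective x
  exact DFunLike.congr_fun this x

/-- The universal property of the Grothendieck group. -/
def K₀.lift {A : Type*} [AddCommGroup A] (φ : C → A)
    (h : ∀ {X Y Z : C} {f : Y ⟶ X} {g : X ⟶ Z}, IsSES f g → φ X = φ Z + φ Y) : K₀ C →+ A :=
  QuotientAddGroup.lift _ (FreeAbelianGroup.lift φ) (by
    rw [AddSubgroup.closure_le]
    rintro _ ⟨Z, Y, X, f, g, hs, rfl⟩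
    simp [h hs])

theorem K₀.lift_of {A : Type*} [AddCommGroup A] (φ : C → A)
    (h : ∀ {X Y Z : C} {f : Y ⟶ X} {g : X ⟶ Z}, IsSES f g → φ X = φ Z + φ Y) (X : C) :
    K₀.lift φ h (K₀.of X) = φ X := FreeAbelianGroup.lift_apply_of φ X

theorem K₀.exists_eq_sub (α : K₀ C) : ∃ X Y : C, α = K₀.of X - K₀.of Y := by
  obtain ⟨x, rfl⟩ := QuotientAddGroup.mk_surjective α
  change ∃ X Y : C, QuotientAddGroup.mk' _ x = _
  induction x using FreeAbelianGroup.induction_on with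
  | zero => exact ⟨0, 0, by rw [sub_self]; exact map_zero _⟩
  | of X => exact ⟨X, 0, by rw [K₀.of_zero, sub_zero]; rfl⟩
  | neg X _ => exact ⟨0, X, by rw [K₀.of_zero, zero_sub, map_neg]; rfl⟩
  | add x y hx hy =>
    obtain ⟨X, Y, h⟩ := hx
    obtain ⟨X', Y', h'⟩ := hy
    refine ⟨X ⊞ X', Y ⊞ Y', ?_⟩
    rw [map_add, h, h', (isSES_biprod_inl_snd X' X).K₀_of, (isSES_biprod_inl_snd Y' Y).K₀_of]
    abel

variable [FinitaryCategory C] (hC : IsHereditary C)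

/-- The Euler form as a unit. -/
noncomputable def eulerUnit (X Y : C) : Additive ℚˣ :=
  Additive.ofMul (Units.mk0 (eulerForm X Y) (eulerForm_ne_zero X Y))

attribute [local instance] HasExt.standard

theorem IsSES.eulerUnit_right (hC : IsHereditary C) {X Y Z : C} {f : Y ⟶ X} {g : X ⟶ Z} (h : IsSES f g) (K : C) :
    eulerUnit K X = eulerUnit K Z + eulerUnit K Y := by
  have := h.epi
  exact congrArg Additive.ofMul (Units.ext (h.eulerForm_right K (exists_lift_of_epi hC _)))

theorem IsSES.eulerUnit_left (hC : IsHereditary C) {X Y Z : C} {f : Y ⟶ X} {g : X ⟶ Z} (h : IsSES f g) (L : C) :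
    eulerUnit X L = eulerUnit Z L + eulerUnit Y L := by
  have := h.mono
  exact congrArg Additive.ofMul (Units.ext (h.eulerForm_left L (exists_extend_of_mono hC _)))

/-- The Euler form on the Grothendieck group. -/
noncomputable def eulerHom : K₀ C →+ K₀ C →+ Additive ℚˣ :=
  K₀.lift (fun X => K₀.lift (eulerUnit X) fun hs => hs.eulerUnit_right hC X)
    fun hs => K₀.hom_ext fun W => by
      rw [AddMonoidHom.add_apply, K₀.lift_of, K₀.lift_of, K₀.lift_of, hs.eulerUnit_left hC W]

/-- The rational value of the Euler form on the Grothendieck group. -/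
noncomputable def euler (α β : K₀ C) : ℚ := ((eulerHom hC α β).toMul : ℚˣ)

theorem euler_of (X Y : C) : euler hC (K₀.of X) (K₀.of Y) = eulerForm X Y := by
  have h : eulerHom hC (K₀.of X) = K₀.lift (eulerUnit X) fun hs => hs.eulerUnit_right hC X :=
    FreeAbelianGroup.lift_apply_of _ X
  rw [euler, h, K₀.lift_of]
  rfl

theorem euler_ne_zero (α β : K₀ C) : euler hC α β ≠ 0 := Units.ne_zero _

theorem euler_add_left (α α' β : K₀ C) :
    euler hC (α + α') β = euler hC α β * euler hC α' β := by
  simp [euler]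

theorem euler_add_right (α β β' : K₀ C) :
    euler hC α (β + β') = euler hC α β * euler hC α β' := by
  simp [euler]

theorem euler_zero_left (β : K₀ C) : euler hC 0 β = 1 := by simp [euler]

end Grothendieck

/-! ### The invariants of a complex: images and homology -/

section Invariants
variable {𝒜 : Type u} [Category.{v} 𝒜] [Abelian 𝒜] {t : ℕ}

open HomologicalComplex

/-- The classes of the images of the differentials. -/
noncomputable def imCls (M : PeriodicComplex 𝒜 t) (i : ZMod t) : K₀ 𝒜 :=
  K₀.of (image (M.d i (i + 1)))

/-- The isomorphism classes of the homology objects. -/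
noncomputable def homCls (M : PeriodicComplex 𝒜 t) (i : ZMod t) : IsoClass 𝒜 :=
  isoClass (M.homology i)

theorem sameClass_iff {M N : PeriodicComplex 𝒜 t} :
    SameClass M N ↔ imCls M = imCls N ∧ homCls M = homCls N := by
  refine ⟨fun h => ⟨funext fun i => (h i).2, funext fun i => Quotient.sound (h i).1⟩,
    fun h i => ⟨Quotient.exact (congrFun h.2 i), congrFun h.1 i⟩⟩

theorem imCls_eq_of_factor (M : PeriodicComplex 𝒜 t) (i : ZMod t) {I : 𝒜} (e : M.X i ⟶ I)
    (m : I ⟶ M.X (i + 1)) [Epi e] [Mono m] (h : e ≫ m = M.d i (i + 1)) :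
    imCls M i = K₀.of I :=
  haveI := strongEpi_of_epi e
  (K₀.of_eq_of_iso (image.isoStrongEpiMono e m h)).symm

theorem isSES_cycles_image (M : PeriodicComplex 𝒜 t) (i : ZMod t) :
    IsSES (M.iCycles i) (factorThruImage (M.d i (i + 1))) := by
  refine IsSES.of_mono_epi ?_ fun k hk => ⟨M.liftCycles k (i + 1) (next_eq i) ?_, M.liftCycles_i k _ _ _⟩
  · rw [← cancel_mono (image.ι _)]
    simp
  · rw [← image.fac (M.d i (i + 1)), reassoc_of% hk, zero_comp]

theorem K₀_of_X (M : PeriodicComplex 𝒜 t) (i : ZMod t) :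
    K₀.of (M.X i) = imCls M i + K₀.of (M.cycles i) :=
  (isSES_cycles_image M i).K₀_of

/-- The inclusion of the boundaries in the cycles. -/
noncomputable def imageToCycles' (M : PeriodicComplex 𝒜 t) (i : ZMod t) :
    image (M.d i (i + 1)) ⟶ M.cycles (i + 1) :=
  M.liftCycles (image.ι (M.d i (i + 1))) (i + 1 + 1) (next_eq _) (by
    rw [← cancel_epi (factorThruImage (M.d i (i + 1)))]
    simp)

theorem imageToCycles'_i (M : PeriodicComplex 𝒜 t) (i : ZMod t) :
    imageToCycles' M i ≫ M.iCycles (i + 1) = image.ι (M.d i (i + 1)) := by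
  simp [imageToCycles']

theorem factorThruImage_imageToCycles' (M : PeriodicComplex 𝒜 t) (i : ZMod t) :
    factorThruImage (M.d i (i + 1)) ≫ imageToCycles' M i = M.toCycles i (i + 1) := by
  rw [← cancel_mono (M.iCycles (i + 1)), Category.assoc, imageToCycles'_i]
  simp

theorem isSES_image_cycles (M : PeriodicComplex 𝒜 t) (i : ZMod t) :
    IsSES (imageToCycles' M i) (M.homologyπ (i + 1)) := by
  have : Mono (imageToCycles' M i) := by
    have : Mono (imageToCycles' M i ≫ M.iCycles (i + 1)) := by
      rw [imageToCycles'_i]; infer_instance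
    exact mono_of_mono _ (M.iCycles (i + 1))
  refine IsSES.of_mono_epi' ?_ fun {Z} k hk => ?_
  · rw [← cancel_epi (factorThruImage (M.d i (i + 1))), ← Category.assoc,
      factorThruImage_imageToCycles', toCycles_comp_homologyπ, comp_zero]
  · have h0 : M.toCycles i (i + 1) ≫ k = 0 := by
      rw [← factorThruImage_imageToCycles', Category.assoc, hk, comp_zero]
    exact ⟨(M.homologyIsCokernel i (i + 1) (prev_eq i)).desc (CokernelCofork.ofπ k h0),
      (M.homologyIsCokernel i (i + 1) (prev_eq i)).fac (CokernelCofork.ofπ k h0)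
        WalkingParallelPair.one⟩

theorem isSES_homology_opcycles (M : PeriodicComplex 𝒜 t) (i : ZMod t) :
    ∃ q : M.opcycles i ⟶ image (M.d i (i + 1)), IsSES (M.homologyι i) q ∧
      q ≫ image.ι _ = M.fromOpcycles i (i + 1) := by
  obtain ⟨q, hq⟩ : ∃ q : M.opcycles i ⟶ image (M.d i (i + 1)),
      M.pOpcycles i ≫ q = factorThruImage _ := by
    obtain ⟨j, rfl⟩ := exists_eq_succ i
    refine ⟨M.descOpcycles (factorThruImage _) j (prev_eq j) ?_, M.p_descOpcycles _ _ _ _⟩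
    rw [← cancel_mono (image.ι _)]
    simp
  have hq' : q ≫ image.ι _ = M.fromOpcycles i (i + 1) := by
    rw [← cancel_epi (M.pOpcycles i), reassoc_of% hq]
    simp
  have : Epi q := by
    have : Epi (M.pOpcycles i ≫ q) := by rw [hq]; infer_instance
    exact epi_of_epi (M.pOpcycles i) q
  refine ⟨q, IsSES.of_mono_epi ?_ fun {Z} k hk => ?_, hq'⟩
  · rw [← cancel_mono (image.ι _), Category.assoc, hq', homologyι_comp_fromOpcycles, zero_comp]
  · have h0 : k ≫ M.fromOpcycles i (i + 1) = 0 := by rw [← hq', reassoc_of% hk, zero_comp]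
    exact ⟨(M.homologyIsKernel i (i + 1) (next_eq i)).lift (KernelFork.ofι k h0),
      (M.homologyIsKernel i (i + 1) (next_eq i)).fac (KernelFork.ofι k h0)
        WalkingParallelPair.zero⟩

theorem K₀_of_cycles (M : PeriodicComplex 𝒜 t) (i : ZMod t) :
    K₀.of (M.cycles (i + 1)) = K₀.ofIsoClass (homCls M (i + 1)) + imCls M i :=
  (isSES_image_cycles M i).K₀_of

/-- In `K₀` an object of a complex is the sum of its homology and of the images of the outgoing and
the incoming differential. -/
theorem K₀_of_X_eq_of_class {M M' : PeriodicComplex 𝒜 t} (h : imCls M = imCls M')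
    (h' : homCls M = homCls M') (i : ZMod t) : K₀.of (M.X i) = K₀.of (M'.X i) := by
  obtain ⟨j, rfl⟩ := exists_eq_succ i
  rw [K₀_of_X, K₀_of_X, K₀_of_cycles, K₀_of_cycles, h, h']

theorem homCls_eq_of_acyclic {K : PeriodicComplex 𝒜 t} (hK : K.Acyclic) :
    homCls K = fun _ => isoClass (0 : 𝒜) :=
  funext fun i => Quotient.sound ⟨((hK i).isZero_homology).isoZero⟩

theorem acyclic_iff_homCls {K : PeriodicComplex 𝒜 t} :
    K.Acyclic ↔ homCls K = fun _ => isoClass (0 : 𝒜) := by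
  refine ⟨homCls_eq_of_acyclic, fun h i => ?_⟩
  obtain ⟨e⟩ : Nonempty (K.homology i ≅ 0) := Quotient.exact (congrFun h i)
  exact (K.exactAt_iff_isZero_homology i).2 ((isZero_zero 𝒜).of_iso e)

theorem K₀_of_cycles_of_acyclic {K : PeriodicComplex 𝒜 t} (hK : K.Acyclic) (i : ZMod t) :
    K₀.of (K.cycles (i + 1)) = imCls K i := by
  rw [K₀_of_cycles, homCls_eq_of_acyclic hK, K₀.ofIsoClass_mk, K₀.of_zero, zero_add]

theorem K₀_of_opcycles_of_acyclic {K : PeriodicComplex 𝒜 t} (hK : K.Acyclic) (i : ZMod t) :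
    K₀.of (K.opcycles i) = imCls K i :=
  haveI := mono_fromOpcycles hK i
  (imCls_eq_of_factor K i (K.pOpcycles i) (K.fromOpcycles i (i + 1)) (by simp)).symm

/-- Images are objects minus cycles in `K₀`, and both of these are additive. -/
theorem IsSES.imCls_of_cycles {A B X : PeriodicComplex 𝒜 t} {f : B ⟶ X} {g : X ⟶ A}
    (h : IsSES f g) (hc : ∀ i, IsSES (cyclesMap f i) (cyclesMap g i)) :
    imCls X = imCls A + imCls B := by
  funext i
  have h1 := (h.degreewise i).K₀_of
  rw [K₀_of_X, K₀_of_X A, K₀_of_X B, (hc i).K₀_of] at h1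
  rw [Pi.add_apply]
  have : imCls X i = (imCls X i + (K₀.of (A.cycles i) + K₀.of (B.cycles i))) -
    (K₀.of (A.cycles i) + K₀.of (B.cycles i)) := by abel
  rw [this, h1]
  abel

theorem IsSES.imCls_of_acyclic_right {K B X : PeriodicComplex 𝒜 t} {f : B ⟶ X} {g : X ⟶ K}
    (h : IsSES f g) (hK : K.Acyclic) : imCls X = imCls K + imCls B :=
  h.imCls_of_cycles fun i => h.cycles_of_acyclic_right hK i

theorem IsSES.imCls_of_acyclic_left {A K X : PeriodicComplex 𝒜 t} {f : K ⟶ X} {g : X ⟶ A}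
    (h : IsSES f g) (hK : K.Acyclic) : imCls X = imCls A + imCls K :=
  h.imCls_of_cycles fun i => h.cycles_of_acyclic_left hK i

theorem IsSES.homCls_of_acyclic_right {K B X : PeriodicComplex 𝒜 t} {f : B ⟶ X} {g : X ⟶ K}
    (h : IsSES f g) (hK : K.Acyclic) : homCls X = homCls B := by
  funext i
  obtain ⟨j, rfl⟩ := exists_eq_succ i
  have hs := h.shortExact
  have m : Mono (homologyMap f (j + 1)) :=
    (hs.homology_exact₁ j (j + 1) (rel_succ j)).mono_g ((hK j).isZero_homology.eq_of_src _ _)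
  have e : Epi (homologyMap f (j + 1)) :=
    (hs.homology_exact₂ (j + 1)).epi_f ((hK (j + 1)).isZero_homology.eq_of_tgt _ _)
  have := isIso_of_mono_of_epi (homologyMap f (j + 1))
  exact Quotient.sound ⟨(asIso (homologyMap f (j + 1))).symm⟩

theorem IsSES.homCls_of_acyclic_left {A K X : PeriodicComplex 𝒜 t} {f : K ⟶ X} {g : X ⟶ A}
    (h : IsSES f g) (hK : K.Acyclic) : homCls X = homCls A := by
  funext i
  have hs := h.shortExact
  have m : Mono (homologyMap g i) :=
    (hs.homology_exact₂ i).mono_g ((hK i).isZero_homology.eq_of_src _ _)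
  have e : Epi (homologyMap g i) :=
    (hs.homology_exact₃ i (i + 1) (rel_succ i)).epi_f
      ((hK (i + 1)).isZero_homology.eq_of_tgt _ _)
  have := isIso_of_mono_of_epi (homologyMap g i)
  exact Quotient.sound ⟨asIso (homologyMap g i)⟩

theorem imCls_zeroDiff (Y : ZMod t → 𝒜) : imCls (zeroDiff Y) = 0 := by
  funext i
  have : Mono (0 : (0 : 𝒜) ⟶ (zeroDiff Y).X (i + 1)) :=
    ⟨fun _ _ _ => (isZero_zero 𝒜).eq_of_tgt _ _⟩
  have : Epi (0 : (zeroDiff Y).X i ⟶ (0 : 𝒜)) :=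
    ⟨fun _ _ _ => (isZero_zero 𝒜).eq_of_src _ _⟩
  rw [imCls_eq_of_factor _ i (0 : (zeroDiff Y).X i ⟶ (0 : 𝒜)) 0 (by simp), K₀.of_zero]
  rfl

theorem homCls_zeroDiff (Y : ZMod t → 𝒜) : homCls (zeroDiff Y) = fun i => isoClass (Y i) := by
  funext i
  obtain ⟨j, rfl⟩ := exists_eq_succ i
  have := (zeroDiff Y).isIso_homologyπ j (j + 1) (prev_eq j) (by simp)
  exact Quotient.sound ⟨(asIso ((zeroDiff Y).homologyπ (j + 1))).symm ≪≫
    asIso ((zeroDiff Y).iCycles (j + 1))⟩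

variable [NeZero t] [FinitaryCategory 𝒜] (h𝒜 : IsHereditary 𝒜)

/-- The Euler form of an acyclic complex and an arbitrary complex. -/
theorem eulerForm_of_acyclic {K : PeriodicComplex 𝒜 t} (hK : K.Acyclic)
    (L : PeriodicComplex 𝒜 t) :
    eulerForm K L = ∏ i, euler h𝒜 (imCls K i) (K₀.of (L.X i)) := by
  -- Since `Ext¹(K, -)` is right exact, the Euler form is additive along the cycles of `L`, which
  -- reduces the claim to complexes with zero differential.
  obtain ⟨Y, q, hq⟩ := isSES_cycles L
  rw [hq.eulerForm_right K fun ζ => hq.lift_of_comp_eq_zero ζ (comp_eq_zero_of_acyclic h𝒜 hK _ _),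
    eulerForm_zeroDiff_right hK, eulerForm_zeroDiff_right hK, ← Finset.prod_mul_distrib]
  refine Finset.prod_congr rfl fun i _ => ?_
  rw [(hq.degreewise i).K₀_of, euler_add_right, ← K₀_of_opcycles_of_acyclic hK, euler_of, euler_of]

/-- The index `i - 1` appears because the cycles of an acyclic complex in degree `i` are the image
of the differential from degree `i - 1`. -/
theorem eulerForm_zeroDiff_of_acyclic {K : PeriodicComplex 𝒜 t} (hK : K.Acyclic)
    (W : ZMod t → 𝒜) :
    eulerForm (zeroDiff W) K = ∏ i, euler h𝒜 (K₀.of (W i)) (imCls K (i - 1)) := by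
  rw [eulerForm_zeroDiff_left hK]
  refine Finset.prod_congr rfl fun i _ => ?_
  obtain ⟨j, rfl⟩ := exists_eq_succ i
  rw [add_sub_cancel_right, ← K₀_of_cycles_of_acyclic hK, euler_of]

end Invariants

/-! ### Linking a complex to its homology by acyclic complexes -/

section Resolutions
variable {𝒜 : Type u} [Category.{v} 𝒜] [Abelian 𝒜] {t : ℕ}

open HomologicalComplex

/-- The differential factors through an object `Q` which extends the image in the next degree by
the homology. -/
theorem exists_factor_left (h𝒜 : IsHereditary 𝒜) (M : PeriodicComplex 𝒜 t) (i : ZMod t) :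
    ∃ (Q : 𝒜) (j : M.homology i ⟶ Q) (r : Q ⟶ M.X (i + 1)) (φ : M.opcycles i ⟶ Q),
      IsSES j r ∧ M.homologyι i ≫ φ = j ∧ Mono φ ∧ φ ≫ r = M.fromOpcycles i (i + 1) := by
  obtain ⟨q, hq, hq'⟩ := isSES_homology_opcycles M i
  -- Heredity extends the extension of the image by the homology, which is given by the opcycles,
  -- along the inclusion of the image in `M.X (i + 1)`.
  obtain ⟨Q, j, r, φ, h, h1, h2⟩ := hq.exists_extend h𝒜 (image.ι (M.d i (i + 1)))
  refine ⟨Q, j, r, φ, h, h1, ?_, h2.trans hq'⟩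
  rw [Preadditive.mono_iff_cancel_zero]
  intro Z x hx
  obtain ⟨y, rfl⟩ := hq.exists_lift x (by
    rw [← cancel_mono (image.ι _), Category.assoc, ← h2, reassoc_of% hx, zero_comp, zero_comp])
  have := h.mono
  have : y = 0 := by
    rw [← cancel_mono j, zero_comp, ← h1, ← Category.assoc, hx]
  rw [this, zero_comp]

/-- Every complex `M` embeds into a complex `N` with acyclic cokernel such that the complex of
homology objects of `M` embeds into `N` with contractible cokernel. -/
theorem exists_coresolution (h𝒜 : IsHereditary 𝒜) (M : PeriodicComplex 𝒜 t) :
    ∃ (N K : PeriodicComplex 𝒜 t) (i : M ⟶ N) (p : N ⟶ K)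
      (j : (zeroDiff fun i => M.homology i) ⟶ N) (s : N ⟶ diskSum M.X),
      K.Acyclic ∧ IsSES i p ∧ IsSES j s := by
  choose Q j r φ hjr h1 hφ h2 using exists_factor_left h𝒜 M
  have hj : ∀ i, j i ≫ r i = 0 := fun i => (hjr i).w
  have hr := fun i => (hjr i).epi
  have hm := fun i => (hjr i).mono
  let q : ∀ i, M.X i ⟶ Q i := fun i => M.pOpcycles i ≫ φ i
  have qr : ∀ i, q i ≫ r i = M.d i (i + 1) := fun i => by simp [q, h2]
  have dq : ∀ i, M.d i (i + 1) ≫ q (i + 1) = 0 := fun i => by simp [q]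
  -- The differential of `N` is `(m, x) ↦ (r x, 0)`. Dividing by the homology, the kernel of `r`,
  -- leaves the contractible complex on `M.X`; the graph `m ↦ (m, q m)` embeds `M` with quotient
  -- `Q`, on which the differential becomes `-q r`.
  let N : PeriodicComplex 𝒜 t := periodicMk (fun i => M.X i ⊞ Q i)
    (fun i => biprod.snd ≫ r i ≫ biprod.inl) fun i => by simp
  have Nd : ∀ i, N.d i (i + 1) = (biprod.snd : M.X i ⊞ Q i ⟶ Q i) ≫ r i ≫
      (biprod.inl : M.X (i + 1) ⟶ M.X (i + 1) ⊞ Q (i + 1)) := periodicMk_d _ _ _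
  have sq : ∀ i, (-(r i ≫ q (i + 1))) ≫ (-(r (i + 1) ≫ q (i + 1 + 1))) = 0 := fun i => by
    simp [reassoc_of% qr (i + 1), dq]
  let K : PeriodicComplex 𝒜 t := periodicMk Q (fun i => -(r i ≫ q (i + 1))) sq
  have Kd : ∀ i, K.d i (i + 1) = -(r i ≫ q (i + 1)) := periodicMk_d _ _ _
  let ι : M ⟶ N := periodicHom (fun i => biprod.lift (𝟙 _) (q i)) fun i => by
    rw [Nd]
    apply biprod.hom_ext <;> simp [reassoc_of% qr i, dq]
  let p : N ⟶ K := periodicHom (fun i => biprod.desc (-q i) (𝟙 (Q i))) fun i => by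
    rw [Nd, Kd]
    apply biprod.hom_ext' <;> simp [reassoc_of% qr i, dq]
  let J : (zeroDiff fun i => M.homology i) ⟶ N :=
    periodicHom (fun i => j i ≫ biprod.inr) fun i => by
      rw [Nd]
      simp [reassoc_of% hj i]
  let s : N ⟶ diskSum M.X := periodicHom (fun i => biprod.map (𝟙 _) (r i)) fun i => by
    rw [Nd, diskSum_d]
    apply biprod.hom_ext' <;> apply biprod.hom_ext <;> simp
  refine ⟨N, K, ι, p, J, s, acyclic_iff.2 fun i Z x hx => ?_, IsSES.of_degreewise fun i => ?_,
    IsSES.of_degreewise fun i => ?_⟩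
  -- If `q (r x) = 0`, then `r x` is a boundary `d m` because `φ` is mono. Hence `x - q m` lies in
  -- the homology and equals `q m'` for some `m'`. As `r` is epi, `m' + m = r z`, and so `x = q (r
  -- z) = d (-z)`.
  · change Z ⟶ Q (i + 1) at x
    rw [Kd] at hx
    have hx1 : x ≫ r (i + 1) ≫ q (i + 1 + 1) = 0 := by simpa using hx
    have hx2 : (x ≫ r (i + 1)) ≫ M.pOpcycles (i + 1 + 1) = 0 := by
      rw [← cancel_mono (φ (i + 1 + 1)), zero_comp]
      simpa [q] using hx1
    obtain ⟨Z₁, π₁, _, m, hm1⟩ :=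
      (comp_pOpcycles_eq_zero_iff_up_to_refinements _ _ (i + 1) (prev_eq _)).1 hx2
    obtain ⟨y, hy⟩ := (hjr (i + 1)).exists_lift (π₁ ≫ x - m ≫ q (i + 1)) (by
      rw [Preadditive.sub_comp, Category.assoc, Category.assoc, qr, hm1, sub_self])
    obtain ⟨Z₂, π₂, _, m', hm'⟩ := surjective_up_to_refinements_of_epi (M.pOpcycles (i + 1))
      (y ≫ M.homologyι (i + 1))
    obtain ⟨Z₃, π₃, _, z, hz⟩ := surjective_up_to_refinements_of_epi (r i) (m' + π₂ ≫ m)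
    refine ⟨Z₃, π₃ ≫ π₂ ≫ π₁, inferInstance, -z, ?_⟩
    rw [Kd]
    have e1 : π₂ ≫ y ≫ j (i + 1) = m' ≫ q (i + 1) := by
      rw [← h1]
      simp only [q] at hm' ⊢
      rw [← reassoc_of% hm']
    rw [hy] at e1
    have e2 : π₂ ≫ π₁ ≫ x = (m' + π₂ ≫ m) ≫ q (i + 1) := by
      rw [Preadditive.add_comp, ← e1]
      simp
    rw [Preadditive.neg_comp_neg, ← reassoc_of% hz, Category.assoc, Category.assoc, e2]
  · change IsSES (biprod.lift (𝟙 _) (q i)) (biprod.desc (-q i) (𝟙 (Q i)))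
    have : Mono (biprod.lift (𝟙 (M.X i)) (q i)) := by
      have : Mono (biprod.lift (𝟙 (M.X i)) (q i) ≫ biprod.fst) := by
        rw [biprod.lift_fst]; infer_instance
      exact mono_of_mono _ biprod.fst
    have : Epi (biprod.desc (-q i) (𝟙 (Q i))) := by
      have : Epi (biprod.inr ≫ biprod.desc (-q i) (𝟙 (Q i))) := by
        rw [biprod.inr_desc]; infer_instance
      exact epi_of_epi biprod.inr _
    refine IsSES.of_mono_epi (by simp) fun k hk => ⟨k ≫ biprod.fst, ?_⟩
    apply biprod.hom_ext
    · simp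
    · have : k ≫ biprod.desc (-q i) (𝟙 (Q i)) = k ≫ biprod.snd - (k ≫ biprod.fst) ≫ q i := by
        rw [biprod.desc_eq]
        simp
        abel
      rw [this, sub_eq_zero] at hk
      simpa using hk.symm
  · change IsSES (j i ≫ (biprod.inr : Q i ⟶ M.X i ⊞ Q i)) (biprod.map (𝟙 _) (r i))
    have : Epi (biprod.map (𝟙 (M.X i)) (r i)) := ⟨fun k l e => by
      apply biprod.hom_ext'
      · simpa using biprod.inl ≫= e
      · rw [← cancel_epi (r i)]; simpa using biprod.inr ≫= e⟩
    refine IsSES.of_mono_epi (by simp [reassoc_of% hj i]) fun k hk => ?_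
    obtain ⟨l, hl⟩ := (hjr i).exists_lift (k ≫ biprod.snd) (by simpa using hk =≫ biprod.snd)
    refine ⟨l, ?_⟩
    rw [reassoc_of% hl]
    apply biprod.hom_ext
    · simpa using (hk =≫ biprod.fst).symm
    · simp

/-- The differential factors through an object `P` which is an extension of the homology by the
object in the previous degree. -/
theorem exists_factor_right (h𝒜 : IsHereditary 𝒜) (M : PeriodicComplex 𝒜 t) (i : ZMod t) :
    ∃ (P : 𝒜) (a : M.X (i - 1) ⟶ P) (h : P ⟶ M.homology i) (φ : P ⟶ M.cycles i),
      IsSES a h ∧ φ ≫ M.homologyπ i = h ∧ Epi φ ∧ a ≫ φ = M.toCycles (i - 1) i := by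
  have key : ∀ (k : ZMod t) (e : k + 1 = i), ∃ (P : 𝒜) (a : M.X k ⟶ P) (h : P ⟶ M.homology i)
      (φ : P ⟶ M.cycles i),
      IsSES a h ∧ φ ≫ M.homologyπ i = h ∧ Epi φ ∧ a ≫ φ = M.toCycles k i := by
    rintro k rfl
    have hq := isSES_image_cycles M k
    -- Dually, the extension of the homology by the image, which is given by the cycles, is lifted
    -- along the projection of the preceding object onto the image.
    obtain ⟨P, a, h, φ, hs, h1, h2⟩ := hq.exists_colift h𝒜 (factorThruImage (M.d k (k + 1)))
    refine ⟨P, a, h, φ, hs, h2, ?_, h1.trans (factorThruImage_imageToCycles' M k)⟩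
    rw [Preadditive.epi_iff_cancel_zero]
    intro Z x hx
    obtain ⟨y, rfl⟩ := hq.exists_desc x (by
      rw [← cancel_epi (factorThruImage (M.d k (k + 1))), ← Category.assoc, ← h1, Category.assoc,
        hx, comp_zero, comp_zero])
    have := hs.epi
    have : y = 0 := by
      rw [← cancel_epi h, comp_zero, ← h2, Category.assoc, hx]
    rw [this, comp_zero]
  exact key (i - 1) (sub_add_cancel i 1)

/-- Every complex `M` is a quotient with acyclic kernel of a complex `N` of which the complex of
homology objects of `M` is a quotient with contractible kernel. -/
theorem exists_resolution (h𝒜 : IsHereditary 𝒜) (M : PeriodicComplex 𝒜 t) :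
    ∃ (N K : PeriodicComplex 𝒜 t) (i : K ⟶ N) (p : N ⟶ M)
      (j : diskSum (shiftX M) ⟶ N) (s : N ⟶ zeroDiff fun i => M.homology i),
      K.Acyclic ∧ IsSES i p ∧ IsSES j s := by
  choose P a' h φ hs' h1 hφ h2' using exists_factor_right h𝒜 M
  let sh : ∀ i : ZMod t, M.X i ≅ M.X (i + 1 - 1) := fun i =>
    M.XIsoOfEq (add_sub_cancel_right i 1).symm
  let a : ∀ i, M.X i ⟶ P (i + 1) := fun i => (sh i).hom ≫ a' (i + 1)
  have hs : ∀ i, IsSES (a i) (h (i + 1)) := fun i => (hs' (i + 1)).iso_comp (sh i)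
  have h2 : ∀ i, a i ≫ φ (i + 1) = M.toCycles i (i + 1) := fun i => by
    rw [← cancel_mono (M.iCycles (i + 1))]
    simp [a, h2', sh]
  have ha : ∀ i, a' i ≫ h i = 0 := fun i => (hs' i).w
  have hm := fun i => (hs i).mono
  have hm' := fun i => (hs' i).mono
  have hep := fun i => (hs' i).epi
  let e : ∀ i, P i ⟶ M.X i := fun i => φ i ≫ M.iCycles i
  have ae : ∀ i, a i ≫ e (i + 1) = M.d i (i + 1) := fun i => by
    simp [e, reassoc_of% h2 i]
  have ed : ∀ i, e i ≫ M.d i (i + 1) = 0 := fun i => by simp [e]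
  -- Here the differential is `(m, x) ↦ (0, a m)`. The map `(m, x) ↦ m + e x` onto `M` has kernel
  -- `P` with differential `-a e`, and the projection of `P` onto the homology has contractible
  -- kernel in `N`.
  let N : PeriodicComplex 𝒜 t := periodicMk (fun i => M.X i ⊞ P i)
    (fun i => biprod.fst ≫ a i ≫ biprod.inr) fun i => by simp
  have Nd : ∀ i, N.d i (i + 1) = (biprod.fst : M.X i ⊞ P i ⟶ M.X i) ≫ a i ≫
      (biprod.inr : P (i + 1) ⟶ M.X (i + 1) ⊞ P (i + 1)) := periodicMk_d _ _ _
  have sq : ∀ i, (-(e i ≫ a i)) ≫ (-(e (i + 1) ≫ a (i + 1))) = 0 := fun i => by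
    simp only [Preadditive.neg_comp_neg, Category.assoc, reassoc_of% ae i]
    rw [← Category.assoc, ed, zero_comp]
  let K : PeriodicComplex 𝒜 t := periodicMk P (fun i => -(e i ≫ a i)) sq
  have Kd : ∀ i, K.d i (i + 1) = -(e i ≫ a i) := periodicMk_d _ _ _
  let ι : K ⟶ N := periodicHom (fun i => biprod.lift (-e i) (𝟙 (P i))) fun i => by
    rw [Nd, Kd]
    apply biprod.hom_ext
    · simp [ae i, ed]
    · simp only [Category.assoc, biprod.lift_snd, biprod.inr_snd, biprod.lift_fst_assoc,
        Preadditive.neg_comp]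
  let p : N ⟶ M := periodicHom (fun i => biprod.desc (𝟙 _) (e i)) fun i => by
    rw [Nd]
    apply biprod.hom_ext' <;> simp [ae i, ed i]
  let J : diskSum (shiftX M) ⟶ N :=
    periodicHom (fun i => biprod.desc (a' i ≫ biprod.inr) ((sh i).inv ≫ biprod.inl)) fun i => by
      rw [Nd, diskSum_d]
      apply biprod.hom_ext' <;> simp [a, sh]
  let s : N ⟶ zeroDiff fun i => M.homology i :=
    periodicHom (fun i => biprod.snd ≫ h i) fun i => by
      rw [Nd, zeroDiff_d]
      simp [(hs i).w]
  refine ⟨N, K, ι, p, J, s, acyclic_iff.2 fun i Z x hx => ?_, IsSES.of_degreewise fun i => ?_,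
    IsSES.of_degreewise fun i => ?_⟩
  -- If `a (e x) = 0`, then `φ x = 0` since `a` and the inclusion of cycles are mono. So `x` dies in
  -- the homology and `x = a m`, where `m` is a cycle because `d m = φ x`. Writing `m = e y` gives
  -- `x = a (e y) = d (-y)`.
  · change Z ⟶ P (i + 1) at x
    rw [Kd] at hx
    have hx1 : x ≫ φ (i + 1) = 0 := by
      rw [← cancel_mono (M.iCycles (i + 1)), ← cancel_mono (a (i + 1))]
      simpa [e] using hx
    obtain ⟨m, hm1⟩ := (hs i).exists_lift x (by rw [← h1, reassoc_of% hx1, zero_comp])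
    have hm2 : m ≫ M.d i (i + 1) = 0 := by
      rw [← M.toCycles_i, ← h2, ← Category.assoc, ← Category.assoc, hm1, hx1, zero_comp]
    obtain ⟨Z₁, π₁, _, y, hy⟩ := surjective_up_to_refinements_of_epi (φ i)
      (M.liftCycles m (i + 1) (next_eq i) hm2)
    refine ⟨Z₁, π₁, inferInstance, -y, ?_⟩
    rw [Kd, Preadditive.neg_comp_neg, ← hm1]
    have := hy =≫ M.iCycles i
    simp only [Category.assoc, liftCycles_i] at this
    simp only [e, Category.assoc]
    rw [reassoc_of% this]
  · change IsSES (biprod.lift (-e i) (𝟙 (P i))) (biprod.desc (𝟙 _) (e i))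
    have : Mono (biprod.lift (-e i) (𝟙 (P i))) := by
      have : Mono (biprod.lift (-e i) (𝟙 (P i)) ≫ biprod.snd) := by
        rw [biprod.lift_snd]; infer_instance
      exact mono_of_mono _ biprod.snd
    have : Epi (biprod.desc (𝟙 (M.X i)) (e i)) := by
      have : Epi (biprod.inl ≫ biprod.desc (𝟙 (M.X i)) (e i)) := by
        rw [biprod.inl_desc]; infer_instance
      exact epi_of_epi biprod.inl _
    refine IsSES.of_mono_epi (by simp) fun k hk => ⟨k ≫ biprod.snd, ?_⟩
    have : k ≫ biprod.desc (𝟙 (M.X i)) (e i) = k ≫ biprod.fst + (k ≫ biprod.snd) ≫ e i := by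
      rw [biprod.desc_eq]
      simp
    rw [this, add_eq_zero_iff_eq_neg] at hk
    apply biprod.hom_ext
    · simpa using hk.symm
    · simp
  · change IsSES (biprod.desc (a' i ≫ (biprod.inr : P i ⟶ M.X i ⊞ P i)) ((sh i).inv ≫ biprod.inl))
      (biprod.snd ≫ h i)
    have : Mono (biprod.desc (a' i ≫ (biprod.inr : P i ⟶ M.X i ⊞ P i))
        ((sh i).inv ≫ biprod.inl)) := ⟨fun k l e => by
      apply biprod.hom_ext
      · rw [← cancel_mono (a' i)]
        simpa [biprod.desc_eq] using e =≫ biprod.snd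
      · rw [← cancel_mono (sh i).inv]
        simpa [biprod.desc_eq] using e =≫ biprod.fst⟩
    have : Epi ((biprod.snd : M.X i ⊞ P i ⟶ P i) ≫ h i) := epi_comp _ _
    refine IsSES.of_mono_epi (by apply biprod.hom_ext' <;> simp [ha i]) fun k hk => ?_
    obtain ⟨l, hl⟩ := (hs' i).exists_lift (k ≫ biprod.snd) (by simpa using hk)
    refine ⟨biprod.lift l (k ≫ biprod.fst ≫ (sh i).hom), ?_⟩
    apply biprod.hom_ext <;> simp [biprod.lift_desc, hl]

end Resolutions

/-! ### Modulo invariants, a product depends only on the invariants of its factors -/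

section ClassProjection
variable {𝒜 : Type u} [Category.{v} 𝒜] [Abelian 𝒜] {t : ℕ}

variable (𝒜 t) in
/-- The index set of the invariants: a class in `K₀` and an isomorphism class for each degree. -/
abbrev ClassIndex := (ZMod t → K₀ 𝒜) × (ZMod t → IsoClass 𝒜)

/-- The invariants of a complex. -/
noncomputable def clsIdx (M : PeriodicComplex 𝒜 t) : ClassIndex 𝒜 t := (imCls M, homCls M)

theorem acyclic_zero : (0 : PeriodicComplex 𝒜 t).Acyclic := fun i =>
  (HomologicalComplex.exactAt_iff_isZero_homology _ i).2
    ((HomologicalComplex.homologyFunctor 𝒜 _ i).map_isZero (isZero_zero _))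

theorem imCls_zero : imCls (0 : PeriodicComplex 𝒜 t) = 0 := by
  have := (isSES_of_iso (Iso.refl (0 : PeriodicComplex 𝒜 t))).imCls_of_acyclic_left acyclic_zero
  simpa using this

theorem clsIdx_eq_of_iso {M M' : PeriodicComplex 𝒜 t} (e : M ≅ M') : clsIdx M = clsIdx M' :=
  Prod.ext (by
    have := (isSES_of_iso e).imCls_of_acyclic_left acyclic_zero
    rwa [imCls_zero, add_zero] at this) ((isSES_of_iso e).homCls_of_acyclic_left acyclic_zero)

/-- The isomorphism of complexes with zero differential given by a family of isomorphisms. -/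
noncomputable def zeroDiffIso {Y Y' : ZMod t → 𝒜} (e : ∀ i, Y i ≅ Y' i) :
    zeroDiff Y ≅ zeroDiff Y' where
  hom := zeroDiffMap fun i => (e i).hom
  inv := zeroDiffMap fun i => (e i).inv
  hom_inv_id := HomologicalComplex.hom_ext _ _ fun i => (e i).hom_inv_id
  inv_hom_id := HomologicalComplex.hom_ext _ _ fun i => (e i).inv_hom_id

variable (𝒜 t) in
/-- The projection from the Ringel–Hall algebra to the vector space spanned by the invariants. -/
noncomputable def classProj : HallAlgebra (PeriodicComplex 𝒜 t) →ₗ[ℚ] (ClassIndex 𝒜 t →₀ ℚ) :=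
  Finsupp.lmapDomain ℚ ℚ (Quotient.lift clsIdx fun _ _ ⟨e⟩ => clsIdx_eq_of_iso e)

theorem classProj_of (M : PeriodicComplex 𝒜 t) :
    classProj 𝒜 t (HallAlgebra.of M) = Finsupp.single (clsIdx M) 1 :=
  Finsupp.mapDomain_single

/-- Translation of the invariants. -/
noncomputable def classShift (a : ZMod t → K₀ 𝒜) :
    (ClassIndex 𝒜 t →₀ ℚ) →ₗ[ℚ] (ClassIndex 𝒜 t →₀ ℚ) :=
  Finsupp.lmapDomain ℚ ℚ fun x => (x.1 + a, x.2)

theorem classShift_single (a : ZMod t → K₀ 𝒜) (x : ClassIndex 𝒜 t) (r : ℚ) :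
    classShift a (Finsupp.single x r) = Finsupp.single (x.1 + a, x.2) r :=
  Finsupp.mapDomain_single

theorem classShift_add (a b : ZMod t → K₀ 𝒜) (x : ClassIndex 𝒜 t →₀ ℚ) :
    classShift (a + b) x = classShift a (classShift b x) := by
  induction x using Finsupp.induction_linear with
  | zero => simp
  | add x y hx hy => rw [map_add, map_add, map_add, hx, hy]
  | single x r => rw [classShift_single, classShift_single, classShift_single, add_comm a,
      ← add_assoc]

theorem classShift_injective (a : ZMod t → K₀ 𝒜) : Function.Injective (classShift (𝒜 := 𝒜) a) :=
  Finsupp.mapDomain_injective fun x y h => by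
    have h1 := congrArg Prod.fst h
    have h2 := congrArg Prod.snd h
    exact Prod.ext (add_right_cancel h1) h2

theorem IsSES.classProj_of_acyclic_right {K B X : PeriodicComplex 𝒜 t} {f : B ⟶ X} {g : X ⟶ K}
    (h : IsSES f g) (hK : K.Acyclic) : classProj 𝒜 t (HallAlgebra.of X) =
      classShift (imCls K) (classProj 𝒜 t (HallAlgebra.of B)) := by
  rw [classProj_of, classProj_of, classShift_single, clsIdx, h.imCls_of_acyclic_right hK,
    h.homCls_of_acyclic_right hK, add_comm]
  rfl

theorem IsSES.classProj_of_acyclic_left {K A X : PeriodicComplex 𝒜 t} {f : K ⟶ X} {g : X ⟶ A}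
    (h : IsSES f g) (hK : K.Acyclic) : classProj 𝒜 t (HallAlgebra.of X) =
      classShift (imCls K) (classProj 𝒜 t (HallAlgebra.of A)) := by
  rw [classProj_of, classProj_of, classShift_single, clsIdx, h.imCls_of_acyclic_left hK,
    h.homCls_of_acyclic_left hK]
  rfl

theorem of_zeroDiff_homology_eq {M M' : PeriodicComplex 𝒜 t} (h : homCls M = homCls M') :
    (HallAlgebra.of (zeroDiff fun i => M.homology i) : HallAlgebra (PeriodicComplex 𝒜 t)) =
      HallAlgebra.of (zeroDiff fun i => M'.homology i) := by
  have : ∀ i, Nonempty (M.homology i ≅ M'.homology i) := fun i => Quotient.exact (congrFun h i)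
  exact HallAlgebra.of_eq_of_iso (zeroDiffIso fun i => (this i).some)

variable [NeZero t] [FinitaryCategory 𝒜] (h𝒜 : IsHereditary 𝒜)

attribute [local instance] HasExt.standard

/-- The Euler form of a family of classes of images with the objects of a complex. -/
noncomputable def eulerLeft (a : ZMod t → K₀ 𝒜) (L : PeriodicComplex 𝒜 t) : ℚ :=
  ∏ i, euler h𝒜 (a i) (K₀.of (L.X i))

theorem eulerLeft_ne_zero (a : ZMod t → K₀ 𝒜) (L : PeriodicComplex 𝒜 t) :
    eulerLeft h𝒜 a L ≠ 0 := Finset.prod_ne_zero_iff.2 fun _ _ => euler_ne_zero _ _ _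

theorem eulerLeft_add (a b : ZMod t → K₀ 𝒜) (L : PeriodicComplex 𝒜 t) :
    eulerLeft h𝒜 (a + b) L = eulerLeft h𝒜 a L * eulerLeft h𝒜 b L := by
  simp only [eulerLeft, Pi.add_apply, euler_add_left, Finset.prod_mul_distrib]

/-- The Euler form of a family of objects with a family of classes of images. -/
noncomputable def eulerRight (W : ZMod t → 𝒜) (a : ZMod t → K₀ 𝒜) : ℚ :=
  ∏ i, euler h𝒜 (K₀.of (W i)) (a (i - 1))

theorem eulerRight_ne_zero (W : ZMod t → 𝒜) (a : ZMod t → K₀ 𝒜) :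
    eulerRight h𝒜 W a ≠ 0 := Finset.prod_ne_zero_iff.2 fun _ _ => euler_ne_zero _ _ _

theorem eulerRight_add (W : ZMod t → 𝒜) (a b : ZMod t → K₀ 𝒜) :
    eulerRight h𝒜 W (a + b) = eulerRight h𝒜 W a * eulerRight h𝒜 W b := by
  simp only [eulerRight, Pi.add_apply, euler_add_right, Finset.prod_mul_distrib]

/-- The obstruction to extending a class from `M` to `N` is a product starting at the acyclic
complex `K`, hence zero, so the comparison of products applies. -/
theorem IsSES.classProj_mul_left (h𝒜 : IsHereditary 𝒜) {M N K : PeriodicComplex 𝒜 t} {i : M ⟶ N} {p : N ⟶ K}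
    (h : IsSES i p) (hK : K.Acyclic) (L : PeriodicComplex 𝒜 t) :
    classProj 𝒜 t (HallAlgebra.of N * HallAlgebra.of L) = (eulerLeft h𝒜 (imCls K) L)⁻¹ •
      classShift (imCls K) (classProj 𝒜 t (HallAlgebra.of M * HallAlgebra.of L)) := by
  rw [eulerLeft, ← eulerForm_of_acyclic h𝒜 hK]
  exact h.map_mul_of_left _ _ L
    (fun ξ => h.extend_of_comp_eq_zero ξ (comp_eq_zero_of_acyclic h𝒜 hK _ _))
    fun hX => hX.classProj_of_acyclic_right hK

/-- The left factor has zero differential because only then is the product of extensions ending at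
`K` known to vanish. This is enough, as the left factor is always reduced first. -/
theorem IsSES.classProj_mul_right {M N K : PeriodicComplex 𝒜 t} {i : K ⟶ N} {p : N ⟶ M}
    (h : IsSES i p) (hK : K.Acyclic) (W : ZMod t → 𝒜) :
    classProj 𝒜 t (HallAlgebra.of (zeroDiff W) * HallAlgebra.of N) =
      (eulerRight h𝒜 W (imCls K))⁻¹ •
        classShift (imCls K) (classProj 𝒜 t (HallAlgebra.of (zeroDiff W) * HallAlgebra.of M)) := by
  rw [eulerRight, ← eulerForm_zeroDiff_of_acyclic h𝒜 hK]
  exact h.map_mul_of_right _ _ _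
    (fun ξ => h.lift_of_comp_eq_zero ξ (comp_eq_zero_of_zeroDiff_of_acyclic h𝒜 hK _ _))
    fun hX => hX.classProj_of_acyclic_left hK

/-- Reduction of the left factor to a complex with zero differential. -/
theorem classProj_mul_eq_left (M L : PeriodicComplex 𝒜 t) :
    classProj 𝒜 t (HallAlgebra.of M * HallAlgebra.of L) = (eulerLeft h𝒜 (imCls M) L)⁻¹ •
      classShift (imCls M) (classProj 𝒜 t
        (HallAlgebra.of (zeroDiff fun i => M.homology i) * HallAlgebra.of L)) := by
  obtain ⟨N, K, i, p, j, s, hK, h1, h2⟩ := exists_coresolution h𝒜 M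
  have hD := acyclic_diskSum M.X
  have e := h1.imCls_of_acyclic_right hK
  rw [h2.imCls_of_acyclic_right hD, imCls_zeroDiff, add_zero] at e
  -- `[N] * [L]` is evaluated through both sequences. The images of the contractible quotient are
  -- those of `K` plus those of `M`, so the scalar and the translation belonging to `K` cancel.
  have e1 := h1.classProj_mul_left h𝒜 hK L
  rw [h2.classProj_mul_left h𝒜 hD L, e, classShift_add, eulerLeft_add, mul_inv, mul_smul] at e1
  have e2 := smul_right_injective _ (inv_ne_zero (eulerLeft_ne_zero h𝒜 (imCls K) L)) e1
  rw [← map_smul] at e2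
  exact (classShift_injective _ e2).symm

/-- Reduction of the right factor to a complex with zero differential. -/
theorem classProj_mul_eq_right (W : ZMod t → 𝒜) (M : PeriodicComplex 𝒜 t) :
    classProj 𝒜 t (HallAlgebra.of (zeroDiff W) * HallAlgebra.of M) =
      (eulerRight h𝒜 W (imCls M))⁻¹ • classShift (imCls M) (classProj 𝒜 t
        (HallAlgebra.of (zeroDiff W) * HallAlgebra.of (zeroDiff fun i => M.homology i))) := by
  obtain ⟨N, K, i, p, j, s, hK, h1, h2⟩ := exists_resolution h𝒜 M
  have hD := acyclic_diskSum (shiftX M)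
  have e := h1.imCls_of_acyclic_left hK
  rw [h2.imCls_of_acyclic_left hD, imCls_zeroDiff, zero_add, add_comm] at e
  have e1 := h1.classProj_mul_right h𝒜 hK W
  rw [h2.classProj_mul_right h𝒜 hD W, e, classShift_add, eulerRight_add, mul_inv, mul_smul] at e1
  have e2 := smul_right_injective _ (inv_ne_zero (eulerRight_ne_zero h𝒜 W (imCls K))) e1
  rw [← map_smul] at e2
  exact (classShift_injective _ e2).symm

theorem classProj_mul_congr_left (h𝒜 : IsHereditary 𝒜) {M M' : PeriodicComplex 𝒜 t} (h : clsIdx M = clsIdx M')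
    (L : PeriodicComplex 𝒜 t) :
    classProj 𝒜 t (HallAlgebra.of M * HallAlgebra.of L) =
      classProj 𝒜 t (HallAlgebra.of M' * HallAlgebra.of L) := by
  have h1 : imCls M = imCls M' := congrArg Prod.fst h
  rw [classProj_mul_eq_left h𝒜, classProj_mul_eq_left h𝒜 M', h1,
    of_zeroDiff_homology_eq (congrArg Prod.snd h : homCls M = homCls M')]

/-- First `L` is replaced by its homology, at the cost of a scalar involving only the `K₀`-classes
of the objects of `M`, which the invariants determine. Then `M` is replaced by its homology. -/
theorem classProj_mul_congr_right (h𝒜 : IsHereditary 𝒜) (L : PeriodicComplex 𝒜 t) {M M' : PeriodicComplex 𝒜 t}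
    (h : clsIdx M = clsIdx M') :
    classProj 𝒜 t (HallAlgebra.of L * HallAlgebra.of M) =
      classProj 𝒜 t (HallAlgebra.of L * HallAlgebra.of M') := by
  have h1 : imCls M = imCls M' := congrArg Prod.fst h
  have h2 : homCls M = homCls M' := congrArg Prod.snd h
  have h3 : eulerLeft h𝒜 (imCls L) M = eulerLeft h𝒜 (imCls L) M' :=
    Finset.prod_congr rfl fun i _ => by rw [K₀_of_X_eq_of_class h1 h2]
  rw [classProj_mul_eq_left h𝒜, classProj_mul_eq_left h𝒜 L, h3, classProj_mul_eq_right h𝒜,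
    classProj_mul_eq_right h𝒜 _ M', h1, of_zeroDiff_homology_eq h2]

end ClassProjection

/-! ### The quotient by `J` embeds into the span of the invariants -/

section Quotient
variable {𝒜 : Type u} [Category.{v} 𝒜] [Abelian 𝒜] {t : ℕ}

/-- A linear map with prescribed values at the invariants. -/
theorem exists_linearMap_of_clsIdx {V : Type*} [AddCommGroup V] [Module ℚ V]
    (φ : PeriodicComplex 𝒜 t → V) (h : ∀ M M', clsIdx M = clsIdx M' → φ M = φ M') :
    ∃ ψ : (ClassIndex 𝒜 t →₀ ℚ) →ₗ[ℚ] V, ∀ M, ψ (Finsupp.single (clsIdx M) 1) = φ M := by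
  classical
  -- Indices that are not the invariants of any complex are sent to `0`; they exist in general
  -- because the class of an image is the class of an object.
  refine ⟨Finsupp.linearCombination ℚ fun x => if h : ∃ M, clsIdx M = x then φ h.choose else 0,
    fun M => ?_⟩
  have hM : ∃ M', clsIdx M' = clsIdx M := ⟨M, rfl⟩
  rw [Finsupp.linearCombination_single, one_smul, dif_pos hM]
  exact h _ _ hM.choose_spec

theorem clsIdx_biprod_of_acyclic {K : PeriodicComplex 𝒜 t} (hK : K.Acyclic)
    (L : PeriodicComplex 𝒜 t) : clsIdx (K ⊞ L) = (imCls K + imCls L, homCls L) := by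
  have h := isSES_biprod_inl_snd L K
  rw [clsIdx, h.imCls_of_acyclic_left hK, h.homCls_of_acyclic_left hK, add_comm]

variable [NeZero t] [FinitaryCategory 𝒜] (h𝒜 : IsHereditary 𝒜)

theorem HallAlgebra.induction_of {C : Type u} [Category.{v} C] [Abelian C]
    {p : HallAlgebra C → Prop} (x : HallAlgebra C) (zero : p 0)
    (add : ∀ x y, p x → p y → p (x + y)) (smul : ∀ (r : ℚ) (X : C), p (r • HallAlgebra.of X)) :
    p x := by
  induction x using Finsupp.induction_linear with
  | zero => exact zero
  | add x y hx hy => exact add x y hx hy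
  | single a r =>
    have h := smul r a.out
    have e : (r • HallAlgebra.of a.out : HallAlgebra C) = Finsupp.single a r := by
      change (r • Finsupp.single (isoClass a.out) (1 : ℚ) : IsoClass C →₀ ℚ) = _
      rw [Finsupp.smul_single, smul_eq_mul, mul_one, isoClass, Quotient.out_eq]
    exact e ▸ h

theorem HallAlgebra.linearMap_ext {C : Type u} [Category.{v} C] [Abelian C] {V : Type*}
    [AddCommGroup V] [Module ℚ V] {f g : HallAlgebra C →ₗ[ℚ] V}
    (h : ∀ X, f (HallAlgebra.of X) = g (HallAlgebra.of X)) : f = g := by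
  refine LinearMap.ext fun x => ?_
  induction x using HallAlgebra.induction_of with
  | zero => simp
  | add x y hx hy => rw [map_add, map_add, hx, hy]
  | smul r X => rw [map_smul, map_smul, h]

/-- Right multiplication by `[L]`, followed by `classProj`, factors through `classProj`. -/
theorem classProj_mul_eq_zero_left (h𝒜 : IsHereditary 𝒜)
    (x y : HallAlgebra (PeriodicComplex 𝒜 t)) (hx : classProj 𝒜 t x = 0) :
    classProj 𝒜 t (x * y) = 0 := by
  induction y using HallAlgebra.induction_of with
  | zero => simp
  | add y z hy hz => rw [mul_add, map_add, hy, hz, add_zero]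
  | smul r L =>
    obtain ⟨ψ, hψ⟩ := exists_linearMap_of_clsIdx
      (fun M : PeriodicComplex 𝒜 t => classProj 𝒜 t (HallAlgebra.of M * HallAlgebra.of L))
      fun M M' h => classProj_mul_congr_left h𝒜 h L
    have : classProj 𝒜 t ∘ₗ LinearMap.mulRight ℚ (HallAlgebra.of L) = ψ ∘ₗ classProj 𝒜 t :=
      HallAlgebra.linearMap_ext fun M => by
        simp [classProj_of, hψ]
    have := LinearMap.congr_fun this x
    simp only [LinearMap.comp_apply, LinearMap.mulRight_apply, hx, map_zero] at this
    rw [mul_smul_comm, map_smul, this, smul_zero]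

theorem classProj_mul_eq_zero_right (h𝒜 : IsHereditary 𝒜)
    (x y : HallAlgebra (PeriodicComplex 𝒜 t)) (hy : classProj 𝒜 t y = 0) :
    classProj 𝒜 t (x * y) = 0 := by
  induction x using HallAlgebra.induction_of with
  | zero => simp
  | add x z hx hz => rw [add_mul, map_add, hx, hz, add_zero]
  | smul r L =>
    obtain ⟨ψ, hψ⟩ := exists_linearMap_of_clsIdx
      (fun M : PeriodicComplex 𝒜 t => classProj 𝒜 t (HallAlgebra.of L * HallAlgebra.of M))
      fun M M' h => classProj_mul_congr_right h𝒜 L h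
    have : classProj 𝒜 t ∘ₗ LinearMap.mulLeft ℚ (HallAlgebra.of L) = ψ ∘ₗ classProj 𝒜 t :=
      HallAlgebra.linearMap_ext fun M => by
        simp [classProj_of, hψ]
    have := LinearMap.congr_fun this y
    simp only [LinearMap.comp_apply, LinearMap.mulLeft_apply, hy, map_zero] at this
    rw [smul_mul_assoc, map_smul, this, smul_zero]

/-- The kernel of `classProj` is a two-sided ideal and contains the generators of `J`. -/
theorem classProj_eq_zero_of_mem_hallIdeal (h𝒜 : IsHereditary 𝒜)
    {x : HallAlgebra (PeriodicComplex 𝒜 t)} (hx : x ∈ hallIdeal 𝒜 t) : classProj 𝒜 t x = 0 := by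
  let I : TwoSidedIdeal (HallAlgebra (PeriodicComplex 𝒜 t)) :=
    TwoSidedIdeal.mk' {x | classProj 𝒜 t x = 0} (map_zero _)
      (fun {x y} hx hy => by
        change classProj 𝒜 t (x + y) = 0
        rw [map_add, hx, hy, add_zero])
      (fun {x} hx => by
        change classProj 𝒜 t (-x) = 0
        rw [map_neg, hx, neg_zero])
      (fun {x y} hy => classProj_mul_eq_zero_right h𝒜 x y hy)
      (fun {x y} hx => classProj_mul_eq_zero_left h𝒜 x y hx)
  have hI : hallIdeal 𝒜 t ≤ I := by
    refine TwoSidedIdeal.span_le.2 ?_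
    rintro _ ⟨M, N, h, rfl⟩
    obtain ⟨h1, h2⟩ := sameClass_iff.1 h
    refine (TwoSidedIdeal.mem_mk' _ _ _ _ _ _ _).2 ?_
    change classProj 𝒜 t (HallAlgebra.of M - HallAlgebra.of N) = 0
    rw [map_sub, classProj_of, classProj_of, clsIdx, clsIdx, h1, h2, sub_self]
  exact (TwoSidedIdeal.mem_mk' {x | classProj 𝒜 t x = 0} _ _ _ _ _ x).1 (hI hx)

/-- The class of a complex in the quotient of the Ringel–Hall algebra. -/
noncomputable def quotOf (M : PeriodicComplex 𝒜 t) : HallQuotient 𝒜 t :=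
  ((HallAlgebra.of M : HallAlgebra (PeriodicComplex 𝒜 t)) : HallQuotient 𝒜 t)

/-- The projection of the quotient of the Ringel–Hall algebra to the space of invariants. -/
noncomputable def quotProj : HallQuotient 𝒜 t →ₗ[ℚ] (ClassIndex 𝒜 t →₀ ℚ) where
  toFun := Quotient.lift (classProj 𝒜 t) fun x y h => sub_eq_zero.1 (by
    rw [← map_sub]
    exact classProj_eq_zero_of_mem_hallIdeal h𝒜 ((TwoSidedIdeal.rel_iff _ x y).1 h))
  map_add' := by
    rintro ⟨x⟩ ⟨y⟩
    exact map_add (classProj 𝒜 t) x y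
  map_smul' := by
    rintro r ⟨x⟩
    exact map_smul (classProj 𝒜 t) r x

theorem quotProj_quotOf (M : PeriodicComplex 𝒜 t) :
    quotProj h𝒜 (quotOf M) = Finsupp.single (clsIdx M) 1 := classProj_of M

theorem quotOf_eq_of_clsIdx {M M' : PeriodicComplex 𝒜 t} (h : clsIdx M = clsIdx M') :
    quotOf M = quotOf M' := by
  refine (RingCon.eq _).2 ((TwoSidedIdeal.rel_iff _ _ _).2 (TwoSidedIdeal.subset_span
    ⟨M, M', sameClass_iff.2 ⟨congrArg Prod.fst h, congrArg Prod.snd h⟩, rfl⟩))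

theorem HallQuotient.induction_of {p : HallQuotient 𝒜 t → Prop} (x : HallQuotient 𝒜 t)
    (zero : p 0) (add : ∀ x y, p x → p y → p (x + y))
    (smul : ∀ (r : ℚ) (M : PeriodicComplex 𝒜 t), p (r • quotOf M)) : p x := by
  obtain ⟨x, rfl⟩ := Quotient.exists_rep x
  change p ((x : HallAlgebra (PeriodicComplex 𝒜 t)) : HallQuotient 𝒜 t)
  induction x using HallAlgebra.induction_of with
  | zero => exact zero
  | add x y hx hy => exact add _ _ hx hy
  | smul r M => exact smul r M

/-- Complexes with equal invariants have equal classes in the quotient, so sending invariants back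
to the class of such a complex is a left inverse. -/
theorem quotProj_injective : Function.Injective (quotProj (t := t) h𝒜) := by
  obtain ⟨ψ, hψ⟩ := exists_linearMap_of_clsIdx (quotOf (𝒜 := 𝒜) (t := t))
    fun M M' h => quotOf_eq_of_clsIdx h
  refine Function.LeftInverse.injective (g := ψ) fun x => ?_
  induction x using HallQuotient.induction_of with
  | zero => simp
  | add x y hx hy => rw [map_add, map_add, hx, hy]
  | smul r M => rw [map_smul, map_smul, quotProj_quotOf, hψ]

attribute [local instance] HasExt.standard

theorem ext_zero_left {C : Type u} [Category.{v} C] [Abelian C] {X Y : C} (h : IsZero X)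
    (a b : Ext1 X Y) : a = b := by
  have : ∀ a : Ext1 X Y, a = 0 := fun a => by
    rw [← Abelian.Ext.mk₀_id_comp a, h.eq_of_src (𝟙 _) 0, Abelian.Ext.mk₀_zero,
      Abelian.Ext.zero_comp]
  rw [this a, this b]

theorem ext_zero_right {C : Type u} [Category.{v} C] [Abelian C] {X Y : C} (h : IsZero Y)
    (a b : Ext1 X Y) : a = b := by
  have : ∀ a : Ext1 X Y, a = 0 := fun a => by
    rw [← Abelian.Ext.comp_mk₀_id a, h.eq_of_src (𝟙 _) 0, Abelian.Ext.mk₀_zero,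
      Abelian.Ext.comp_zero]
  rw [this a, this b]

/-- The product with the class of an acyclic complex on the left. -/
theorem quotOf_mul_quotOf_left (h𝒜 : IsHereditary 𝒜) {K : PeriodicComplex 𝒜 t} (hK : K.Acyclic)
    (L : PeriodicComplex 𝒜 t) :
    quotOf K * quotOf L = (eulerForm K L)⁻¹ • quotOf (K ⊞ L) := by
  have z := isZero_zero (PeriodicComplex 𝒜 t)
  -- The comparison is applied to the subobject `0` of `K`, with acyclic quotient `K`; the class of
  -- `0` is the unit of the Hall algebra.
  have h := (isSES_of_iso (Iso.refl K)).map_mul_of_left (classProj 𝒜 t) (classShift (imCls K)) L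
    (fun ξ => ⟨0, ext_zero_left z _ _⟩) fun hX => hX.classProj_of_acyclic_right hK
  apply quotProj_injective h𝒜
  rw [map_smul, quotProj_quotOf]
  refine h.trans ?_
  have : (HallAlgebra.of 0 * HallAlgebra.of L : HallAlgebra (PeriodicComplex 𝒜 t)) =
    HallAlgebra.of L := one_mul _
  rw [this, classProj_of, classShift_single, clsIdx_biprod_of_acyclic hK, add_comm (imCls K)]
  rfl

/-- The product with the class of an acyclic complex on the right. -/
theorem quotOf_mul_quotOf_right (h𝒜 : IsHereditary 𝒜) {K : PeriodicComplex 𝒜 t}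
    (hK : K.Acyclic) (L : PeriodicComplex 𝒜 t) :
    quotOf L * quotOf K = (eulerForm L K)⁻¹ • quotOf (K ⊞ L) := by
  have z := isZero_zero (PeriodicComplex 𝒜 t)
  have hs : IsSES (𝟙 K) (0 : K ⟶ (0 : PeriodicComplex 𝒜 t)) := by
    have : Epi (0 : K ⟶ (0 : PeriodicComplex 𝒜 t)) := ⟨fun _ _ _ => z.eq_of_src _ _⟩
    exact IsSES.of_mono_epi (by simp) fun k _ => ⟨k, by simp⟩
  have h := hs.map_mul_of_right (classProj 𝒜 t) (classShift (imCls K)) L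
    (fun ξ => ⟨0, ext_zero_right z _ _⟩) fun hX => hX.classProj_of_acyclic_left hK
  apply quotProj_injective h𝒜
  rw [map_smul, quotProj_quotOf]
  refine h.trans ?_
  have : (HallAlgebra.of L * HallAlgebra.of 0 : HallAlgebra (PeriodicComplex 𝒜 t)) =
    HallAlgebra.of L := mul_one _
  rw [this, classProj_of, classShift_single, clsIdx_biprod_of_acyclic hK, add_comm (imCls K)]
  rfl

theorem quotOf_comm (h𝒜 : IsHereditary 𝒜) {K : PeriodicComplex 𝒜 t} (hK : K.Acyclic)
    (L : PeriodicComplex 𝒜 t) :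
    quotOf K * quotOf L = (eulerForm L K / eulerForm K L) • (quotOf L * quotOf K) := by
  rw [quotOf_mul_quotOf_left h𝒜 hK, quotOf_mul_quotOf_right h𝒜 hK, smul_smul, div_mul_eq_mul_div,
    mul_inv_cancel₀ (eulerForm_ne_zero L K), one_div]

/-- For a general `L` the number `⟨L, K⟩` is not computed from a formula but read off as the
coefficient in the product `[L] * [K]`. -/
theorem eulerForm_congr_left (h𝒜 : IsHereditary 𝒜) {K : PeriodicComplex 𝒜 t} (hK : K.Acyclic)
    {L L' : PeriodicComplex 𝒜 t} (h : clsIdx L = clsIdx L') : eulerForm L K = eulerForm L' K := by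
  have h1 := quotOf_mul_quotOf_right h𝒜 hK L
  have h2 := quotOf_mul_quotOf_right h𝒜 hK L'
  have h3 : clsIdx (K ⊞ L) = clsIdx (K ⊞ L') := by
    rw [clsIdx_biprod_of_acyclic hK, clsIdx_biprod_of_acyclic hK]
    exact Prod.ext (by rw [show imCls L = imCls L' from congrArg Prod.fst h])
      (show homCls L = homCls L' from congrArg Prod.snd h)
  rw [quotOf_eq_of_clsIdx h, h2, quotOf_eq_of_clsIdx h3] at h1
  have h4 := congrArg (fun x => quotProj h𝒜 x (clsIdx (K ⊞ L'))) h1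
  simp only [map_smul, quotProj_quotOf, Finsupp.smul_apply, Finsupp.single_eq_same, smul_eq_mul,
    mul_one] at h4
  exact (inv_injective h4).symm

end Quotient

/-! ### The Ore condition and left fractions -/

section OreSets
variable {𝒜 : Type u} [Category.{v} 𝒜] [Abelian 𝒜] {t : ℕ}

theorem acyclic_biprod {K L : PeriodicComplex 𝒜 t} (hK : K.Acyclic) (hL : L.Acyclic) :
    (K ⊞ L).Acyclic := by
  have := congrArg Prod.snd (clsIdx_biprod_of_acyclic hK L)
  exact acyclic_iff_homCls.2 (Eq.trans this (homCls_eq_of_acyclic hL))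

theorem clsIdx_biprod_injective {K : PeriodicComplex 𝒜 t} (hK : K.Acyclic)
    {L M : PeriodicComplex 𝒜 t} : clsIdx (K ⊞ L) = clsIdx (K ⊞ M) ↔ clsIdx L = clsIdx M := by
  rw [clsIdx_biprod_of_acyclic hK, clsIdx_biprod_of_acyclic hK, clsIdx, clsIdx, Prod.ext_iff,
    Prod.ext_iff, add_right_inj]

variable [NeZero t] [FinitaryCategory 𝒜]

theorem quotProj_eq_zero_of_not_mem_range (h𝒜 : IsHereditary 𝒜) (x : HallQuotient 𝒜 t)
    {c : ClassIndex 𝒜 t} (hc : ∀ M : PeriodicComplex 𝒜 t, clsIdx M ≠ c) :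
    quotProj h𝒜 x c = 0 := by
  induction x using HallQuotient.induction_of with
  | zero => simp
  | add x y hx hy => rw [map_add, Finsupp.add_apply, hx, hy, add_zero]
  | smul r M =>
    rw [map_smul, quotProj_quotOf, Finsupp.smul_apply, Finsupp.single_eq_of_ne (hc M).symm,
      smul_zero]

/-- A linear map which multiplies the classes with nonzero scalars and translates them by the
class of an acyclic complex is injective. -/
theorem eq_zero_of_twist (h𝒜 : IsHereditary 𝒜) {K : PeriodicComplex 𝒜 t} (hK : K.Acyclic)
    (F : HallQuotient 𝒜 t →ₗ[ℚ] HallQuotient 𝒜 t) (χ : PeriodicComplex 𝒜 t → ℚ)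
    (hχ : ∀ L, χ L ≠ 0) (hc : ∀ L L', clsIdx L = clsIdx L' → χ L = χ L')
    (hF : ∀ L, F (quotOf L) = χ L • quotOf (K ⊞ L)) (x : HallQuotient 𝒜 t) (hx : F x = 0) :
    x = 0 := by
  classical
  -- Adding `K` is injective on invariants, so no two terms of `x` can cancel in `F x`.
  have key : ∀ (M : PeriodicComplex 𝒜 t) (x : HallQuotient 𝒜 t),
      quotProj h𝒜 (F x) (clsIdx (K ⊞ M)) = χ M * quotProj h𝒜 x (clsIdx M) := by
    intro M x
    induction x using HallQuotient.induction_of with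
    | zero => simp
    | add x y hx hy => simp only [map_add, Finsupp.add_apply, hx, hy, mul_add]
    | smul r L =>
      simp only [map_smul, hF, quotProj_quotOf, Finsupp.smul_apply, Finsupp.single_apply,
        clsIdx_biprod_injective hK, smul_eq_mul]
      split_ifs with h
      · rw [hc L M h]
        ring
      · simp
  apply quotProj_injective h𝒜
  rw [map_zero]
  ext c
  by_cases h : ∃ M, clsIdx M = c
  · obtain ⟨M, rfl⟩ := h
    have := key M x
    rw [hx, map_zero, Finsupp.zero_apply, eq_comm, mul_eq_zero] at this
    exact this.resolve_left (hχ M)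
  · exact quotProj_eq_zero_of_not_mem_range h𝒜 x (not_exists.1 h)

theorem eulerForm_congr_right (h𝒜 : IsHereditary 𝒜) {K : PeriodicComplex 𝒜 t} (hK : K.Acyclic)
    {L L' : PeriodicComplex 𝒜 t} (h : clsIdx L = clsIdx L') : eulerForm K L = eulerForm K L' := by
  rw [eulerForm_of_acyclic h𝒜 hK, eulerForm_of_acyclic h𝒜 hK]
  exact Finset.prod_congr rfl fun i _ => by
    rw [K₀_of_X_eq_of_class (congrArg Prod.fst h) (congrArg Prod.snd h)]

theorem eq_zero_of_quotOf_mul (h𝒜 : IsHereditary 𝒜) {K : PeriodicComplex 𝒜 t} (hK : K.Acyclic)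
    (x : HallQuotient 𝒜 t) (hx : quotOf K * x = 0) : x = 0 :=
  eq_zero_of_twist h𝒜 hK (LinearMap.mulLeft ℚ (quotOf K)) (fun L => (eulerForm K L)⁻¹)
    (fun L => inv_ne_zero (eulerForm_ne_zero K L))
    (fun _ _ h => congrArg _ (eulerForm_congr_right h𝒜 hK h))
    (fun L => quotOf_mul_quotOf_left h𝒜 hK L) x hx

theorem eq_zero_of_mul_quotOf (h𝒜 : IsHereditary 𝒜) {K : PeriodicComplex 𝒜 t} (hK : K.Acyclic)
    (x : HallQuotient 𝒜 t) (hx : x * quotOf K = 0) : x = 0 :=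
  eq_zero_of_twist h𝒜 hK (LinearMap.mulRight ℚ (quotOf K)) (fun L => (eulerForm L K)⁻¹)
    (fun L => inv_ne_zero (eulerForm_ne_zero L K))
    (fun _ _ h => congrArg _ (eulerForm_congr_left h𝒜 hK h))
    (fun L => quotOf_mul_quotOf_right h𝒜 hK L) x hx

/-- `[K]` commutes with every `[L]` up to a scalar depending on `L`; `y` is `x` with its terms
rescaled accordingly. -/
theorem exists_quotOf_mul_eq (h𝒜 : IsHereditary 𝒜) {K : PeriodicComplex 𝒜 t} (hK : K.Acyclic)
    (x : HallQuotient 𝒜 t) : ∃ y, quotOf K * x = y * quotOf K := by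
  induction x using HallQuotient.induction_of with
  | zero => exact ⟨0, by simp⟩
  | add x y hx hy =>
    obtain ⟨x', hx⟩ := hx
    obtain ⟨y', hy⟩ := hy
    exact ⟨x' + y', by rw [mul_add, add_mul, hx, hy]⟩
  | smul r L =>
    exact ⟨(r * (eulerForm L K / eulerForm K L)) • quotOf L, by
      rw [mul_smul_comm, quotOf_comm h𝒜 hK, smul_mul_assoc, smul_smul]⟩

/-- The multiplicative set of the classes of acyclic complexes. -/
def acyclicSubmonoid (h𝒜 : IsHereditary 𝒜) : Submonoid (HallQuotient 𝒜 t) where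
  carrier := acyclicClasses 𝒜 t
  one_mem' := ⟨1, 0, one_ne_zero, acyclic_zero, (one_smul _ _).symm⟩
  mul_mem' := by
    rintro _ _ ⟨r, K, hr, hK, rfl⟩ ⟨s, L, hs, hL, rfl⟩
    refine ⟨r * s * (eulerForm K L)⁻¹, K ⊞ L,
      mul_ne_zero (mul_ne_zero hr hs) (inv_ne_zero (eulerForm_ne_zero K L)), acyclic_biprod hK hL,
      ?_⟩
    change (r • quotOf K) * (s • quotOf L) = _ • quotOf (K ⊞ L)
    rw [smul_mul_smul_comm, quotOf_mul_quotOf_left h𝒜 hK, smul_smul]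

/-- The Ore condition for the classes of acyclic complexes. -/
noncomputable abbrev acyclicOreSet (h𝒜 : IsHereditary 𝒜) :
    OreLocalization.OreSet (acyclicSubmonoid (t := t) h𝒜) :=
  have key : ∀ (r : HallQuotient 𝒜 t) (s : acyclicSubmonoid (t := t) h𝒜), ∃ y, s * r = y * s := by
    rintro x ⟨_, r, K, hr, hK, rfl⟩
    obtain ⟨y, hy⟩ := exists_quotOf_mul_eq h𝒜 hK x
    refine ⟨y, ?_⟩
    change (r • quotOf K) * x = y * (r • quotOf K)
    rw [smul_mul_assoc, mul_smul_comm, hy]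
  { ore_right_cancel := by
      rintro x y ⟨_, r, K, hr, hK, rfl⟩ h
      -- Classes of acyclic complexes are right regular, so no further factor is needed.
      refine ⟨1, ?_⟩
      change x * (r • quotOf K) = y * (r • quotOf K) at h
      rw [mul_smul_comm, mul_smul_comm] at h
      have h' := smul_right_injective _ hr h
      change x * quotOf K = y * quotOf K at h'
      rw [← sub_eq_zero, ← sub_mul] at h'
      rw [sub_eq_zero.1 (eq_zero_of_mul_quotOf h𝒜 hK _ h')]
    oreNum := fun r s => (key r s).choose
    -- Commutation up to scalars lets the denominator be moved across unchanged.
    oreDenom := fun _ s => s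
    ore_eq := fun r s => (key r s).choose_spec }

/-- The quotient of the Ringel–Hall algebra embeds into the semi-derived Ringel–Hall algebra. -/
theorem map_injective (h𝒜 : IsHereditary 𝒜) :
    Function.Injective (NCLocalization.map (HallQuotient 𝒜 t) (acyclicClasses 𝒜 t)) := by
  let := acyclicOreSet (t := t) h𝒜
  let f : HallQuotient 𝒜 t →ₐ[ℚ] OreLocalization (acyclicSubmonoid (t := t) h𝒜)
      (HallQuotient 𝒜 t) :=
    { (OreLocalization.numeratorRingHom : HallQuotient 𝒜 t →+* OreLocalization
        (acyclicSubmonoid (t := t) h𝒜) (HallQuotient 𝒜 t)) with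
      commutes' := fun r => rfl }
  have hf : Function.Injective f := OreLocalization.numeratorHom_inj (by
    rintro _ ⟨r, K, hr, hK, rfl⟩ x hx
    change (r • quotOf K) * x = 0 at hx
    rw [smul_mul_assoc] at hx
    exact eq_zero_of_quotOf_mul h𝒜 hK x ((smul_eq_zero.1 hx).resolve_left hr))
  obtain ⟨g, hg, -⟩ := NCLocalization.existsUnique_lift _ (acyclicClasses 𝒜 t) f
    fun s hs => OreLocalization.numerator_isUnit (⟨s, hs⟩ : acyclicSubmonoid (t := t) h𝒜)
  -- The universal localization maps to the Ore localization, where the numerator map is injective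
  -- because the denominators are regular.
  refine Function.Injective.of_comp (f := g) ?_
  have : g ∘ NCLocalization.map (HallQuotient 𝒜 t) (acyclicClasses 𝒜 t) = f :=
    funext fun x => DFunLike.congr_fun hg x
  rw [this]
  exact hf

/-- Every element of the semi-derived Ringel–Hall algebra is a left fraction. -/
theorem exists_cls_mul_eq_map (h𝒜 : IsHereditary 𝒜) (x : SemiDerivedHallAlgebra 𝒜 t) :
    ∃ (K : PeriodicComplex 𝒜 t) (y : HallQuotient 𝒜 t), K.Acyclic ∧
      cls K * x = NCLocalization.map (HallQuotient 𝒜 t) (acyclicClasses 𝒜 t) y := by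
  let := acyclicOreSet (t := t) h𝒜
  let m := NCLocalization.map (HallQuotient 𝒜 t) (acyclicClasses 𝒜 t)
  let f : HallQuotient 𝒜 t →ₐ[ℚ] OreLocalization (acyclicSubmonoid (t := t) h𝒜)
      (HallQuotient 𝒜 t) :=
    { (OreLocalization.numeratorRingHom : HallQuotient 𝒜 t →+* OreLocalization
        (acyclicSubmonoid (t := t) h𝒜) (HallQuotient 𝒜 t)) with
      commutes' := fun r => rfl }
  obtain ⟨g, hg, -⟩ := NCLocalization.existsUnique_lift _ (acyclicClasses 𝒜 t) f
    fun s hs => OreLocalization.numerator_isUnit (⟨s, hs⟩ : acyclicSubmonoid (t := t) h𝒜)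
  have hu : ∀ s : acyclicSubmonoid (t := t) h𝒜, IsUnit (m s) := fun s =>
    NCLocalization.isUnit_map (HallQuotient 𝒜 t) (acyclicClasses 𝒜 t) ⟨s.1, s.2⟩
  let U : acyclicSubmonoid (t := t) h𝒜 →* (SemiDerivedHallAlgebra 𝒜 t)ˣ :=
    { toFun := fun s => (hu s).unit
      map_one' := Units.ext (map_one m)
      map_mul' := fun a b => Units.ext (map_mul m a.1 b.1) }
  let k := OreLocalization.universalHom (m : HallQuotient 𝒜 t →+* SemiDerivedHallAlgebra 𝒜 t) U
    fun s => rfl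
  have hk : ∀ y, k (f y) = m y := fun y => OreLocalization.universalHom_commutes _ _ _
  -- By the universal property, passing to the Ore localization and back is the identity. So `x` is
  -- the image under `k` of an Ore fraction.
  have hkg : (k.comp (g : _ →+* _)).toRatAlgHom = AlgHom.id ℚ _ := by
    refine (NCLocalization.existsUnique_lift _ (acyclicClasses 𝒜 t) m
      fun s hs => NCLocalization.isUnit_map (HallQuotient 𝒜 t) (acyclicClasses 𝒜 t)
        ⟨s, hs⟩).unique ?_ ?_
    · refine AlgHom.ext fun (y : HallQuotient 𝒜 t) => ?_
      exact (congrArg k (DFunLike.congr_fun hg y)).trans (hk y)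
    · exact AlgHom.ext fun _ => rfl
  have hx : k (g x) = x := DFunLike.congr_fun hkg x
  generalize g x = z at hx
  induction z using OreLocalization.ind with | _ y s
  obtain ⟨s, r, K, hr, hK, rfl⟩ := s
  refine ⟨K, r⁻¹ • y, hK, ?_⟩
  have e : m (r • quotOf K) * x = m y := by
    rw [← hx]
    exact Units.mul_inv_cancel_left (hu ⟨_, r, K, hr, hK, rfl⟩).unit (m y)
  rw [map_smul, smul_mul_assoc] at e
  change m (quotOf K) * x = m (r⁻¹ • y)
  rw [map_smul, ← e, smul_smul, inv_mul_cancel₀ hr, one_smul]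

end OreSets

/-! ### Invariants of sums of stalks and of the complexes `K_{X,i}` -/

section Stalks
variable {𝒜 : Type u} [Category.{v} 𝒜] [Abelian 𝒜] {t : ℕ}

open HomologicalComplex

/-- The complex with zero differential as a sum of stalk complexes. -/
noncomputable def stalkBicone (A : ZMod t → 𝒜) : Bicone fun i : ZMod t => stalk (A i) i where
  pt := zeroDiff A
  π i := mkHomToSingle (K := zeroDiff A) (𝟙 (A i)) (by simp)
  ι i := mkHomFromSingle (K := zeroDiff A) (𝟙 (A i)) (by simp)
  ι_π i j := by
    split_ifs with h
    · subst h
      refine from_single_hom_ext ?_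
      rw [comp_f, mkHomFromSingle_f, mkHomToSingle_f, eqToHom_refl, id_f]
      simp
    · exact from_single_hom_ext ((isZero_single_obj_X _ j (A j) i h).eq_of_tgt _ _)

theorem K₀_of_disk_X (X : 𝒜) (i : ZMod t) :
    K₀.of ((disk X i).X (i - 1)) = (if t = 1 then 2 else 1) • K₀.of X := by
  by_cases ht : t = 1
  · rw [if_pos ht, two_smul, disk, dif_pos ht]
    exact (isSES_biprod_inl_snd X X).K₀_of
  · rw [if_neg ht, one_smul, disk, dif_neg ht]
    exact K₀.of_eq_of_iso (doubleXIso₀ _ _)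

variable [NeZero t]

theorem stalkBicone_total (A : ZMod t → 𝒜) :
    ∑ i, (stalkBicone A).π i ≫ (stalkBicone A).ι i = 𝟙 (stalkBicone A).pt := by
  refine HomologicalComplex.hom_ext _ _ fun j => ?_
  have e : (∑ i, (stalkBicone A).π i ≫ (stalkBicone A).ι i).f j =
      ∑ i, ((stalkBicone A).π i ≫ (stalkBicone A).ι i).f j :=
    map_sum (AddMonoidHom.mk' (fun φ : zeroDiff A ⟶ zeroDiff A => φ.f j) fun _ _ => rfl) _ _
  rw [e, Finset.sum_eq_single j]
  · rw [comp_f]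
    change (mkHomToSingle (K := zeroDiff A) (𝟙 (A j)) (by simp)).f j ≫
      (mkHomFromSingle (K := zeroDiff A) (𝟙 (A j)) (by simp)).f j = 𝟙 (A j)
    rw [mkHomFromSingle_f, mkHomToSingle_f]
    simp
  · intro i _ hij
    exact (comp_f _ _ _).trans
      (by rw [(isZero_single_obj_X _ i (A i) j hij.symm).eq_of_tgt
        (((stalkBicone A).π i).f j) 0, zero_comp])
  · simp

theorem clsIdx_stalkSum (A : ZMod t → 𝒜) :
    clsIdx (stalkSum A) = (0, fun i => isoClass (A i)) := by
  have : HasFiniteBiproducts (PeriodicComplex 𝒜 t) := Abelian.hasFiniteBiproducts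
  have e : stalkSum A ≅ zeroDiff A := (biproduct.uniqueUpToIso (fun i => stalk (A i) i)
    (isBilimitOfTotal (stalkBicone A) (stalkBicone_total A))).symm
  rw [clsIdx_eq_of_iso e, clsIdx, imCls_zeroDiff, homCls_zeroDiff]

/-- The only nonzero image sits in degree `i - 1`, where the identity of `X` starts. For `t = 1`
there is just one degree. -/
theorem imCls_disk (X : 𝒜) (i : ZMod t) : imCls (disk X i) = Pi.single (i - 1) (K₀.of X) := by
  funext j
  by_cases ht : t = 1
  · have : Subsingleton (ZMod t) := by subst ht; exact inferInstanceAs (Subsingleton (Fin 1))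
    obtain rfl : j = i - 1 := Subsingleton.elim _ _
    rw [Pi.single_eq_same, disk, dif_pos ht]
    exact imCls_eq_of_factor _ _ (biprod.snd : X ⊞ X ⟶ X) (biprod.inl : X ⟶ X ⊞ X) rfl
  · have hi : i - 1 ≠ i := by
      have : Fact (1 < t) := ⟨by have := NeZero.ne t; omega⟩
      simp
    have hr : (ComplexShape.up (ZMod t)).Rel (i - 1) i :=
      ComplexShape.up_mk _ _ (sub_add_cancel i 1)
    have hd : disk X i = double (𝟙 X) hr := by rw [disk, dif_neg ht]
    rw [hd]
    by_cases hj : j = i - 1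
    · subst hj
      rw [Pi.single_eq_same]
      have key : ∀ (k : ZMod t) (hk : k = i), K₀.of (image ((double (𝟙 X) hr).d (i - 1) k)) =
          K₀.of X := by
        intro k hk
        obtain rfl := hk.symm
        have : IsIso ((double (𝟙 X) hr).d (i - 1) i) := by
          rw [double_d _ _ hi]
          infer_instance
        exact (K₀.of_eq_of_iso (image.isoStrongEpiMono (𝟙 _) ((double (𝟙 X) hr).d (i - 1) i)
          (Category.id_comp _))).symm.trans (K₀.of_eq_of_iso (doubleXIso₀ (𝟙 X) hr))
      exact key _ (sub_add_cancel i 1)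
    · rw [Pi.single_eq_of_ne hj]
      have hz := double_d_eq_zero₀ (𝟙 X) hr j (j + 1) hj
      have : Mono (0 : (0 : 𝒜) ⟶ (double (𝟙 X) hr).X (j + 1)) :=
        ⟨fun _ _ _ => (isZero_zero 𝒜).eq_of_tgt _ _⟩
      have : Epi (0 : (double (𝟙 X) hr).X j ⟶ (0 : 𝒜)) :=
        ⟨fun _ _ _ => (isZero_zero 𝒜).eq_of_src _ _⟩
      rw [imCls_eq_of_factor _ j (0 : (double (𝟙 X) hr).X j ⟶ (0 : 𝒜)) 0 (by rw [hz, comp_zero]),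
        K₀.of_zero]

variable [FinitaryCategory 𝒜]

/-- Only the factor in degree `i - 1` survives. For `t = 1` the object of the second complex there
is `Y ⊞ Y`, which explains the exponent `2`. -/
theorem eulerForm_disk (h𝒜 : IsHereditary 𝒜) (X Y : 𝒜) (i : ZMod t) :
    eulerForm (disk X i) (disk Y i) = eulerForm X Y ^ (if t = 1 then 2 else 1) := by
  rw [eulerForm_of_acyclic h𝒜 (acyclic_disk X i), Finset.prod_eq_single (i - 1)]
  · rw [imCls_disk, Pi.single_eq_same, K₀_of_disk_X, ← euler_of h𝒜]
    simp only [euler, map_nsmul, toMul_nsmul, Units.val_pow_eq_pow_val]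
  · intro j _ hj
    rw [imCls_disk, Pi.single_eq_of_ne hj, euler_zero_left]
  · simp

end Stalks

/-! ### Fractions with prescribed invariants: independence and spanning -/

section Fractions
variable {𝒜 : Type u} [Category.{v} 𝒜] [Abelian 𝒜] {t : ℕ} [NeZero t] [FinitaryCategory 𝒜]

theorem cls_eq_of_clsIdx {M M' : PeriodicComplex 𝒜 t} (h : clsIdx M = clsIdx M') :
    cls M = cls M' :=
  congrArg (NCLocalization.map _ _) (quotOf_eq_of_clsIdx h)

theorem cls_mul_cls_left (h𝒜 : IsHereditary 𝒜) {K : PeriodicComplex 𝒜 t} (hK : K.Acyclic)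
    (L : PeriodicComplex 𝒜 t) : cls K * cls L = (eulerForm K L)⁻¹ • cls (K ⊞ L) := by
  change NCLocalization.map _ _ (quotOf K) * NCLocalization.map _ _ (quotOf L) =
    _ • NCLocalization.map _ _ (quotOf (K ⊞ L))
  rw [← map_mul, quotOf_mul_quotOf_left h𝒜 hK, map_smul]

/-- `x` is, up to a scalar, the fraction `[P]⁻¹ [M]` where the invariants of `M` are those
of `P`, translated by `c`. -/
def IsFraction (P : PeriodicComplex 𝒜 t) (x : SemiDerivedHallAlgebra 𝒜 t)
    (c : ClassIndex 𝒜 t) : Prop :=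
  ∃ (r : ℚ) (M : PeriodicComplex 𝒜 t), r ≠ 0 ∧ cls P * x = r • cls M ∧
    clsIdx M = (imCls P + c.1, c.2)

/-- Numerator and denominator are multiplied by `[Q]` on the left, which turns both into direct sums
up to scalars. -/
theorem IsFraction.mul_denom (h𝒜 : IsHereditary 𝒜) {P Q : PeriodicComplex 𝒜 t}
    (hQ : Q.Acyclic) {x : SemiDerivedHallAlgebra 𝒜 t} {c : ClassIndex 𝒜 t}
    (h : IsFraction P x c) : IsFraction (Q ⊞ P) x c := by
  obtain ⟨r, M, hr, e, hM⟩ := h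
  refine ⟨eulerForm Q P * r * (eulerForm Q M)⁻¹, Q ⊞ M, mul_ne_zero
    (mul_ne_zero (eulerForm_ne_zero _ _) hr) (inv_ne_zero (eulerForm_ne_zero _ _)), ?_, ?_⟩
  · have h1 : cls (Q ⊞ P) = eulerForm Q P • (cls Q * cls P) := by
      rw [cls_mul_cls_left h𝒜 hQ, smul_smul, mul_inv_cancel₀ (eulerForm_ne_zero _ _), one_smul]
    rw [h1, smul_mul_assoc, mul_assoc, e, mul_smul_comm, cls_mul_cls_left h𝒜 hQ, smul_smul,
      smul_smul]
  · have h1 : imCls (Q ⊞ P) = imCls Q + imCls P :=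
      congrArg Prod.fst (clsIdx_biprod_of_acyclic hQ P)
    have h2 : imCls M = imCls P + c.1 := congrArg Prod.fst hM
    have h3 : homCls M = c.2 := congrArg Prod.snd hM
    rw [clsIdx_biprod_of_acyclic hQ, h1, h2, h3, add_assoc]

theorem IsFraction.of_denom (h𝒜 : IsHereditary 𝒜) {P Q : PeriodicComplex 𝒜 t}
    (hP : P.Acyclic) (hQ : Q.Acyclic) {x : SemiDerivedHallAlgebra 𝒜 t} {c : ClassIndex 𝒜 t}
    (h : IsFraction P x c) : IsFraction (P ⊞ Q) x c := by
  obtain ⟨r, M, hr, e, hM⟩ := h.mul_denom h𝒜 hQ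
  have e1 : imCls (P ⊞ Q) = imCls (Q ⊞ P) := by
    rw [show imCls (P ⊞ Q) = imCls P + imCls Q from congrArg Prod.fst
      (clsIdx_biprod_of_acyclic hP Q), show imCls (Q ⊞ P) = imCls Q + imCls P from
      congrArg Prod.fst (clsIdx_biprod_of_acyclic hQ P), add_comm]
  have e2 : clsIdx (P ⊞ Q) = clsIdx (Q ⊞ P) := Prod.ext e1 (by
    change homCls _ = homCls _
    rw [homCls_eq_of_acyclic (acyclic_biprod hP hQ), homCls_eq_of_acyclic (acyclic_biprod hQ hP)])
  exact ⟨r, M, hr, by rw [cls_eq_of_clsIdx e2, e], by rw [hM, e1]⟩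

/-- The numerator of `x` has zero homology, hence is acyclic, so the denominator of `y` can be moved
across it at the cost of a scalar. -/
theorem IsFraction.mul (h𝒜 : IsHereditary 𝒜) {P Q : PeriodicComplex 𝒜 t}
    (hQ : Q.Acyclic) {x y : SemiDerivedHallAlgebra 𝒜 t} {a : ZMod t → K₀ 𝒜}
    {c : ClassIndex 𝒜 t} (h : IsFraction P x (a, fun _ => isoClass 0)) (h' : IsFraction Q y c) :
    IsFraction (Q ⊞ P) (x * y) (a + c.1, c.2) := by
  obtain ⟨r, M, hr, e, hM⟩ := h
  obtain ⟨s, N, hs, e', hN⟩ := h'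
  have hMa : M.Acyclic := acyclic_iff_homCls.2 (congrArg Prod.snd hM)
  have hM1 : imCls M = imCls P + a := congrArg Prod.fst hM
  have hN1 : imCls N = imCls Q + c.1 := congrArg Prod.fst hN
  have hN2 : homCls N = c.2 := congrArg Prod.snd hN
  have n := fun A B : PeriodicComplex 𝒜 t => eulerForm_ne_zero A B
  have h1 : cls (Q ⊞ P) = eulerForm Q P • (cls Q * cls P) := by
    rw [cls_mul_cls_left h𝒜 hQ, smul_smul, mul_inv_cancel₀ (n _ _), one_smul]
  have h2 : cls Q * cls M = (eulerForm M Q / eulerForm Q M) • (cls M * cls Q) := by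
    change NCLocalization.map _ _ (quotOf Q) * NCLocalization.map _ _ (quotOf M) =
      _ • (NCLocalization.map _ _ (quotOf M) * NCLocalization.map _ _ (quotOf Q))
    rw [← map_mul, ← map_mul, quotOf_comm h𝒜 hQ, map_smul]
  refine ⟨eulerForm Q P * r * (eulerForm M Q / eulerForm Q M) * s * (eulerForm M N)⁻¹, M ⊞ N,
    mul_ne_zero (mul_ne_zero (mul_ne_zero (mul_ne_zero (n _ _) hr) (div_ne_zero (n _ _) (n _ _)))
      hs) (inv_ne_zero (n _ _)), ?_, ?_⟩
  · calc cls (Q ⊞ P) * (x * y) = eulerForm Q P • (cls Q * (cls P * x) * y) := by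
          rw [h1, smul_mul_assoc]
          simp only [mul_assoc]
      _ = (eulerForm Q P * r * (eulerForm M Q / eulerForm Q M)) • (cls M * (cls Q * y)) := by
          rw [e, mul_smul_comm, smul_mul_assoc, h2, smul_mul_assoc, smul_smul, smul_smul,
            mul_assoc (cls M)]
      _ = _ := by
          rw [e', mul_smul_comm, cls_mul_cls_left h𝒜 hMa, smul_smul, smul_smul]
  · have e1 : imCls (Q ⊞ P) = imCls Q + imCls P :=
      congrArg Prod.fst (clsIdx_biprod_of_acyclic hQ P)
    rw [clsIdx_biprod_of_acyclic hMa, hM1, hN1, hN2, e1]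
    refine Prod.ext ?_ rfl
    change imCls P + a + (imCls Q + c.1) = imCls Q + imCls P + (a + c.1)
    abel

theorem cls_zero : cls (0 : PeriodicComplex 𝒜 t) = 1 :=
  map_one (NCLocalization.map (HallQuotient 𝒜 t) (acyclicClasses 𝒜 t))

theorem isFraction_cls (M : PeriodicComplex 𝒜 t) : IsFraction 0 (cls M) (clsIdx M) :=
  ⟨1, M, one_ne_zero, by rw [cls_zero, one_mul, one_smul], by rw [imCls_zero, zero_add]⟩

theorem exists_common_denom (h𝒜 : IsHereditary 𝒜) {I : Type*} {x : I → SemiDerivedHallAlgebra 𝒜 t}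
    {σ : I → ClassIndex 𝒜 t}
    (h : ∀ i, ∃ P : PeriodicComplex 𝒜 t, P.Acyclic ∧ IsFraction P (x i) (σ i)) (s : Finset I) :
    ∃ P : PeriodicComplex 𝒜 t, P.Acyclic ∧ ∀ i ∈ s, IsFraction P (x i) (σ i) := by
  classical
  induction s using Finset.induction_on with
  | empty => exact ⟨0, acyclic_zero, by simp⟩
  | insert i s _ ih =>
    obtain ⟨P, hP, h1⟩ := ih
    obtain ⟨Q, hQ, h2⟩ := h i
    refine ⟨Q ⊞ P, acyclic_biprod hQ hP, fun j hj => ?_⟩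
    rcases Finset.mem_insert.1 hj with rfl | hj
    · exact h2.of_denom h𝒜 hQ hP
    · exact (h1 j hj).mul_denom h𝒜 hQ

/-- Multiplying a relation by a common denominator moves it into the embedded quotient, where the
terms become multiples of classes with pairwise distinct invariants. -/
theorem linearIndependent_of_isFraction (h𝒜 : IsHereditary 𝒜) {I : Type*}
    {x : I → SemiDerivedHallAlgebra 𝒜 t} {σ : I → ClassIndex 𝒜 t} (hσ : Function.Injective σ)
    (h : ∀ i, ∃ P : PeriodicComplex 𝒜 t, P.Acyclic ∧ IsFraction P (x i) (σ i)) :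
    LinearIndependent ℚ x := by
  classical
  rw [linearIndependent_iff']
  intro s f hf i hi
  obtain ⟨P, hP, hs⟩ := exists_common_denom h𝒜 h s
  -- Outside `s` the scalar `1` and the zero complex are placeholders.
  have hs' : ∀ i, ∃ (r : ℚ) (M : PeriodicComplex 𝒜 t), i ∈ s → (r ≠ 0 ∧ cls P * x i = r • cls M ∧
      clsIdx M = (imCls P + (σ i).1, (σ i).2)) := fun i => by
    by_cases hi : i ∈ s
    · obtain ⟨r, M, h⟩ := hs i hi
      exact ⟨r, M, fun _ => h⟩
    · exact ⟨1, 0, fun h => absurd h hi⟩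
  choose r M hM using hs'
  have e : NCLocalization.map (HallQuotient 𝒜 t) (acyclicClasses 𝒜 t)
      (∑ j ∈ s, (f j * r j) • quotOf (M j)) = 0 := by
    have := congrArg (fun z => cls P * z) hf
    simp only [Finset.mul_sum, mul_zero] at this
    rw [map_sum, ← this]
    refine Finset.sum_congr rfl fun j hj => ?_
    rw [map_smul, mul_smul_comm, (hM j hj).2.1, smul_smul]
    rfl
  have e1 := congrArg (fun z => quotProj h𝒜 z (clsIdx (M i)))
    (map_injective h𝒜 (e.trans (map_zero _).symm))
  simp only [map_sum, map_smul, quotProj_quotOf, map_zero, Finsupp.finsetSum_apply,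
    Finsupp.smul_apply, Finsupp.zero_apply] at e1
  rw [Finset.sum_eq_single i] at e1
  · rw [Finsupp.single_eq_same, smul_eq_mul, mul_one, mul_eq_zero] at e1
    exact e1.resolve_right (hM i hi).1
  · intro j hj hji
    rw [Finsupp.single_eq_of_ne, smul_zero]
    rw [(hM i hi).2.2, (hM j hj).2.2]
    intro h0
    obtain ⟨h1, h2⟩ := Prod.mk.inj h0
    exact hji (hσ (Prod.ext (add_left_cancel h1) h2)).symm
  · exact fun h => absurd hi h

theorem span_eq_top_of_isFraction (h𝒜 : IsHereditary 𝒜) {I : Type*}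
    {x : I → SemiDerivedHallAlgebra 𝒜 t} {σ : I → ClassIndex 𝒜 t} (hσ : Function.Surjective σ)
    (h : ∀ i, ∃ P : PeriodicComplex 𝒜 t, P.Acyclic ∧ IsFraction P (x i) (σ i)) :
    Submodule.span ℚ (Set.range x) = ⊤ := by
  rw [eq_top_iff]
  rintro z -
  obtain ⟨K, y, hK, e⟩ := exists_cls_mul_eq_map h𝒜 z
  obtain ⟨k, hk⟩ := isUnit_cls hK
  rw [← hk] at e
  have e' : z = k⁻¹ * NCLocalization.map (HallQuotient 𝒜 t) (acyclicClasses 𝒜 t) y := by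
    rw [← e, Units.inv_mul_cancel_left]
  rw [e']
  clear e e'
  induction y using HallQuotient.induction_of with
  | zero => simp
  | add y y' hy hy' => rw [map_add, mul_add]; exact Submodule.add_mem _ hy hy'
  | smul r M =>
    rw [map_smul, mul_smul_comm]
    refine Submodule.smul_mem _ _ ?_
    change (k⁻¹ : (SemiDerivedHallAlgebra 𝒜 t)ˣ) * cls M ∈ _
    -- These are the invariants that a multiple of `[K]⁻¹ [M]` must have.
    obtain ⟨i, hi⟩ := hσ (imCls M - imCls K, homCls M)
    obtain ⟨P, hP, hx⟩ := h i
    obtain ⟨s, N, hs, h1, h2⟩ := hx.mul_denom h𝒜 hK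
    have c1 : clsIdx N = clsIdx (P ⊞ M) := by
      have e1 : imCls (K ⊞ P) = imCls K + imCls P :=
        congrArg Prod.fst (clsIdx_biprod_of_acyclic hK P)
      rw [h2, hi, clsIdx_biprod_of_acyclic hP, e1]
      refine Prod.ext ?_ rfl
      change imCls K + imCls P + (imCls M - imCls K) = imCls P + imCls M
      abel
    -- The order `[P] [K]` is chosen so that the unit `[P]` cancels on the left against `[P] [M]`.
    have h3 : cls (K ⊞ P) = (eulerForm P K) • (cls P * cls K) := by
      change NCLocalization.map _ _ (quotOf (K ⊞ P)) =
        _ • (NCLocalization.map _ _ (quotOf P) * NCLocalization.map _ _ (quotOf K))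
      rw [← map_mul, quotOf_mul_quotOf_right h𝒜 hK, map_smul, smul_smul,
        mul_inv_cancel₀ (eulerForm_ne_zero _ _), one_smul]
    have h4 : cls (P ⊞ M) = eulerForm P M • (cls P * cls M) := by
      rw [cls_mul_cls_left h𝒜 hP, smul_smul, mul_inv_cancel₀ (eulerForm_ne_zero _ _), one_smul]
    rw [h3, cls_eq_of_clsIdx c1, h4, smul_mul_assoc, mul_assoc, smul_smul, ← hk] at h1
    have h5 : eulerForm P K • (k * x i : SemiDerivedHallAlgebra 𝒜 t) =
        (s * eulerForm P M) • cls M := by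
      apply (isUnit_cls hP).mul_right_injective
      change cls P * _ = cls P * _
      rw [mul_smul_comm, mul_smul_comm, h1]
    have h6 : (k⁻¹ : (SemiDerivedHallAlgebra 𝒜 t)ˣ) * cls M =
        ((s * eulerForm P M)⁻¹ * eulerForm P K) • x i := by
      have h0 : s * eulerForm P M ≠ 0 := mul_ne_zero hs (eulerForm_ne_zero _ _)
      have : cls M = (s * eulerForm P M)⁻¹ • eulerForm P K •
          (k * x i : SemiDerivedHallAlgebra 𝒜 t) := by
        rw [h5, smul_smul, inv_mul_cancel₀ h0, one_smul]
      rw [this, smul_smul, mul_smul_comm, Units.inv_mul_cancel_left]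
    rw [h6]
    exact Submodule.smul_mem _ _ (Submodule.subset_span ⟨i, rfl⟩)

end Fractions

/-! ### The elements `K_{α,i}` and the basis -/

section Generators
variable {𝒜 : Type u} [Category.{v} 𝒜] [Abelian 𝒜] {t : ℕ} [NeZero t]

theorem K₀.of_biprod {C : Type u} [Category.{v} C] [Abelian C] (X Y : C) :
    K₀.of (X ⊞ Y) = K₀.of X + K₀.of Y := by
  exact (isSES_biprod_inl_snd Y X).K₀_of.trans (add_comm _ _)

theorem clsIdx_disk_eq {X X' : 𝒜} (h : K₀.of X = K₀.of X') (i : ZMod t) :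
    clsIdx (disk X i) = clsIdx (disk X' i) :=
  Prod.ext (by change imCls _ = imCls _; rw [imCls_disk, imCls_disk, h]) (by
    change homCls _ = homCls _
    rw [homCls_eq_of_acyclic (acyclic_disk X i), homCls_eq_of_acyclic (acyclic_disk X' i)])

variable [FinitaryCategory 𝒜]

/-- The element `⟨X - Y, Y⟩⁻ᵉ [K_{X,i}] ⋄ [K_{Y,i}]⁻¹`. -/
noncomputable def diskFraction (X Y : 𝒜) (i : ZMod t) : SemiDerivedHallAlgebra 𝒜 t :=
  ((eulerForm X Y / eulerForm Y Y) ^ (if t = 1 then 2 else 1))⁻¹ •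
    (cls (disk X i) * Ring.inverse (cls (disk Y i)))

theorem diskFraction_congr (h𝒜 : IsHereditary 𝒜) {X X' Y Y' : 𝒜} (hX : K₀.of X = K₀.of X')
    (hY : K₀.of Y = K₀.of Y') (i : ZMod t) : diskFraction X Y i = diskFraction X' Y' i := by
  have e : ∀ A B : 𝒜, eulerForm A B = euler h𝒜 (K₀.of A) (K₀.of B) := fun A B =>
    (euler_of h𝒜 A B).symm
  rw [diskFraction, diskFraction, cls_eq_of_clsIdx (clsIdx_disk_eq hX i),
    cls_eq_of_clsIdx (clsIdx_disk_eq hY i), e X, e Y, e X', e Y', hX, hY]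

/-- `K_{X ⊞ Y, i}` and `K_{X,i} ⊞ K_{Y,i}` have the same invariants, and the class of the latter is
a multiple of the product. -/
theorem cls_disk_biprod (h𝒜 : IsHereditary 𝒜) (X Y : 𝒜) (i : ZMod t) :
    cls (disk (X ⊞ Y) i) =
      eulerForm X Y ^ (if t = 1 then 2 else 1) • (cls (disk X i) * cls (disk Y i)) := by
  have h : clsIdx (disk (X ⊞ Y) i) = clsIdx (disk X i ⊞ disk Y i) := by
    rw [clsIdx_biprod_of_acyclic (acyclic_disk X i), homCls_eq_of_acyclic (acyclic_disk Y i),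
      clsIdx, homCls_eq_of_acyclic (acyclic_disk (X ⊞ Y) i), imCls_disk, imCls_disk, imCls_disk,
      K₀.of_biprod, Pi.single_add]
  rw [cls_mul_cls_left h𝒜 (acyclic_disk X i), smul_smul, cls_eq_of_clsIdx h, eulerForm_disk h𝒜,
    mul_inv_cancel₀ (pow_ne_zero _ (eulerForm_ne_zero _ _)), one_smul]

theorem eulerForm_biprod_left (h𝒜 : IsHereditary 𝒜) (X Y Z : 𝒜) :
    eulerForm (X ⊞ Y) Z = eulerForm X Z * eulerForm Y Z := by
  rw [← euler_of h𝒜, K₀.of_biprod, euler_add_left, euler_of, euler_of]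

theorem eulerForm_biprod_right (h𝒜 : IsHereditary 𝒜) (X Y Z : 𝒜) :
    eulerForm X (Y ⊞ Z) = eulerForm X Y * eulerForm X Z := by
  rw [← euler_of h𝒜, K₀.of_biprod, euler_add_right, euler_of, euler_of]

theorem diskFraction_mul (X Y : 𝒜) (i : ZMod t) : diskFraction X Y i * cls (disk Y i) =
    ((eulerForm X Y / eulerForm Y Y) ^ (if t = 1 then 2 else 1))⁻¹ • cls (disk X i) := by
  rw [diskFraction, smul_mul_assoc, mul_assoc, Ring.inverse_mul_cancel _
    (isUnit_cls (acyclic_disk Y i)), mul_one]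

/-- After multiplication by the unit `[K_{Y ⊞ Z, i}]` both sides are multiples of `[K_{X,i}]
[K_{Z,i}]`. The normalizing Euler factor is what makes the scalars agree, by bilinearity. -/
theorem diskFraction_biprod (h𝒜 : IsHereditary 𝒜) (X Y Z : 𝒜) (i : ZMod t) :
    diskFraction (X ⊞ Z) (Y ⊞ Z) i = diskFraction X Y i := by
  have n := fun A B : 𝒜 => eulerForm_ne_zero A B
  apply (isUnit_cls (acyclic_disk (Y ⊞ Z) i)).mul_left_injective
  change _ * _ = _ * _
  rw [diskFraction_mul, cls_disk_biprod h𝒜 Y, mul_smul_comm, ← mul_assoc, diskFraction_mul,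
    smul_mul_assoc, cls_disk_biprod h𝒜 X, smul_smul, smul_smul]
  congr 1
  rw [← inv_pow, ← inv_pow, ← mul_pow, ← mul_pow, eulerForm_biprod_left h𝒜,
    eulerForm_biprod_left h𝒜, eulerForm_biprod_right h𝒜, eulerForm_biprod_right h𝒜,
    eulerForm_biprod_right h𝒜]
  congr 1
  have h1 := n X Y
  have h2 := n X Z
  have h3 := n Y Y
  have h4 := n Y Z
  have h5 := n Z Y
  have h6 := n Z Z
  field_simp

/-- Adding `Y'` to `X` and `Y`, and `Y` to `X'` and `Y'`, gives numerators and denominators with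
equal classes in `K₀`, on which the fraction depends. -/
theorem diskFraction_eq (h𝒜 : IsHereditary 𝒜) {X Y X' Y' : 𝒜}
    (h : K₀.of X - K₀.of Y = K₀.of X' - K₀.of Y') (i : ZMod t) :
    diskFraction X Y i = diskFraction X' Y' i := by
  rw [← diskFraction_biprod h𝒜 X Y Y', ← diskFraction_biprod h𝒜 X' Y' Y]
  refine diskFraction_congr h𝒜 ?_ ?_ i
  · rw [K₀.of_biprod, K₀.of_biprod]
    exact sub_eq_sub_iff_add_eq_add.1 h
  · rw [K₀.of_biprod, K₀.of_biprod, add_comm]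

/-- The element `K_{α,i}`. -/
noncomputable def diskClass (α : K₀ 𝒜) (i : ZMod t) : SemiDerivedHallAlgebra 𝒜 t :=
  diskFraction (K₀.exists_eq_sub α).choose (K₀.exists_eq_sub α).choose_spec.choose i

theorem diskClass_sub (h𝒜 : IsHereditary 𝒜) (X Y : 𝒜) (i : ZMod t) :
    diskClass (K₀.of X - K₀.of Y) i = diskFraction X Y i :=
  diskFraction_eq h𝒜 (K₀.exists_eq_sub (K₀.of X - K₀.of Y)).choose_spec.choose_spec.symm i

theorem cls_mul_comm_of_acyclic (h𝒜 : IsHereditary 𝒜) {K L : PeriodicComplex 𝒜 t}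
    (hK : K.Acyclic) : cls K * cls L = (eulerForm L K / eulerForm K L) • (cls L * cls K) := by
  change NCLocalization.map _ _ (quotOf K) * NCLocalization.map _ _ (quotOf L) =
    _ • (NCLocalization.map _ _ (quotOf L) * NCLocalization.map _ _ (quotOf K))
  rw [← map_mul, ← map_mul, quotOf_comm h𝒜 hK, map_smul]

theorem isFraction_diskClass (h𝒜 : IsHereditary 𝒜) (α : K₀ 𝒜) (i : ZMod t) :
    ∃ P : PeriodicComplex 𝒜 t, P.Acyclic ∧
      IsFraction P (diskClass α i) (Pi.single (i - 1) α, fun _ => isoClass 0) := by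
  obtain ⟨X, Y, rfl⟩ := K₀.exists_eq_sub α
  have n := fun A B : PeriodicComplex 𝒜 t => eulerForm_ne_zero A B
  refine ⟨disk Y i, acyclic_disk Y i, _, disk X i, mul_ne_zero (inv_ne_zero (pow_ne_zero
    (if t = 1 then 2 else 1) (div_ne_zero (eulerForm_ne_zero X Y) (eulerForm_ne_zero Y Y)))) (div_ne_zero
    (n (disk X i) (disk Y i)) (n (disk Y i) (disk X i))), ?_, ?_⟩
  · rw [diskClass_sub h𝒜, diskFraction, mul_smul_comm, ← mul_assoc,
      cls_mul_comm_of_acyclic h𝒜 (acyclic_disk Y i), smul_mul_assoc, mul_assoc,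
      Ring.mul_inverse_cancel _ (isUnit_cls (acyclic_disk Y i)), mul_one, smul_smul]
  · rw [clsIdx, homCls_eq_of_acyclic (acyclic_disk X i), imCls_disk, imCls_disk, ← Pi.single_add,
      add_sub_cancel]

theorem isFraction_prod_diskClass (h𝒜 : IsHereditary 𝒜) (α : ZMod t → K₀ 𝒜) (l : List ℕ) :
    ∃ P : PeriodicComplex 𝒜 t, P.Acyclic ∧
      IsFraction P (l.map fun j : ℕ => diskClass (α j) (j : ZMod t)).prod
        ((l.map fun j : ℕ => (Pi.single ((j : ZMod t) - 1) (α j) : ZMod t → K₀ 𝒜)).sum,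
          fun _ => isoClass 0) := by
  induction l with
  | nil =>
    refine ⟨0, acyclic_zero, ?_⟩
    have h := isFraction_cls (0 : PeriodicComplex 𝒜 t)
    rwa [cls_zero, clsIdx, imCls_zero, homCls_eq_of_acyclic acyclic_zero] at h
  | cons j l ih =>
    obtain ⟨P, hP, h⟩ := ih
    obtain ⟨Q, hQ, h'⟩ := isFraction_diskClass h𝒜 (α j) (j : ZMod t)
    rw [List.map_cons, List.prod_cons, List.map_cons, List.sum_cons]
    exact ⟨P ⊞ Q, acyclic_biprod hP hQ, h'.mul h𝒜 hP h⟩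

/-- `K_{α,j}` contributes in degree `j - 1`, so degree `i` receives the class with index `i + 1`;
the representatives `0, ..., t - 1` meet each degree once. -/
theorem sum_range_single {G : Type*} [AddCommGroup G] (α : ZMod t → G) :
    ((List.range t).map fun j : ℕ => (Pi.single ((j : ZMod t) - 1) (α j) : ZMod t → G)).sum =
      fun i => α (i + 1) := by
  rw [← List.sum_toFinset _ List.nodup_range, List.toFinset_range]
  funext i
  rw [Finset.sum_apply, Finset.sum_eq_single (i + 1).val]
  · rw [ZMod.natCast_zmod_val, add_sub_cancel_right, Pi.single_eq_same]
  · intro j hj hji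
    refine Pi.single_eq_of_ne (fun h => hji ?_) _
    rw [h, sub_add_cancel, ZMod.val_cast_of_lt (Finset.mem_range.1 hj)]
  · exact fun h => absurd (Finset.mem_range.2 (ZMod.val_lt _)) h

theorem isFraction_generator (h𝒜 : IsHereditary 𝒜) (α : ZMod t → K₀ 𝒜) (A : ZMod t → 𝒜) :
    ∃ P : PeriodicComplex 𝒜 t, P.Acyclic ∧
      IsFraction P (((List.range t).map fun j : ℕ => diskClass (α j) (j : ZMod t)).prod *
        cls (stalkSum A)) (fun i => α (i + 1), fun i => isoClass (A i)) := by
  obtain ⟨P, hP, h⟩ := isFraction_prod_diskClass h𝒜 α (List.range t)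
  rw [sum_range_single] at h
  have h' := isFraction_cls (stalkSum A)
  rw [clsIdx_stalkSum] at h'
  have h2 := h.mul h𝒜 acyclic_zero h'
  rw [add_zero] at h2
  exact ⟨0 ⊞ P, acyclic_biprod acyclic_zero hP, h2⟩

theorem exists_basis (h𝒜 : IsHereditary 𝒜) :
    ∃ b : Module.Basis ((ZMod t → K₀ 𝒜) × (ZMod t → IsoClass 𝒜)) ℚ (SemiDerivedHallAlgebra 𝒜 t),
      ∀ (α : ZMod t → K₀ 𝒜) (A : ZMod t → 𝒜), b (α, fun i => isoClass (A i)) =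
        ((List.range t).map fun j : ℕ => diskClass (α j) (j : ZMod t)).prod *
          cls (stalkSum A) := by
  let x : (ZMod t → K₀ 𝒜) × (ZMod t → IsoClass 𝒜) → SemiDerivedHallAlgebra 𝒜 t := fun c =>
    ((List.range t).map fun j : ℕ => diskClass (c.1 j) (j : ZMod t)).prod *
      cls (stalkSum fun i => (c.2 i).out)
  -- The cyclic shift `α ↦ (i ↦ α (i + 1))` that relates the parameters of the basis to the
  -- invariants of the fractions.
  let σ : (ZMod t → K₀ 𝒜) × (ZMod t → IsoClass 𝒜) ≃ ClassIndex 𝒜 t :=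
    ((Equiv.addRight (1 : ZMod t)).arrowCongr (Equiv.refl _)).symm.prodCongr (Equiv.refl _)
  have hx : ∀ c, ∃ P : PeriodicComplex 𝒜 t, P.Acyclic ∧ IsFraction P (x c) (σ c) := by
    intro c
    have h := isFraction_generator h𝒜 c.1 fun i => (c.2 i).out
    have e : (fun i => isoClass (c.2 i).out) = c.2 := funext fun i => Quotient.out_eq _
    rw [e] at h
    exact h
  refine ⟨Module.Basis.mk (linearIndependent_of_isFraction h𝒜 σ.injective hx)
    (span_eq_top_of_isFraction h𝒜 σ.surjective hx).ge, fun α A => ?_⟩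
  rw [Module.Basis.mk_apply]
  change _ * _ = _ * _
  -- The basis is built from chosen representatives; replacing them by the `A i` leaves the
  -- invariants, and hence the class, unchanged.
  refine congrArg _ (cls_eq_of_clsIdx ?_)
  rw [clsIdx_stalkSum, clsIdx_stalkSum]
  exact Prod.ext rfl (funext fun i => Quotient.out_eq _)

end Generators

end SemiDerivedHall

theorem theorem3p12 {k : Type*} [Field k] [Finite k]
    {𝒜 : Type u} [Category.{v} 𝒜] [Abelian 𝒜] [Linear k 𝒜] [SemiDerivedHall.FinitaryCategory 𝒜]
    (h𝒜 : SemiDerivedHall.IsHereditary 𝒜) (t : ℕ) [NeZero t] :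
    ∃ K : SemiDerivedHall.K₀ 𝒜 → ZMod t → SemiDerivedHall.SemiDerivedHallAlgebra 𝒜 t,
      (∀ (X Y : 𝒜) (i : ZMod t),
        K (SemiDerivedHall.K₀.of X - SemiDerivedHall.K₀.of Y) i =
          ((SemiDerivedHall.eulerForm X Y / SemiDerivedHall.eulerForm Y Y) ^
              (if t = 1 then 2 else 1))⁻¹ •
            (SemiDerivedHall.cls (SemiDerivedHall.disk X i) *
              Ring.inverse (SemiDerivedHall.cls (SemiDerivedHall.disk Y i)))) ∧
      ∃ b : Module.Basis ((ZMod t → SemiDerivedHall.K₀ 𝒜) × (ZMod t → SemiDerivedHall.IsoClass 𝒜))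
          ℚ (SemiDerivedHall.SemiDerivedHallAlgebra 𝒜 t),
        ∀ (α : ZMod t → SemiDerivedHall.K₀ 𝒜) (A : ZMod t → 𝒜),
          b (α, fun i => SemiDerivedHall.isoClass (A i)) =
            ((List.range t).map fun j : ℕ => K (α j) j).prod *
              SemiDerivedHall.cls (SemiDerivedHall.stalkSum A) :=
  ⟨SemiDerivedHall.diskClass, SemiDerivedHall.diskClass_sub h𝒜, SemiDerivedHall.exists_basis h𝒜⟩
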